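/- **Problem and assumptions.** Let $B,n_1,\dots,n_B,l$ be nonnegative integers, $x=(x_1,\dots,x_B)\in\mathbb R^{n}=\mathbb R^{n_1}\times\cdots\times\mathbb R^{n_B}$ with the Euclidean norm, and consider $$\min\{\phi(x):=f(x)+h(x): Ax=d\},\qquad h(x)=\sum_{t=1}^B h_t(x_t),\quad Ax=\sum_{t=1}^B A_tx_t\in\mathbb R^l .$$ Assume: (A1) each $h_t:\mathbb R^{n_t}\to(-\infty,\infty]$ is proper, lower semicontinuous and convex with compact domain $\mathcal H_t$; put $\mathcal H=\mathcal H_1\times\cdots\times\mathcal H_B$; (A2) $A\neq0$ and $\mathcal F:=\{x\in\mathcal H:Ax=d\}\neq\emptyset$; (A3) $h$ is $K_h$-Lipschitz on $\mathcal H$, $K_h\ge0$; (A4) for every $t$ there is $m_t\ge0$ such that $u\mapsto f(x_{<t},u,x_{>t})+\frac{m_t}{2}\|u\|^2$ is convex on $\mathcal H_t$ for all $x\in\mathcal H$; (A5) $f$ is differentiable on $\mathcal H$, $\nabla f$ is bounded on $\mathcal H$, and for every $t$ there is $M_t\ge0$ with $\|\nabla_{x_t}f(x_{\le t},\tilde x_{>t})-\nabla_{x_t}f(x_{\le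 t},x_{>t})\|\le M_t\|\tilde x_{>t}-x_{>t}\|$ for all $x,\tilde x\in\mathcal H$ (for $t=B$ this is vacuous); (A6) there is $z_\dagger\in\mathcal F$ with $d_\dagger:=\mathrm{dist}(z_\dagger,\partial\mathcal H)>0$. A pair $(z,q)\in\mathcal H\times\mathbb R^l$ is $(\rho,\eta)$-stationary if $\mathrm{dist}(0,\nabla f(z)+A^*q+\partial h(z))\le\rho$ and $\|Az-d\|\le\eta$. **Method.** Put $m=\max_tm_t$, $M=\max_tM_t$. Let $\lambda\in(0,1/(2m)]$ (any $\lambda>0$ if $m=0$), $c_1>0$, $\bar z^0\in\mathcal H$, $(\rho,\eta)\in(0,1)^2$ and $(\chi,\theta)\in(0,1]^2$ with $2\chi B(2-\theta)(1-\theta)\le\theta^2$. Let $\mathcal L_c^\theta(x;p)=\phi(x)+(1-\theta)\langle p,Ax-d\rangle+\frac c2\|Ax-d\|^2$. *Static method* with input $(x^0,p^0,c)$: for $k=1,2,\dots$ compute successively, for $t=1,\dots,B$, $$x_t^k=\operatorname*{argmin}_{u}\{\lambda\mathcal L_c^\theta(x_{<t}^k,u,x_{>t}^{k-1};p^{k-1})+\tfrac12\|u-x_t^{k-1}\|^2\};$$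 set $q^k=(1-\theta)p^{k-1}+c(Ax^k-d)$, $p^k=(1-\theta)p^{k-1}+\chi c(Ax^k-d)$ and $$v_t^k=\nabla_{x_t}f(x^k)-\nabla_{x_t}f(x_{\le t}^k,x_{>t}^{k-1})+cA_t^*\sum_{s>t}A_s(x_s^k-x_s^{k-1})-\tfrac1\lambda(x_t^k-x_t^{k-1}).$$ Return $(x^k,p^k,q^k,v^k)$ successfully if $\|v^k\|\le\rho$ and $\|Ax^k-d\|\le\eta$; otherwise return it unsuccessfully if $k\ge3$ is even and $$\frac1\rho\cdot\frac2{k+2}\sum_{i=k/2}^k\|v^i\|+\frac1\eta\sqrt{\frac{c^3}{k}}\cdot\frac2{k+2}\sum_{i=k/2}^k\|Ax^i-d\|\le1 .$$ *Dynamic method (DP.ADMM)*: $\bar p^0=0$; for $\ell=1,2,\dots$ call the static method with input $(\bar z^{\ell-1},\bar p^{\ell-1},c_\ell)$ to obtain $(\bar z^\ell,\bar p^\ell,\bar q^\ell,\bar v^\ell)$; stop with output $(\bar z^\ell,\bar q^\ell)$ if the call is successful, and otherwise set $c_{\ell+1}=2c_\ell$. **Constants.** $D_\dagger=\sup_{\mathcal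 H}\|z-z_\dagger\|$, $G_f=\sup_{\mathcal H}\|\nabla f\|$, $\Delta_\phi=\sup_{\mathcal H}\phi-\inf_{\mathcal H}\phi$, $\sigma_A^+$ the smallest positive singular value of $A$, $\|A\|_\dagger=\sum_t\|A_t\|$, $$\kappa_0=\frac{2B^2(\lambda M+1)}{\sqrt\lambda},\quad \kappa_1=\frac{\chi\|A\|D_\dagger}{\theta},\quad \kappa_2=\frac1\theta\Big[1+\frac{2\chi D_\dagger(K_h+G_f)}{\theta d_\dagger\sigma_A^+}\Big]+1,\quad \kappa_3=\frac{108\kappa_2^2}{\chi^2},$$ $$\kappa_4=\frac{\theta d_\dagger\sigma_A^+}{\chi D_\dagger},\quad \kappa_5=8(B-1)\|A\|_\dagger^2,\quad \kappa_6=3+\frac{8\kappa_0^2\Delta_\phi}{\kappa_4^2},$$ $$\tilde\kappa^{(0)}=2\Big(\sqrt{\Delta_\phi}+\frac{5\kappa_2}{\chi\sqrt{c_1}}\Big),\quad \tilde\kappa^{(1)}=3\kappa_0^2[\tilde\kappa^{(0)}]^2,\quad \tilde\kappa^{(2)}=3\kappa_5[\tilde\kappa^{(0)}]^2,$$ $$\xi^{(0)}=\frac8{\kappa_4^2}\Big[\frac{81\kappa_0^2\kappa_1^2}{\chi^2}+\kappa_5\Delta_\phi\Big]+3(1-\theta)\kappa_1,\quad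 \xi^{(1)}=\frac{648\,\kappa_5\kappa_1^2}{\chi^2\kappa_4^2},$$ $$T_1=48\big(\kappa_6+\tilde\kappa^{(1)}+(\xi^{(0)}+\kappa_3+\tilde\kappa^{(2)})c_1+\xi^{(1)}c_1^2\big),\quad E_0=2\Big(1+\frac{T_1^2}{c_1^3}\Big),\quad E_1=2\sqrt{\frac{T_1}{c_1^3}}.$$ **Theorem.** Every subproblem met by DP.ADMM has a unique solution, and DP.ADMM stops and outputs a $(\rho,\eta)$-stationary pair. The total number of iterations of the static method over all calls is at most $$T_1\Big(2E_0^2+\frac{E_0+2E_1^2}{\varepsilon^2}+\frac{E_1}{\varepsilon^3}\Big),\qquad \varepsilon=\min\{\rho,\eta\}.$$ In particular it is at most $C\varepsilon^{-3}$ with a constant $C$ that does not depend on $(\rho,\eta)$ or $\bar z^0$. -/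

import Mathlib

open scoped BigOperators

noncomputable section

namespace DPADMM

/-- The product space `ℝ^{n_1} × ⋯ × ℝ^{n_B}` with its Euclidean (Hilbert) structure. -/
abbrev Blocks {B : ℕ} (n : Fin B → ℕ) : Type :=
  PiLp 2 (fun t : Fin B => EuclideanSpace ℝ (Fin (n t)))

/-- The data of `min { f(x) + ∑ t, h_t(x_t) : ∑ t, A_t x_t = d }`.
Only the values of `f` on the domain of `h` matter. -/
structure Problem (B : ℕ) (n : Fin B → ℕ) (l : ℕ) where
  f : Blocks n → ℝ
  hBlock : ∀ t : Fin B, EuclideanSpace ℝ (Fin (n t)) → EReal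
  ABlock : ∀ t : Fin B, EuclideanSpace ℝ (Fin (n t)) →L[ℝ] EuclideanSpace ℝ (Fin l)
  d : EuclideanSpace ℝ (Fin l)

/-- `(y_{<t}, u, x_{>t})`. -/
def splice {B : ℕ} {n : Fin B → ℕ} (y : Blocks n) (t : Fin B)
    (u : EuclideanSpace ℝ (Fin (n t))) (x : Blocks n) : Blocks n :=
  WithLp.toLp 2 (Function.update (fun s => if s < t then y s else x s) t u)

/-- `‖x_{>t} - y_{>t}‖`. -/
def tailDist {B : ℕ} {n : Fin B → ℕ} (t : Fin B) (x y : Blocks n) : ℝ :=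
  Real.sqrt (∑ s ∈ Finset.Ioi t, ‖x s - y s‖ ^ 2)

/-- `g` is a proper lower semicontinuous convex function with values in `(-∞, ∞]`. -/
structure IsClosedProperConvex {E : Type*} [NormedAddCommGroup E] [NormedSpace ℝ E]
    (g : E → EReal) : Prop where
  ne_bot : ∀ x, g x ≠ ⊥
  proper : ∃ x, g x < ⊤
  lsc : LowerSemicontinuous g
  convex_epigraph : Convex ℝ {z : E × ℝ | g z.1 ≤ (z.2 : EReal)}

/-- The subdifferential of `g` at `z`. -/
def subdiff {E : Type*} [NormedAddCommGroup E] [InnerProductSpace ℝ E]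
    (g : E → EReal) (z : E) : Set E :=
  {ξ | ∀ u, g z + ((inner ℝ ξ (u - z) : ℝ) : EReal) ≤ g u}

namespace Problem

variable {B : ℕ} {n : Fin B → ℕ} {l : ℕ} (P : Problem B n l)

/-- `h(x) = ∑ t, h_t(x_t)`. -/
def h (x : Blocks n) : EReal := ∑ t, P.hBlock t (x t)

/-- `A x = ∑ t, A_t x_t`. -/
def A : Blocks n →L[ℝ] EuclideanSpace ℝ (Fin l) :=
  ∑ t, (P.ABlock t).comp (PiLp.proj 2 (fun t : Fin B => EuclideanSpace ℝ (Fin (n t))) t)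

/-- `ℋ_t = dom h_t`. -/
def domBlock (t : Fin B) : Set (EuclideanSpace ℝ (Fin (n t))) := {u | P.hBlock t u < ⊤}

/-- `ℋ = ℋ_1 × ⋯ × ℋ_B`. -/
def dom : Set (Blocks n) := {x | ∀ t, x t ∈ P.domBlock t}

/-- The feasible set `ℱ = {x ∈ ℋ : A x = d}`. -/
def feasible : Set (Blocks n) := {x ∈ P.dom | P.A x = P.d}

/-- The gradient of `f` relative to `ℋ`. It is the usual gradient wherever `f` is differentiable
in a neighbourhood, and is uniquely determined when `ℋ` is convex with nonempty interior. -/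
def grad (x : Blocks n) : Blocks n := gradientWithin P.f P.dom x

/-- `φ = f + h` on `ℋ`. -/
def phi (x : Blocks n) : ℝ := P.f x + (P.h x).toReal

/-- `(z, q)` is a `(ρ, η)`-stationary pair: `z ∈ ℋ`,
`dist(0, ∇f(z) + A^* q + ∂h(z)) ≤ ρ` and `‖A z - d‖ ≤ η`. -/
def IsStationaryPair (ρ η : ℝ) (z : Blocks n) (q : EuclideanSpace ℝ (Fin l)) : Prop :=
  z ∈ P.dom ∧
  Metric.infEDist (0 : Blocks n)
      ((fun ξ => P.grad z + ContinuousLinearMap.adjoint P.A q + ξ) '' subdiff P.h z)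
    ≤ ENNReal.ofReal ρ ∧
  ‖P.A z - P.d‖ ≤ η

/-- The dampened augmented Lagrangian
`φ(x) + (1 - θ) ⟨p, A x - d⟩ + (c / 2) ‖A x - d‖²`, equal to `⊤` off `ℋ`. -/
def lagrangian (θ c : ℝ) (x : Blocks n) (p : EuclideanSpace ℝ (Fin l)) : EReal :=
  (P.f x : EReal) + P.h x +
    (((1 - θ) * inner ℝ p (P.A x - P.d) + c / 2 * ‖P.A x - P.d‖ ^ 2 : ℝ) : EReal)

end Problem

/-- The constants named in the assumptions: `K_h`, `m_t`, `M_t` and the point `z_†`.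
(`M_t` for the last block is unconstrained apart from its sign.) -/
structure Moduli {B : ℕ} (n : Fin B → ℕ) where
  Kh : ℝ
  mBlock : Fin B → ℝ
  MBlock : Fin B → ℝ
  zdag : Blocks n

/-- The standing assumptions on the problem. -/
structure Assumptions {B : ℕ} {n : Fin B → ℕ} {l : ℕ} (P : Problem B n l) (K : Moduli n) :
    Prop where
  closedConvex : ∀ t, IsClosedProperConvex (P.hBlock t)
  compactDom : ∀ t, IsCompact (P.domBlock t)
  A_ne_zero : P.A ≠ 0
  feasible_nonempty : P.feasible.Nonempty
  Kh_nonneg : 0 ≤ K.Kh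
  h_lipschitz : ∀ x ∈ P.dom, ∀ y ∈ P.dom,
    |(P.h x).toReal - (P.h y).toReal| ≤ K.Kh * ‖x - y‖
  m_nonneg : ∀ t, 0 ≤ K.mBlock t
  weaklyConvex : ∀ t, ∀ x ∈ P.dom, ConvexOn ℝ (P.domBlock t)
    (fun u => P.f (splice x t u x) + K.mBlock t / 2 * ‖u‖ ^ 2)
  f_differentiable : DifferentiableOn ℝ P.f P.dom
  M_nonneg : ∀ t, 0 ≤ K.MBlock t
  grad_lipschitz : ∀ t, ∀ x ∈ P.dom, ∀ y ∈ P.dom,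
    ‖P.grad (splice x t (x t) y) t - P.grad x t‖ ≤ K.MBlock t * tailDist t y x
  /-- `sup_ℋ ‖∇f‖` is finite; this holds in particular if `∇f` is Lipschitz on `ℋ`. -/
  grad_bounded : BddAbove ((fun x => ‖P.grad x‖) '' P.dom)
  zdag_feasible : K.zdag ∈ P.feasible
  zdag_interior : 0 < Metric.infDist K.zdag (frontier P.dom)

/-- Prox stepsize `λ`, under-relaxation parameter `χ`, dampening parameter `θ`. -/
structure Params where
  lam : ℝ
  chi : ℝ
  theta : ℝ

/-- `m = max_t m_t`. -/
def Moduli.m {B : ℕ} {n : Fin B → ℕ} (K : Moduli n) : ℝ := ⨆ t, K.mBlock t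

/-- `M = max_t M_t`. -/
def Moduli.M {B : ℕ} {n : Fin B → ℕ} (K : Moduli n) : ℝ := ⨆ t, K.MBlock t

/-- `λ ∈ (0, 1/(2m)]` (any `λ > 0` if `m = 0`), `(χ, θ) ∈ (0,1]²` and
`2 χ B (2 - θ)(1 - θ) ≤ θ²`. -/
structure Params.Admissible {B : ℕ} {n : Fin B → ℕ} (S : Params) (K : Moduli n) : Prop where
  lam_pos : 0 < S.lam
  lam_le : 2 * K.m * S.lam ≤ 1
  chi_pos : 0 < S.chi
  chi_le : S.chi ≤ 1
  theta_pos : 0 < S.theta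
  theta_le : S.theta ≤ 1
  chi_theta : 2 * S.chi * B * (2 - S.theta) * (1 - S.theta) ≤ S.theta ^ 2

section Constants

variable {B : ℕ} {n : Fin B → ℕ} {l : ℕ} (P : Problem B n l) (K : Moduli n) (S : Params)

/-- `D_† = sup_{z ∈ ℋ} ‖z - z_†‖`. -/
def Ddag : ℝ := sSup ((fun z => ‖z - K.zdag‖) '' P.dom)

/-- `d_† = dist(z_†, ∂ℋ)`. -/
def ddag : ℝ := Metric.infDist K.zdag (frontier P.dom)

/-- `G_f = sup_{x ∈ ℋ} ‖∇f(x)‖`. -/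
def Gf : ℝ := sSup ((fun x => ‖P.grad x‖) '' P.dom)

/-- `Δ_φ = sup_ℋ φ - inf_ℋ φ`. -/
def deltaPhi : ℝ := sSup (P.phi '' P.dom) - sInf (P.phi '' P.dom)

/-- The smallest positive singular value of `A`. -/
def sigmaPlus : ℝ :=
  sInf {s : ℝ | 0 < s ∧ ∃ i : ℕ,
    (P.A : Blocks n →ₗ[ℝ] EuclideanSpace ℝ (Fin l)).singularValues i = s}

/-- `‖A‖_† = ∑ t, ‖A_t‖`. -/
def normADag : ℝ := ∑ t, ‖P.ABlock t‖

def kappa0 : ℝ := 2 * (B : ℝ) ^ 2 * (S.lam * K.M + 1) / Real.sqrt S.lam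

def kappa1 : ℝ := S.chi * ‖P.A‖ * Ddag P K / S.theta

def kappa2 : ℝ :=
  1 / S.theta *
    (1 + 2 * S.chi * Ddag P K * (K.Kh + Gf P) / (S.theta * ddag P K * sigmaPlus P)) + 1

def kappa3 : ℝ := 108 * kappa2 P K S ^ 2 / S.chi ^ 2

def kappa4 : ℝ := S.theta * ddag P K * sigmaPlus P / (S.chi * Ddag P K)

def kappa5 : ℝ := 8 * ((B : ℝ) - 1) * normADag P ^ 2

def kappa6 : ℝ := 3 + 8 * kappa0 K S ^ 2 * deltaPhi P / kappa4 P K S ^ 2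

def kappaTilde0 (cLow : ℝ) : ℝ :=
  2 * (Real.sqrt (deltaPhi P) + 5 * kappa2 P K S / (S.chi * Real.sqrt cLow))

def kappaTilde1 (cLow : ℝ) : ℝ := 3 * kappa0 K S ^ 2 * kappaTilde0 P K S cLow ^ 2

def kappaTilde2 (cLow : ℝ) : ℝ := 3 * kappa5 P * kappaTilde0 P K S cLow ^ 2

def xi0 (R : ℝ) : ℝ :=
  8 / kappa4 P K S ^ 2 *
      (9 * kappa0 K S ^ 2 * (R + kappa1 P K S) ^ 2 / S.chi ^ 2 + kappa5 P * deltaPhi P)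
    + (1 - S.theta) * (R + kappa1 P K S)

def xi1 (R : ℝ) : ℝ :=
  72 * kappa5 P * (R + kappa1 P K S) ^ 2 / (S.chi ^ 2 * kappa4 P K S ^ 2)

/-- `𝒯_c(ρ, η | c̲, R)`. -/
def iterBound (c ρ η cLow R : ℝ) : ℝ :=
  48 * ((kappa6 P K S + kappaTilde1 P K S cLow / ρ ^ 2)
    + (xi0 P K S R + kappa3 P K S / η ^ 2 + kappaTilde2 P K S cLow / ρ ^ 2) * c
    + xi1 P K S R * c ^ 2)

/-- `T_1 = 𝒯_{c₁}(1, 1 | c₁, 2 κ₁)`. -/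
def T1 (c₁ : ℝ) : ℝ := iterBound P K S c₁ 1 1 c₁ (2 * kappa1 P K S)

def E0 (c₁ : ℝ) : ℝ := 2 * (1 + T1 P K S c₁ ^ 2 / c₁ ^ 3)

def E1 (c₁ : ℝ) : ℝ := 2 * Real.sqrt (T1 P K S c₁ / c₁ ^ 3)

/-- `T₁ (2 E₀² + (E₀ + 2 E₁²)/ε² + E₁/ε³)`. -/
def totalBound (c₁ ε : ℝ) : ℝ :=
  T1 P K S c₁ *
    (2 * E0 P K S c₁ ^ 2 + (E0 P K S c₁ + 2 * E1 P K S c₁ ^ 2) / ε ^ 2 + E1 P K S c₁ / ε ^ 3)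

end Constants

/-- A state of the dynamic method: the penalty parameter `c` of the current call of the static
method, the number `k` of iterations performed in this call so far, and the iterates
`x^0, …, x^k` and `p^0, …, p^k` of this call (entries with index above `k` are irrelevant). -/
structure State {B : ℕ} (n : Fin B → ℕ) (l : ℕ) where
  c : ℝ
  k : ℕ
  x : ℕ → Blocks n
  p : ℕ → EuclideanSpace ℝ (Fin l)

section Algorithm

variable {B : ℕ} {n : Fin B → ℕ} {l : ℕ} (P : Problem B n l) (S : Params)

/-- Step 1: `y` results from `x` by one cyclic sweep of exact block prox minimizations, i.e.
`y_t ∈ argmin_u { λ L_c^θ(y_{<t}, u, x_{>t}; p) + ½ ‖u - x_t‖² }` for every `t`. -/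
def IsProxSweep (c : ℝ) (x : Blocks n) (p : EuclideanSpace ℝ (Fin l)) (y : Blocks n) : Prop :=
  ∀ t, IsMinOn
    (fun u => (S.lam : EReal) * P.lagrangian S.theta c (splice y t u x) p
      + ((1 / 2 * ‖u - x t‖ ^ 2 : ℝ) : EReal)) Set.univ (y t)

/-- `q^i = (1 - θ) p^{i-1} + c (A x^i - d)`, for `i ≥ 1`. -/
def State.q (s : State n l) (i : ℕ) : EuclideanSpace ℝ (Fin l) :=
  (1 - S.theta) • s.p (i - 1) + s.c • (P.A (s.x i) - P.d)

/-- The residual `v^i`, for `i ≥ 1`. -/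
def State.v (s : State n l) (i : ℕ) : Blocks n :=
  WithLp.toLp 2 fun t =>
    (P.grad (s.x i) t - P.grad (splice (s.x i) t (s.x i t) (s.x (i - 1))) t)
      + s.c • ContinuousLinearMap.adjoint (P.ABlock t)
          (∑ j ∈ Finset.Ioi t, P.ABlock j (s.x i j - s.x (i - 1) j))
      - (1 / S.lam) • (s.x i t - s.x (i - 1) t)

/-- Step 2a: iteration `k` of the current call passes the successful termination test. -/
def State.Successful (ρ η : ℝ) (s : State n l) : Prop :=
  1 ≤ s.k ∧ ‖s.v P S s.k‖ ≤ ρ ∧ ‖P.A (s.x s.k) - P.d‖ ≤ η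

/-- Step 2b: iteration `k` of the current call passes the unsuccessful termination test. -/
def State.PassesErgodicTest (ρ η : ℝ) (s : State n l) : Prop :=
  Even s.k ∧ 3 ≤ s.k ∧
  1 / ρ * (2 / ((s.k : ℝ) + 2) * ∑ i ∈ Finset.Icc (s.k / 2) s.k, ‖s.v P S i‖)
    + 1 / η * Real.sqrt (s.c ^ 3 / (s.k : ℝ)) *
      (2 / ((s.k : ℝ) + 2) * ∑ i ∈ Finset.Icc (s.k / 2) s.k, ‖P.A (s.x i) - P.d‖) ≤ 1

/-- The current call of the static method returns at iteration `k`. -/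
def State.Returns (ρ η : ℝ) (s : State n l) : Prop :=
  s.Successful P S ρ η ∨ s.PassesErgodicTest P S ρ η

/-- The state at the start of a call with penalty parameter `c` and initial pair `(z, p)`. -/
def State.start (c : ℝ) (z : Blocks n) (p : EuclideanSpace ℝ (Fin l)) : State n l :=
  ⟨c, 0, fun _ => z, fun _ => p⟩

/-- The state after one more iteration, with new primal iterate `y` and the multiplier update
`p^{k+1} = (1 - θ) p^k + χ c (A y - d)`. -/
def State.next (s : State n l) (y : Blocks n) : State n l :=
  ⟨s.c, s.k + 1, Function.update s.x (s.k + 1) y,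
    Function.update s.p (s.k + 1)
      ((1 - S.theta) • s.p s.k + (S.chi * s.c) • (P.A y - P.d))⟩

/-- `Reach P S ρ η c₁ z₀ N s`: the dynamic method started with penalty parameter `c₁` at `z₀`
(and zero multiplier) can be in state `s` after a total of `N` iterations of the static method,
summed over all its calls. -/
inductive Reach (ρ η c₁ : ℝ) (z₀ : Blocks n) : ℕ → State n l → Prop
  | init : Reach ρ η c₁ z₀ 0 (State.start c₁ z₀ 0)
  | iterate {N : ℕ} {s : State n l} {y : Blocks n} :
      Reach ρ η c₁ z₀ N s → ¬ s.Returns P S ρ η → IsProxSweep P S s.c (s.x s.k) (s.p s.k) y →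
      Reach ρ η c₁ z₀ (N + 1) (s.next P S y)
  | newCall {N : ℕ} {s : State n l} :
      Reach ρ η c₁ z₀ N s → s.Returns P S ρ η → ¬ s.Successful P S ρ η →
      Reach ρ η c₁ z₀ N (State.start (2 * s.c) (s.x s.k) (s.p s.k))

end Algorithm

end DPADMM

end

/-! Consider one call with penalty `c`, continued forever without termination tests. Each block
subproblem is strongly convex, so a sweep lowers the augmented Lagrangian by a multiple of the
squared step. The dual step may raise it again, but after correction by multiples of `‖p^i‖²` and
`‖p^i - p^{i-1}‖²` the resulting potential `Ψ` is nonincreasing from index 1 on; this is where the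
condition linking `χ` and `θ` enters. Moreover `‖v^{i+1}‖² ≤ (κ/2)(Ψ_i - Ψ_{i+1})` with `κ = κ₀² +
κ₅ c` (`potential_decrease`, `sweepResidual_sq_le`).

The point is to bound the range of `Ψ` independently of `c`. A priori only `‖p^i‖ ≤ κ₁ c` is known,
which gives a range of order `1 + c`. The Slater point supplies the rest: `v - ∇f - A^*q` is a
subgradient of `h`, and testing it on a ball around `z_†` gives `‖p^{i+1}‖ ≤ (1-θ)‖p^i‖ +
(2θ/κ₄)(‖v^{i+1}‖ + K_h + G_f)` (`slater_bound`, `norm_dual_succ_le`). Over a window that is long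
compared with the crude range, the residuals average at most `κ₄/2`, hence the multipliers average
at most `κ₂` (`sum_a_le`). So a small multiplier occurs beyond every index, which bounds `Ψ` from
below, and two consecutive small ones occur early, which bounds `Ψ` from above. Afterwards the range
of `Ψ` is `Δ_φ + O(1/c)`, the residuals over the second half of the first `k` iterations average
`O(√(κ/k))`, and the infeasibility averages `O(1/c)`. The ergodic test is thus passed within a
quarter of `iterBound` (`ergodic_test`, `exists_passesErgodicTest`).

If that test is passed at some `k ≤ c³`, the infeasibility has weight at least `1/η`, and some
iterate of the window already passes the successful test. An unsuccessful return therefore forces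
`c³ < k`. Compared with the cost bound, of order `c/ε² + c²` for fixed `c₁`, this gives `c =
O(1/ε)`. Since `c` doubles, the total cost is dominated by the last call and is `O(ε⁻³)`
(`sum_call_cost_le`). Sweeps are unique, so the actual run follows these infinite sequences
(`CallInvariant`), and a bounded iteration count forces the method to stop. -/

open scoped BigOperators

noncomputable section

namespace DPADMM

/-! ### Scalar analysis of potential, residual and multiplier norms -/

section Scalar

/-- Cauchy–Schwarz against the constant sequence. -/
theorem sum_le_of_sum_sq_le {ι : Type*} (s : Finset ι) (V : ι → ℝ) {C r : ℝ}
    (hr : 0 ≤ r) (h : ∑ i ∈ s, V i ^ 2 ≤ C) (hC : C ≤ s.card * r ^ 2) :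
    ∑ i ∈ s, V i ≤ s.card * r := by
  have h1 : (∑ i ∈ s, V i) ^ 2 ≤ s.card * ∑ i ∈ s, V i ^ 2 := sq_sum_le_card_mul_sum_sq
  have h2 : (0 : ℝ) ≤ s.card := Nat.cast_nonneg _
  apply abs_le_of_sq_le_sq' _ (by positivity) |>.2
  calc _ ≤ _ := h1
    _ ≤ s.card * (s.card * r ^ 2) := by gcongr; linarith
    _ = _ := by ring

/-- The scalar quantities that drive the analysis of the static method: `a i = ‖p^i‖`,
`V i = ‖v^i‖`, `φ i = ‖A x^i - d‖` and the potential `Ψ i`. -/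
structure StaticSequence (a V φ Ψ : ℕ → ℝ) (θ χ c κ κ₁ κ₄ G lo hi : ℝ) : Prop where
  theta_pos : 0 < θ
  theta_le : θ ≤ 1
  chi_pos : 0 < χ
  c_pos : 0 < c
  kappa_nonneg : 0 ≤ κ
  kappa4_pos : 0 < κ₄
  G_nonneg : 0 ≤ G
  a_nonneg : ∀ i, 0 ≤ a i
  V_sq : ∀ i, 1 ≤ i → V (i + 1) ^ 2 ≤ κ / 2 * (Ψ i - Ψ (i + 1))
  psi_anti : ∀ i, 1 ≤ i → Ψ (i + 1) ≤ Ψ i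
  psi_le : ∀ i R, a i ≤ R → a (i + 1) ≤ R → Ψ (i + 1) ≤ hi + 2 * R ^ 2 / (χ ^ 2 * c)
  le_psi : ∀ i, lo - a (i + 1) ^ 2 / (2 * χ ^ 2 * c) ≤ Ψ (i + 1)
  a_succ : ∀ i, a (i + 1) ≤ (1 - θ) * a i + 2 * θ / κ₄ * (V (i + 1) + G)
  a_le : ∀ i, a i ≤ κ₁ * c
  phi_le : ∀ i, χ * c * φ (i + 1) ≤ a i + a (i + 1)

namespace StaticSequence

variable {a V φ Ψ : ℕ → ℝ} {θ χ c κ κ₁ κ₄ G lo hi : ℝ}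

theorem psi_antitone (h : StaticSequence a V φ Ψ θ χ c κ κ₁ κ₄ G lo hi)
    {i j : ℕ} (hi1 : 1 ≤ i) (hij : i ≤ j) : Ψ j ≤ Ψ i := by
  induction j, hij using Nat.le_induction with
  | base => exact le_rfl
  | succ n hn ih => exact (h.psi_anti n (hi1.trans hn)).trans ih

theorem sum_V_sq_le (h : StaticSequence a V φ Ψ θ χ c κ κ₁ κ₄ G lo hi)
    {j : ℕ} (hj : 1 ≤ j) (L : ℕ) :
    ∑ i ∈ Finset.range L, V (j + i + 1) ^ 2 ≤ κ / 2 * (Ψ j - Ψ (j + L)) := by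
  induction L with
  | zero => simp
  | succ n ih =>
    rw [Finset.sum_range_succ]
    have := h.V_sq (j + n) (by omega)
    rw [show j + (n + 1) = j + n + 1 by ring]
    linarith

theorem sum_V_le (h : StaticSequence a V φ Ψ θ χ c κ κ₁ κ₄ G lo hi)
    {j : ℕ} (hj : 1 ≤ j) (L : ℕ) {D r : ℝ} (hr : 0 ≤ r)
    (hD : Ψ j - Ψ (j + L) ≤ D) (hL : κ / 2 * D ≤ L * r ^ 2) :
    ∑ i ∈ Finset.range L, V (j + i + 1) ≤ L * r := by
  have := sum_le_of_sum_sq_le (Finset.range L) (fun i => V (j + i + 1)) (C := κ / 2 * D) hr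
    ((h.sum_V_sq_le hj L).trans
      (mul_le_mul_of_nonneg_left hD (by linarith [h.kappa_nonneg])))
    (by simpa using hL)
  simpa using this

/-- Summing the recursion `a_succ` over a window: the part `(1 - θ) a` telescopes up to boundary
terms, and a fraction `θ` of the sum is left over. -/
theorem theta_sum_a_le (h : StaticSequence a V φ Ψ θ χ c κ κ₁ κ₄ G lo hi)
    (j L : ℕ) :
    θ * ∑ i ∈ Finset.range L, a (j + i + 1) ≤ (1 - θ) * (a j - a (j + L))
      + 2 * θ / κ₄ * (∑ i ∈ Finset.range L, V (j + i + 1) + L * G) := by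
  induction L with
  | zero => simp
  | succ n ih =>
    rw [Finset.sum_range_succ, Finset.sum_range_succ]
    have := h.a_succ (j + n)
    rw [show j + (n + 1) = j + n + 1 by ring]
    push_cast
    have e : 2 * θ / κ₄ * (∑ i ∈ Finset.range n, V (j + i + 1) + V (j + n + 1) + (n + 1) * G) =
      2 * θ / κ₄ * (∑ i ∈ Finset.range n, V (j + i + 1) + n * G)
       + 2 * θ / κ₄ * (V (j + n + 1) + G) := by ring
    rw [e]
    linarith

/-- Windows of sufficient length have a small average multiplier. -/
theorem sum_a_le (h : StaticSequence a V φ Ψ θ χ c κ κ₁ κ₄ G lo hi)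
    {j : ℕ} (hj : 1 ≤ j) (L : ℕ) {D : ℝ}
    (hD : Ψ j - Ψ (j + L) ≤ D) (hL : 2 * κ * D ≤ L * κ₄ ^ 2) (hL' : (1 - θ) * (κ₁ * c) ≤ L) :
    ∑ i ∈ Finset.range L, a (j + i + 1) ≤ L * (1 / θ * (1 + 2 * G / κ₄) + 1) := by
  have h4 := h.kappa4_pos
  have hθ := h.theta_pos
  -- With average residual `κ₄ / 2` the residuals contribute `θ` per index to the recursion; after
  -- division by `θ` this is the final `+ 1` of the bound.
  have h1 := h.sum_V_le hj L (r := κ₄ / 2) (by linarith) hD (by nlinarith)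
  have h2 := h.theta_sum_a_le j L
  -- The boundary term may be as large as `κ₁ c`; the second length condition spreads it over the
  -- window.
  have h3 : (1 - θ) * (a j - a (j + L)) ≤ L := by
    refine le_trans ?_ hL'
    apply mul_le_mul_of_nonneg_left _ (by linarith [h.theta_le])
    linarith [h.a_le j, h.a_nonneg (j + L)]
  have h5 : 2 * θ / κ₄ * (∑ i ∈ Finset.range L, V (j + i + 1) + L * G) ≤
      2 * θ / κ₄ * (L * (κ₄ / 2) + L * G) := by gcongr
  have h6 : 2 * θ / κ₄ * (L * (κ₄ / 2) + L * G) = θ * L + θ * L * (2 * G / κ₄) := by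
    field_simp
  have h7 : 0 ≤ 2 * G / κ₄ := div_nonneg (by linarith [h.G_nonneg]) h4.le
  have hLn : (0 : ℝ) ≤ L := Nat.cast_nonneg _
  have h8 : θ * ∑ i ∈ Finset.range L, a (j + i + 1) ≤
      θ * (L * (1 / θ * (1 + 2 * G / κ₄) + 1)) := by
    have e : θ * (L * (1 / θ * (1 + 2 * G / κ₄) + 1)) = L + L * (2 * G / κ₄) + θ * L := by
      field_simp
    rw [e]
    have := mul_le_mul_of_nonneg_right h.theta_le (mul_nonneg hLn h7)
    linarith
  exact le_of_mul_le_mul_left h8 hθ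

theorem le_psi_crude (h : StaticSequence a V φ Ψ θ χ c κ κ₁ κ₄ G lo hi)
    (i : ℕ) : lo - (κ₁ * c) ^ 2 / (2 * χ ^ 2 * c) ≤ Ψ (i + 1) := by
  refine le_trans ?_ (h.le_psi i)
  have := h.c_pos
  have := h.chi_pos
  gcongr
  · exact h.a_nonneg _
  · exact h.a_le _

/-- Uses only `a ≤ κ₁ c`. The range obtained still grows with `c`; it serves to decide how long a
window must be for small multipliers to appear. The factor `5/2` is `2` from the upper bound plus
`1/2` from the lower one. -/
theorem psi_sub_le_crude (h : StaticSequence a V φ Ψ θ χ c κ κ₁ κ₄ G lo hi)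
    {i j : ℕ} (hi1 : 1 ≤ i) (hj : 1 ≤ j) :
    Ψ i - Ψ j ≤ hi - lo + 5 / 2 * κ₁ ^ 2 * c / χ ^ 2 := by
  obtain ⟨i, rfl⟩ := Nat.exists_eq_add_of_le' hi1
  obtain ⟨j, rfl⟩ := Nat.exists_eq_add_of_le' hj
  have h1 := h.le_psi_crude j
  have h2 := h.psi_le i _ (h.a_le _) (h.a_le _)
  have hc := h.c_pos
  have hχ := h.chi_pos
  have e1 : (κ₁ * c) ^ 2 / (2 * χ ^ 2 * c) = 1 / 2 * κ₁ ^ 2 * c / χ ^ 2 := by field_simp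
  have e2 : 2 * (κ₁ * c) ^ 2 / (χ ^ 2 * c) = 2 * κ₁ ^ 2 * c / χ ^ 2 := by field_simp
  rw [e1] at h1
  rw [e2] at h2
  have e3 : 5 / 2 * κ₁ ^ 2 * c / χ ^ 2 = 2 * κ₁ ^ 2 * c / χ ^ 2 + 1 / 2 * κ₁ ^ 2 * c / χ ^ 2 := by
    ring
  linarith

/-- Beyond every index there is a small multiplier, whence a uniform lower bound on the
potential. -/
theorem le_psi_uniform (h : StaticSequence a V φ Ψ θ χ c κ κ₁ κ₄ G lo hi)
    {j : ℕ} (hj : 1 ≤ j) :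
    lo - (1 / θ * (1 + 2 * G / κ₄) + 1) ^ 2 / (2 * χ ^ 2 * c) ≤ Ψ j := by
  set κ₂ := 1 / θ * (1 + 2 * G / κ₄) + 1 with hκ₂
  have h4 := h.kappa4_pos
  set D := hi - lo + 5 / 2 * κ₁ ^ 2 * c / χ ^ 2
  -- Only the existence of a later small multiplier matters, so the length of the window is not
  -- tracked. It may reach beyond any termination of the call, which is why the sequence is taken to
  -- be infinite.
  obtain ⟨L, hL⟩ := exists_nat_ge (max (2 * κ * D / κ₄ ^ 2) (max ((1 - θ) * (κ₁ * c)) 1))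
  have hL1 : 2 * κ * D / κ₄ ^ 2 ≤ L := (le_max_left _ _).trans hL
  have hL2 : (1 - θ) * (κ₁ * c) ≤ L := ((le_max_left _ _).trans (le_max_right _ _)).trans hL
  have hL3 : (1 : ℝ) ≤ L := ((le_max_right _ _).trans (le_max_right _ _)).trans hL
  rw [div_le_iff₀ (by positivity)] at hL1
  have hs := h.sum_a_le hj L (h.psi_sub_le_crude hj (by omega)) hL1 hL2
  obtain ⟨i, -, hi⟩ : ∃ i ∈ Finset.range L, a (j + i + 1) ≤ κ₂ := by
    apply Finset.exists_le_of_sum_le (by simp; rintro rfl; norm_num at hL3)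
    rw [Finset.sum_const, Finset.card_range, nsmul_eq_mul]
    exact hs
  refine le_trans ?_ (h.psi_antitone hj (show j ≤ j + i + 1 by omega))
  refine le_trans ?_ (h.le_psi (j + i))
  have := h.c_pos
  have := h.chi_pos
  gcongr
  exact h.a_nonneg _

/-- After `2 m + 1` iterations the potential is bounded independently of the initial
multiplier. -/
theorem psi_le_uniform (h : StaticSequence a V φ Ψ θ χ c κ κ₁ κ₄ G lo hi)
    {m : ℕ} (hm : 1 ≤ m)
    (hL : 2 * κ * (hi - lo + 5 / 2 * κ₁ ^ 2 * c / χ ^ 2) ≤ m * κ₄ ^ 2)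
    (hL' : (1 - θ) * (κ₁ * c) ≤ m) {k : ℕ} (hk : 2 * m + 1 ≤ k) :
    Ψ k ≤ hi + 8 * (1 / θ * (1 + 2 * G / κ₄) + 1) ^ 2 / (χ ^ 2 * c) := by
  set κ₂ := 1 / θ * (1 + 2 * G / κ₄) + 1 with hκ₂
  have hmn : (0 : ℝ) ≤ m := Nat.cast_nonneg _
  have hs := h.sum_a_le le_rfl (2 * m) (h.psi_sub_le_crude le_rfl (by omega))
    (hL.trans (by push_cast; nlinarith [sq_nonneg κ₄]))
    (hL'.trans (by push_cast; linarith))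
  -- The upper bound `psi_le` needs two consecutive small multipliers. Grouping `2 m` of them in `m`
  -- pairs yields a pair with sum at most `2 κ₂`; then `R = 2 κ₂` produces the constant `8`.
  have hpair : ∑ i ∈ Finset.range (2 * m), a (1 + i + 1) =
      ∑ i ∈ Finset.range m, (a (2 * i + 2) + a (2 * i + 3)) := by
    clear * -
    induction m with
    | zero => simp
    | succ n ih =>
      rw [show 2 * (n + 1) = 2 * n + 1 + 1 by ring, Finset.sum_range_succ, Finset.sum_range_succ,
        Finset.sum_range_succ, ih]
      ring_nf
  rw [hpair] at hs
  obtain ⟨i, himem, hi'⟩ : ∃ i ∈ Finset.range m, a (2 * i + 2) + a (2 * i + 3) ≤ 2 * κ₂ := by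
    apply Finset.exists_le_of_sum_le (by simp; omega)
    refine hs.trans (le_of_eq ?_)
    simp; ring
  rw [Finset.mem_range] at himem
  refine (h.psi_antitone (show 1 ≤ 2 * i + 3 by omega) (by omega)).trans ?_
  have := h.psi_le (2 * i + 2) (2 * κ₂) (by linarith [h.a_nonneg (2 * i + 3)])
    (by linarith [h.a_nonneg (2 * i + 2)])
  refine this.trans (le_of_eq ?_)
  ring

/-- The ergodic test is passed at every sufficiently large even index. -/
theorem ergodic_test (h : StaticSequence a V φ Ψ θ χ c κ κ₁ κ₄ G lo hi)
    {m : ℕ} (hm : 1 ≤ m)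
    (hL : 2 * κ * (hi - lo + 5 / 2 * κ₁ ^ 2 * c / χ ^ 2) ≤ m * κ₄ ^ 2)
    (hL' : (1 - θ) * (κ₁ * c) ≤ m) {k : ℕ} (hk : 2 * m + 3 ≤ k) {ρ η : ℝ} (hρ : 0 < ρ)
    (hη : 0 < η)
    (hkρ : 2 * κ * (hi - lo + 9 * (1 / θ * (1 + 2 * G / κ₄) + 1) ^ 2 / (χ ^ 2 * c)) ≤
      k * ρ ^ 2)
    (hkη : 8 * (1 / θ * (1 + 2 * G / κ₄) + 1) ^ 2 * c ≤ k * (χ ^ 2 * η ^ 2)) :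
    1 / ρ * (2 / (((2 * k : ℕ) : ℝ) + 2) * ∑ i ∈ Finset.Icc (2 * k / 2) (2 * k), V i)
    + 1 / η * Real.sqrt (c ^ 3 / ((2 * k : ℕ) : ℝ)) *
      (2 / (((2 * k : ℕ) : ℝ) + 2) * ∑ i ∈ Finset.Icc (2 * k / 2) (2 * k), φ i) ≤ 1 := by
  set κ₂ := 1 / θ * (1 + 2 * G / κ₄) + 1 with hκ₂
  have hc := h.c_pos
  have hχ := h.chi_pos
  have hθ := h.theta_pos
  have h4 := h.kappa4_pos
  have hG := h.G_nonneg
  have hκ₂p : 0 < κ₂ := by positivity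
  have hmn : (0 : ℝ) ≤ m := Nat.cast_nonneg _
  have hmk : (m : ℝ) ≤ (k + 1 : ℕ) := by exact_mod_cast (by omega : m ≤ k + 1)
  -- The test is evaluated at `2 k`, so its window `k, …, 2 k` has `k + 1 = L` terms and starts at
  -- `j + 2`.
  obtain ⟨j, rfl⟩ : ∃ j, k = j + 2 := ⟨k - 2, by omega⟩
  have hwin : ∀ g : ℕ → ℝ, ∑ i ∈ Finset.Icc (2 * (j + 2) / 2) (2 * (j + 2)), g i =
      ∑ i ∈ Finset.range (j + 2 + 1), g (j + 1 + i + 1) := by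
    intro g
    rw [show 2 * (j + 2) / 2 = j + 2 by omega, ← Finset.Ico_succ_right_eq_Icc,
      Finset.sum_Ico_eq_sum_range]
    apply Finset.sum_congr
    · congr 1; simp; omega
    · intro i _; congr 1; ring
  rw [hwin, hwin]
  have hcast : 2 / (((2 * (j + 2) : ℕ) : ℝ) + 2) = 1 / ((j + 2 + 1 : ℕ) : ℝ) := by
    push_cast; field_simp
  rw [hcast]
  set L : ℕ := j + 2 + 1 with hLdef
  have hLpos : (0 : ℝ) < (L : ℝ) := by positivity
  have hkL : (((j + 2 : ℕ) : ℝ)) ≤ L := by simp [hLdef]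
  -- the residuals
  have hV : ∑ i ∈ Finset.range L, V (j + 1 + i + 1) ≤ L * (ρ / 2) := by
    apply h.sum_V_le (by omega) L (D := hi - lo + 9 * κ₂ ^ 2 / (χ ^ 2 * c)) (by linarith)
    · have h1 := h.psi_le_uniform hm hL hL' (k := j + 1) (by omega)
      have h2 := h.le_psi_uniform (j := j + 1 + L) (by omega)
      -- The upper bound costs `8` and the lower bound `1/2`; the constant `9` is their sum rounded
      -- up.
      have e : 9 * κ₂ ^ 2 / (χ ^ 2 * c) - 8 * κ₂ ^ 2 / (χ ^ 2 * c) - κ₂ ^ 2 / (2 * χ ^ 2 * c)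
          = κ₂ ^ 2 / (2 * χ ^ 2 * c) := by field_simp; norm_num
      have : 0 ≤ κ₂ ^ 2 / (2 * χ ^ 2 * c) := by positivity
      linarith
    · have : ((j + 2 : ℕ) : ℝ) * ρ ^ 2 ≤ L * ρ ^ 2 := by gcongr
      linarith
  -- the multipliers
  have hA : ∀ i, 1 ≤ i → ∑ r ∈ Finset.range L, a (i + r + 1) ≤ L * κ₂ := by
    intro i hi1
    apply h.sum_a_le hi1 L (h.psi_sub_le_crude hi1 (by omega))
    · refine hL.trans ?_
      gcongr
    · exact hL'.trans hmk
  have hF : ∑ i ∈ Finset.range L, φ (j + 1 + i + 1) ≤ L * (2 * κ₂ / (χ * c)) := by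
    have h1 : χ * c * ∑ i ∈ Finset.range L, φ (j + 1 + i + 1) ≤
        ∑ i ∈ Finset.range L, a (j + i + 1) + ∑ i ∈ Finset.range L, a (j + 1 + i + 1) := by
      rw [Finset.mul_sum, ← Finset.sum_add_distrib]
      apply Finset.sum_le_sum
      intro i _
      have := h.phi_le (j + 1 + i)
      rwa [show j + i + 1 = j + 1 + i by ring]
    have h2 := hA j (by omega)
    have h3 := hA (j + 1) (by omega)
    rw [show L * (2 * κ₂ / (χ * c)) = 2 * L * κ₂ / (χ * c) by ring, le_div_iff₀ (by positivity)]
    linarith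
  -- Against the average infeasibility `2 κ₂ / (χ c)` this weight leaves exactly `η / 2`, half of
  -- the test's budget.
  have hs : Real.sqrt (c ^ 3 / ((2 * (j + 2) : ℕ) : ℝ)) ≤ η * χ * c / (4 * κ₂) := by
    rw [Real.sqrt_le_left (by positivity), div_le_iff₀ (by positivity), div_pow, div_mul_eq_mul_div,
      le_div_iff₀ (by positivity)]
    have : 8 * κ₂ ^ 2 * c * (2 * c ^ 2) ≤ ((j + 2 : ℕ) : ℝ) * (χ ^ 2 * η ^ 2) * (2 * c ^ 2) := by
      gcongr
    push_cast at this ⊢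
    linarith
  have p1 : 1 / ρ * (1 / (L : ℝ) * ∑ i ∈ Finset.range L, V (j + 1 + i + 1)) ≤ 1 / 2 := by
    calc _ ≤ 1 / ρ * (1 / (L : ℝ) * (L * (ρ / 2))) := by gcongr
      _ = 1 / 2 := by field_simp
  have p2 : 1 / η * Real.sqrt (c ^ 3 / ((2 * (j + 2) : ℕ) : ℝ)) *
      (1 / (L : ℝ) * ∑ i ∈ Finset.range L, φ (j + 1 + i + 1)) ≤ 1 / 2 := by
    calc _ ≤ 1 / η * Real.sqrt (c ^ 3 / ((2 * (j + 2) : ℕ) : ℝ)) *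
            (1 / (L : ℝ) * (L * (2 * κ₂ / (χ * c)))) := by gcongr
      _ ≤ 1 / η * (η * χ * c / (4 * κ₂)) * (1 / (L : ℝ) * (L * (2 * κ₂ / (χ * c)))) := by gcongr
      _ = 1 / 2 := by field_simp; norm_num
  linarith

end StaticSequence

end Scalar

/-! ### Smallest positive singular value -/

section SingularValues

variable {E F : Type*} [NormedAddCommGroup E] [InnerProductSpace ℝ E] [FiniteDimensional ℝ E]
  [NormedAddCommGroup F] [InnerProductSpace ℝ F] [FiniteDimensional ℝ F]

/-- A lower bound for the positive singular values bounds the adjoint from below on the range. -/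
theorem mul_norm_le_norm_adjoint_of_mem_range (T : E →ₗ[ℝ] F) {σ : ℝ} (hσ : 0 ≤ σ)
    (h : ∀ i, 0 < T.singularValues i → σ ≤ T.singularValues i) (x : E) :
    σ * ‖T x‖ ≤ ‖LinearMap.adjoint T (T x)‖ := by
  set hT := T.isSymmetric_adjoint_comp_self
  set b := hT.eigenvectorBasis rfl
  set μ := hT.eigenvalues rfl
  have hb : ∀ i, inner ℝ (b i) (LinearMap.adjoint T (T x)) = μ i * inner ℝ (b i) x := by
    intro i
    have := hT.eigenvectorBasis_apply_self_apply rfl x i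
    rw [OrthonormalBasis.repr_apply_apply, OrthonormalBasis.repr_apply_apply] at this
    simpa using this
  have h1 : ‖LinearMap.adjoint T (T x)‖ ^ 2 = ∑ i, (μ i * inner ℝ (b i) x) ^ 2 := by
    rw [← b.sum_sq_norm_inner_right]
    apply Finset.sum_congr rfl
    intro i _
    rw [hb, Real.norm_eq_abs, sq_abs]
  have h2 : ‖T x‖ ^ 2 = ∑ i, μ i * (inner ℝ (b i) x) ^ 2 := by
    rw [← real_inner_self_eq_norm_sq, ← LinearMap.adjoint_inner_right, ← b.sum_inner_mul_inner]
    apply Finset.sum_congr rfl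
    intro i _
    rw [hb, real_inner_comm]
    ring
  have h3 : (σ * ‖T x‖) ^ 2 ≤ ‖LinearMap.adjoint T (T x)‖ ^ 2 := by
    rw [mul_pow, h1, h2, Finset.mul_sum]
    apply Finset.sum_le_sum
    intro i _
    have hs : T.singularValues i ^ 2 = μ i := T.sq_singularValues_fin rfl i
    -- Since the vector is `T x`, its expansion carries a factor `μ i`: directions with zero
    -- singular value vanish on both sides.
    rcases (T.singularValues_nonneg i).eq_or_lt with h0 | h0
    · rw [← hs, ← h0]; simp
    · have : σ ^ 2 ≤ μ i := by
        rw [← hs]; exact pow_le_pow_left₀ hσ (h i h0) 2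
      have hμ : 0 ≤ μ i := by rw [← hs]; positivity
      rw [mul_pow]
      calc σ ^ 2 * (μ i * inner ℝ (b i) x ^ 2) ≤ μ i * (μ i * inner ℝ (b i) x ^ 2) := by gcongr
        _ = _ := by ring
  exact abs_le_of_sq_le_sq' h3 (norm_nonneg _) |>.2

end SingularValues

/-! ### Slater-type subgradient bound and balls in the domain -/

section SubgradientBound

variable {E : Type*} [NormedAddCommGroup E] [InnerProductSpace ℝ E]

/-- A Slater point bounds the subgradients of a function that is Lipschitz on its domain. -/
theorem norm_subgradient_le {g : E → ℝ} {s : Set E} {K r : ℝ} {z x ξ : E}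
    (hr : 0 ≤ r) (hball : Metric.closedBall z r ⊆ s) (hK : 0 ≤ K)
    (hlip : ∀ u ∈ s, g u - g x ≤ K * ‖u - x‖)
    (hξ : ∀ u ∈ s, g x + inner ℝ ξ (u - x) ≤ g u) :
    r * ‖ξ‖ ≤ (r + ‖x - z‖) * K + inner ℝ ξ (x - z) := by
  by_cases h0 : ξ = 0
  · subst h0; simp; positivity
  have hn : 0 < ‖ξ‖ := norm_pos_iff.2 h0
  -- The boundary point of the ball furthest in the direction `ξ`, where the subgradient inequality
  -- is strongest.
  set u := z + (r / ‖ξ‖) • ξ with hu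
  have hun : ‖u - z‖ = r := by
    rw [hu, add_sub_cancel_left, norm_smul, Real.norm_of_nonneg (by positivity)]
    field_simp
  have hus : u ∈ s := hball (by rw [mem_closedBall_iff_norm, hun])
  have h1 := hlip u hus
  have h2 := hξ u hus
  have h3 : ‖u - x‖ ≤ r + ‖x - z‖ := by
    calc ‖u - x‖ = ‖(u - z) - (x - z)‖ := by congr 1; abel
      _ ≤ ‖u - z‖ + ‖x - z‖ := norm_sub_le _ _
      _ = _ := by rw [hun]
  have h4 : inner ℝ ξ (u - x) = r * ‖ξ‖ - inner ℝ ξ (x - z) := by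
    have : u - x = (r / ‖ξ‖) • ξ - (x - z) := by rw [hu]; abel
    rw [this, inner_sub_right, inner_smul_right, real_inner_self_eq_norm_sq]
    field_simp
  have h5 : K * ‖u - x‖ ≤ K * (r + ‖x - z‖) := by gcongr
  linarith

end SubgradientBound

section Balls

/-- A ball around a point of `s` that does not reach the frontier of `s` lies in `s`. -/
theorem ball_infDist_frontier_subset {E : Type*} [NormedAddCommGroup E] [NormedSpace ℝ E]
    {s : Set E} {z : E} (hz : z ∈ s) : Metric.ball z (Metric.infDist z (frontier s)) ⊆ s := by
  intro u hu
  by_contra hus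
  have hpre : IsPreconnected (Metric.ball z (Metric.infDist z (frontier s))) :=
    (convex_ball _ _).isPreconnected
  have hpos : 0 < Metric.infDist z (frontier s) := Metric.pos_of_mem_ball hu
  have hnf : ∀ w ∈ Metric.ball z (Metric.infDist z (frontier s)), w ∉ frontier s := by
    intro w hw hwf
    have := Metric.infDist_le_dist_of_mem hwf (x := z)
    rw [Metric.mem_ball, dist_comm] at hw
    linarith
  have hin : ∀ w ∈ Metric.ball z (Metric.infDist z (frontier s)), w ∈ closure s →
      w ∈ interior s := fun w hw hwc => by
    by_contra h
    exact hnf w hw ⟨hwc, h⟩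
  -- A ball missing the frontier is covered by the interior and the exterior of `s`; being
  -- connected, it cannot meet both.
  obtain ⟨w, -, hwi, hwc⟩ := hpre (interior s) (closure s)ᶜ isOpen_interior
    isClosed_closure.isOpen_compl
    (fun w hw => or_iff_not_imp_right.2 fun h => hin w hw (not_not.1 h))
    ⟨z, Metric.mem_ball_self hpos, hin z (Metric.mem_ball_self hpos) (subset_closure hz)⟩
    ⟨u, hu, fun h => hus (interior_subset (hin u hu h))⟩
  exact hwc (subset_closure (interior_subset hwi))

end Balls

/-! ### Block coordinates and partially updated points -/

section Splice

variable {B : ℕ} {n : Fin B → ℕ} {l : ℕ}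

theorem splice_apply_self (y : Blocks n) (t : Fin B) (u) (x : Blocks n) :
    splice y t u x t = u := by
  simp [splice]

theorem splice_apply_ne (y : Blocks n) {s t : Fin B} (h : s ≠ t) (u) (x : Blocks n) :
    splice y t u x s = if s < t then y s else x s := by
  simp [splice, h]

theorem splice_self_apply_ne (w : Blocks n) {s t : Fin B} (h : s ≠ t) (u) :
    splice w t u w s = w s := by
  simp [splice, h]

theorem splice_self_self (w : Blocks n) (t : Fin B) : splice w t (w t) w = w := by
  ext s : 1
  by_cases h : s = t
  · subst h; simp [splice]
  · simp [splice]

/-- `(y_1, …, y_j, x_{j+1}, …, x_B)`. -/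
def headTail (y x : Blocks n) (j : ℕ) : Blocks n :=
  WithLp.toLp 2 fun s => if (s : ℕ) < j then y s else x s

theorem headTail_apply (y x : Blocks n) (j : ℕ) (s : Fin B) :
    headTail y x j s = if (s : ℕ) < j then y s else x s := rfl

theorem headTail_zero (y x : Blocks n) : headTail y x 0 = x := by
  ext s : 1; simp [headTail_apply]

theorem headTail_card (y x : Blocks n) : headTail y x B = y := by
  ext s : 1; simp [headTail_apply]

/-- Reduces splicing from two points to changing one block of a single base point, the form in which
the block subproblems are studied. -/
theorem splice_eq_splice_headTail (y x : Blocks n) (t : Fin B) (u) :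
    splice y t u x = splice (headTail y x t) t u (headTail y x t) := by
  ext s : 1
  by_cases h : s = t
  · subst h; simp [splice]
  · simp [splice, h, headTail_apply]

theorem headTail_succ (y x : Blocks n) (t : Fin B) :
    headTail y x (t + 1) = splice y t (y t) x := by
  ext s : 1
  by_cases h : s = t
  · subst h; simp [splice, headTail_apply]
  · have : (s : ℕ) ≠ t := fun h' => h (Fin.ext h')
    simp only [splice, headTail_apply, PiLp.toLp_apply, Function.update_of_ne h, Fin.lt_def]
    congr 1
    simp only [eq_iff_iff]; omega

theorem headTail_apply_self (y x : Blocks n) (t : Fin B) : headTail y x t t = x t := by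
  simp [headTail_apply]

/-- The vector with block `δ` in position `t` and zeros elsewhere. -/
def blockSingle (t : Fin B) (δ : EuclideanSpace ℝ (Fin (n t))) : Blocks n :=
  WithLp.toLp 2 (Pi.single t δ)

theorem splice_sub_splice (w : Blocks n) (t : Fin B) (u v) :
    splice w t u w - splice w t v w = blockSingle t (u - v) := by
  ext s : 1
  by_cases h : s = t
  · subst h; simp [splice, blockSingle]
  · simp [splice, blockSingle, h]

theorem splice_combo (w : Blocks n) (t : Fin B) (u v) {a b : ℝ} (hab : a + b = 1) :
    splice w t (a • u + b • v) w = a • splice w t u w + b • splice w t v w := by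
  ext s : 1
  by_cases h : s = t
  · subst h; simp [splice]
  · simp [splice, h, ← add_smul, hab]

theorem inner_blockSingle (x : Blocks n) (t : Fin B) (δ) :
    inner ℝ x (blockSingle t δ) = inner ℝ (x t) δ := by
  rw [PiLp.inner_apply, Finset.sum_eq_single t]
  · simp [blockSingle]
  · intro s _ h; simp [blockSingle, h]
  · simp

variable (P : Problem B n l)

theorem Problem.A_apply (x : Blocks n) : P.A x = ∑ t, P.ABlock t (x t) := by
  simp [Problem.A]

theorem Problem.A_blockSingle (t : Fin B) (δ) : P.A (blockSingle t δ) = P.ABlock t δ := by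
  rw [P.A_apply, Finset.sum_eq_single t]
  · simp [blockSingle]
  · intro s _ h; simp [blockSingle, h]
  · simp

theorem Problem.A_splice (w : Blocks n) (t : Fin B) (u v) :
    P.A (splice w t u w) = P.A (splice w t v w) + P.ABlock t (u - v) := by
  rw [← P.A_blockSingle, ← splice_sub_splice w, map_sub]; abel

theorem Problem.adjoint_A_apply (q) (t : Fin B) :
    ContinuousLinearMap.adjoint P.A q t = ContinuousLinearMap.adjoint (P.ABlock t) q := by
  apply ext_inner_right ℝ
  intro δ
  rw [← inner_blockSingle, ContinuousLinearMap.adjoint_inner_left, P.A_blockSingle,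
    ContinuousLinearMap.adjoint_inner_left]

theorem splice_mem_dom {w : Blocks n} {t : Fin B} {u} (hw : ∀ s, s ≠ t → w s ∈ P.domBlock s) :
    splice w t u w ∈ P.dom ↔ u ∈ P.domBlock t := by
  constructor
  · intro h; simpa [splice_apply_self] using h t
  · intro h s
    by_cases hs : s = t
    · subst hs; rwa [splice_apply_self]
    · rw [splice_self_apply_ne _ hs]; exact hw s hs

end Splice

/-! ### Extended values, compactness and positivity of the constants -/

section Domain

variable {B : ℕ} {n : Fin B → ℕ} {l : ℕ} {P : Problem B n l} {K : Moduli n}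

theorem sum_ereal_ne_bot {ι : Type*} (s : Finset ι) {g : ι → EReal} (h : ∀ i, g i ≠ ⊥) :
    ∑ i ∈ s, g i ≠ ⊥ := by
  classical
  induction s using Finset.induction_on with
  | empty => simp
  | insert a s ha ih => rw [Finset.sum_insert ha]; simp [EReal.add_eq_bot_iff, h, ih]

theorem coe_sum_ereal {ι : Type*} (s : Finset ι) (g : ι → ℝ) :
    ((∑ i ∈ s, g i : ℝ) : EReal) = ∑ i ∈ s, (g i : EReal) := by
  classical
  induction s using Finset.induction_on with
  | empty => simp
  | insert a s ha ih => rw [Finset.sum_insert ha, Finset.sum_insert ha, EReal.coe_add, ih]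

theorem Moduli.mBlock_le (K : Moduli n) (t : Fin B) : K.mBlock t ≤ K.m :=
  le_ciSup (Set.finite_range K.mBlock).bddAbove t

theorem Moduli.MBlock_le (K : Moduli n) (t : Fin B) : K.MBlock t ≤ K.M :=
  le_ciSup (Set.finite_range K.MBlock).bddAbove t

namespace Assumptions

theorem coe_toReal_hBlock (hP : Assumptions P K) {t : Fin B} {u} (hu : u ∈ P.domBlock t) :
    ((P.hBlock t u).toReal : EReal) = P.hBlock t u :=
  EReal.coe_toReal (ne_of_lt hu) ((hP.closedConvex t).ne_bot u)

theorem h_eq (hP : Assumptions P K) {x : Blocks n} (hx : x ∈ P.dom) :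
    P.h x = ((∑ t, (P.hBlock t (x t)).toReal : ℝ) : EReal) := by
  rw [Problem.h, coe_sum_ereal]
  exact Finset.sum_congr rfl fun t _ => (hP.coe_toReal_hBlock (hx t)).symm

theorem toReal_h (hP : Assumptions P K) {x : Blocks n} (hx : x ∈ P.dom) :
    (P.h x).toReal = ∑ t, (P.hBlock t (x t)).toReal := by
  rw [hP.h_eq hx, EReal.toReal_coe]

theorem coe_toReal_h (hP : Assumptions P K) {x : Blocks n} (hx : x ∈ P.dom) :
    ((P.h x).toReal : EReal) = P.h x := by
  rw [hP.toReal_h hx, hP.h_eq hx]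

theorem h_eq_top (hP : Assumptions P K) {x : Blocks n} (hx : x ∉ P.dom) : P.h x = ⊤ := by
  simp only [Problem.dom, Set.mem_ofPred_eq, not_forall] at hx
  obtain ⟨t, ht⟩ := hx
  have : P.hBlock t (x t) = ⊤ := by simpa [Problem.domBlock] using ht
  rw [Problem.h, ← Finset.add_sum_erase _ _ (Finset.mem_univ t), this]
  exact EReal.top_add_of_ne_bot (sum_ereal_ne_bot _ fun i => (hP.closedConvex i).ne_bot _)

theorem hBlock_combo_le (hP : Assumptions P K) {t : Fin B} {u v} (hu : u ∈ P.domBlock t)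
    (hv : v ∈ P.domBlock t) {a b : ℝ} (ha : 0 ≤ a) (hb : 0 ≤ b) (hab : a + b = 1) :
    P.hBlock t (a • u + b • v) ≤
      ((a * (P.hBlock t u).toReal + b * (P.hBlock t v).toReal : ℝ) : EReal) := by
  have := (hP.closedConvex t).convex_epigraph
    (x := (u, (P.hBlock t u).toReal)) (y := (v, (P.hBlock t v).toReal))
    (by simp [hP.coe_toReal_hBlock hu]) (by simp [hP.coe_toReal_hBlock hv]) ha hb hab
  simpa using this

theorem convexOn_hBlock (hP : Assumptions P K) (t : Fin B) :
    ConvexOn ℝ (P.domBlock t) fun u => (P.hBlock t u).toReal := by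
  have key : Convex ℝ (P.domBlock t) := by
    intro u hu v hv a b ha hb hab
    exact (hP.hBlock_combo_le hu hv ha hb hab).trans_lt (EReal.coe_lt_top _)
  refine ⟨key, ?_⟩
  intro u hu v hv a b ha hb hab
  have := hP.hBlock_combo_le hu hv ha hb hab
  rw [← hP.coe_toReal_hBlock (key hu hv ha hb hab), EReal.coe_le_coe_iff] at this
  simpa using this

theorem convex_dom (hP : Assumptions P K) : Convex ℝ P.dom := by
  intro x hx y hy a b ha hb hab t
  exact (hP.convexOn_hBlock t).1 (hx t) (hy t) ha hb hab

theorem convexOn_h (hP : Assumptions P K) : ConvexOn ℝ P.dom fun x => (P.h x).toReal := by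
  refine ⟨hP.convex_dom, ?_⟩
  intro x hx y hy a b ha hb hab
  simp only [hP.toReal_h hx, hP.toReal_h hy, hP.toReal_h (hP.convex_dom hx hy ha hb hab)]
  rw [Finset.smul_sum, Finset.smul_sum, ← Finset.sum_add_distrib]
  exact Finset.sum_le_sum fun t _ => (hP.convexOn_hBlock t).2 (hx t) (hy t) ha hb hab

theorem isCompact_dom (hP : Assumptions P K) : IsCompact P.dom := by
  have h := (isCompact_univ_pi hP.compactDom).image (PiLp.continuous_toLp 2 _)
  convert! h using 1
  ext x
  constructor
  · intro hx
    exact ⟨fun t => x t, fun t _ => hx t, rfl⟩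
  · rintro ⟨y, hy, rfl⟩ t
    exact hy t trivial

theorem ball_subset_dom (hP : Assumptions P K) :
    Metric.ball K.zdag (ddag P K) ⊆ P.dom :=
  ball_infDist_frontier_subset hP.zdag_feasible.1

theorem ddag_pos (hP : Assumptions P K) : 0 < ddag P K := hP.zdag_interior

theorem closedBall_subset_dom (hP : Assumptions P K) :
    Metric.closedBall K.zdag (ddag P K) ⊆ P.dom := by
  rw [← closure_ball _ hP.ddag_pos.ne']
  exact closure_minimal hP.ball_subset_dom hP.isCompact_dom.isClosed

theorem hasFDerivWithinAt_f (hP : Assumptions P K) {x : Blocks n} (hx : x ∈ P.dom) :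
    HasFDerivWithinAt P.f (InnerProductSpace.toDual ℝ _ (P.grad x)) P.dom x :=
  ((hP.f_differentiable x hx).hasGradientWithinAt).hasFDerivWithinAt

theorem continuousOn_phi (hP : Assumptions P K) : ContinuousOn P.phi P.dom := by
  apply hP.f_differentiable.continuousOn.add
  have : LipschitzOnWith ⟨K.Kh, hP.Kh_nonneg⟩ (fun x => (P.h x).toReal) P.dom :=
    LipschitzOnWith.of_dist_le_mul fun x hx y hy => by
      rw [Real.dist_eq, dist_eq_norm]
      exact hP.h_lipschitz x hx y hy
  exact this.continuousOn

theorem phi_le_sSup (hP : Assumptions P K) {x : Blocks n} (hx : x ∈ P.dom) :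
    P.phi x ≤ sSup (P.phi '' P.dom) :=
  le_csSup (hP.isCompact_dom.image_of_continuousOn hP.continuousOn_phi).bddAbove
    (Set.mem_image_of_mem _ hx)

theorem sInf_le_phi (hP : Assumptions P K) {x : Blocks n} (hx : x ∈ P.dom) :
    sInf (P.phi '' P.dom) ≤ P.phi x :=
  csInf_le (hP.isCompact_dom.image_of_continuousOn hP.continuousOn_phi).bddBelow
    (Set.mem_image_of_mem _ hx)

theorem deltaPhi_nonneg (hP : Assumptions P K) : 0 ≤ deltaPhi P :=
  sub_nonneg.2 ((hP.sInf_le_phi hP.zdag_feasible.1).trans (hP.phi_le_sSup hP.zdag_feasible.1))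

theorem norm_sub_zdag_le (hP : Assumptions P K) {x : Blocks n} (hx : x ∈ P.dom) :
    ‖x - K.zdag‖ ≤ Ddag P K :=
  le_csSup (hP.isCompact_dom.image (by fun_prop)).bddAbove ⟨x, hx, rfl⟩

theorem norm_grad_le (hP : Assumptions P K) {x : Blocks n} (hx : x ∈ P.dom) :
    ‖P.grad x‖ ≤ Gf P :=
  le_csSup hP.grad_bounded ⟨x, hx, rfl⟩

theorem Gf_nonneg (hP : Assumptions P K) : 0 ≤ Gf P :=
  (norm_nonneg _).trans (hP.norm_grad_le hP.zdag_feasible.1)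

theorem exists_A_apply_ne_zero (hP : Assumptions P K) : ∃ x, P.A x ≠ 0 := by
  by_contra! h
  exact hP.A_ne_zero (ContinuousLinearMap.ext h)

/-- The closed ball of radius `d_†` lies in `ℋ`, and `A ≠ 0` excludes the zero space, so this ball
has a point at distance exactly `d_†`. -/
theorem ddag_le_Ddag (hP : Assumptions P K) : ddag P K ≤ Ddag P K := by
  obtain ⟨x, hx⟩ := hP.exists_A_apply_ne_zero
  have hx0 : 0 < ‖x‖ := norm_pos_iff.2 (by rintro rfl; simp at hx)
  have hd := hP.ddag_pos
  have hn : ‖K.zdag + (ddag P K / ‖x‖) • x - K.zdag‖ = ddag P K := by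
    rw [add_sub_cancel_left, norm_smul, Real.norm_of_nonneg (by positivity)]
    field_simp
  have := hP.norm_sub_zdag_le (x := K.zdag + (ddag P K / ‖x‖) • x)
    (hP.closedBall_subset_dom (by rw [mem_closedBall_iff_norm, hn]))
  rwa [hn] at this

theorem Ddag_pos (hP : Assumptions P K) : 0 < Ddag P K := hP.ddag_pos.trans_le hP.ddag_le_Ddag

theorem one_le_B (hP : Assumptions P K) : 1 ≤ B := by
  obtain ⟨x, hx⟩ := hP.exists_A_apply_ne_zero
  by_contra! h
  obtain rfl : B = 0 := by omega
  exact hx (by simp [P.A_apply])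

theorem sigmaPlus_spec (hP : Assumptions P K) : 0 < sigmaPlus P ∧
    ∀ i : ℕ, 0 < (P.A : Blocks n →ₗ[ℝ] EuclideanSpace ℝ (Fin l)).singularValues i →
      sigmaPlus P ≤ (P.A : Blocks n →ₗ[ℝ] EuclideanSpace ℝ (Fin l)).singularValues i := by
  set T := (P.A : Blocks n →ₗ[ℝ] EuclideanSpace ℝ (Fin l)) with hT
  set s := {s : ℝ | 0 < s ∧ ∃ i : ℕ, T.singularValues i = s} with hs
  have hfin : s.Finite := by
    refine (T.singularValues.support.finite_toSet.image T.singularValues).subset ?_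
    rintro x ⟨hx, i, rfl⟩
    exact ⟨i, Finsupp.mem_support_iff.2 hx.ne', rfl⟩
  -- Without a positive singular value `A` would vanish; this prevents the infimum of the empty set.
  have hne : s.Nonempty := by
    by_contra! h
    have h0 : T.singularValues = 0 := by
      ext i
      by_contra h'
      have : T.singularValues i ∈ s :=
        ⟨(T.singularValues_pos_iff_ne_zero i).2 h', i, rfl⟩
      rw [h] at this
      exact this
    rw [LinearMap.singularValues_eq_zero_iff] at h0
    obtain ⟨x, hx⟩ := hP.exists_A_apply_ne_zero
    exact hx (by simpa [hT] using LinearMap.congr_fun h0 x)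
  refine ⟨(hne.csInf_mem hfin).1, fun i hi => csInf_le hfin.bddBelow ⟨hi, i, rfl⟩⟩

theorem sigmaPlus_mul_norm_le (hP : Assumptions P K) {q} (hq : q ∈ Set.range P.A) :
    sigmaPlus P * ‖q‖ ≤ ‖ContinuousLinearMap.adjoint P.A q‖ := by
  obtain ⟨x, rfl⟩ := hq
  exact mul_norm_le_norm_adjoint_of_mem_range
    (P.A : Blocks n →ₗ[ℝ] EuclideanSpace ℝ (Fin l)) hP.sigmaPlus_spec.1.le
    hP.sigmaPlus_spec.2 x

theorem iSup_M_nonneg (hP : Assumptions P K) : 0 ≤ K.M :=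
  (hP.M_nonneg ⟨0, hP.one_le_B⟩).trans (K.MBlock_le _)

end Assumptions

end Domain

/-! ### Quadratic growth at minimizers -/

section Generic

variable {E : Type*} [NormedAddCommGroup E] [InnerProductSpace ℝ E]

theorem norm_sq_combo (x y : E) {a b : ℝ} (hab : a + b = 1) :
    ‖a • x + b • y‖ ^ 2 = a * ‖x‖ ^ 2 + b * ‖y‖ ^ 2 - a * b * ‖x - y‖ ^ 2 := by
  obtain rfl : a = 1 - b := by linarith
  rw [norm_add_sq_real, norm_sub_sq_real, norm_smul, norm_smul, inner_smul_left, inner_smul_right,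
    mul_pow, mul_pow, Real.norm_eq_abs, Real.norm_eq_abs, sq_abs, sq_abs]
  simp
  ring

/-- The limit `b → 0`; it recovers the full quadratic growth constant from convex combinations near
the minimizer. -/
theorem le_of_forall_one_sub_mul_le {X Y : ℝ} (h : ∀ b, 0 < b → b < 1 → (1 - b) * X ≤ Y) :
    X ≤ Y := by
  by_contra! hlt
  have h1 := h (1 / 2) (by norm_num) (by norm_num)
  by_cases hX : 0 < X
  -- This `b` gives `(1 - b) X = X - (X - Y) / 4`, still above `Y`. It is less than `1` because the
  -- case `b = 1/2` has excluded very negative `Y`.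
  · have h2 := h ((X - Y) / (4 * X)) (div_pos (by linarith) (by linarith)) (by
      rw [div_lt_one (by linarith)]; linarith)
    have : (1 - (X - Y) / (4 * X)) * X = X - (X - Y) / 4 := by field_simp
    linarith
  · linarith

/-- Quadratic growth at a minimizer of a strongly convex function. -/
theorem growth_of_isMinOn {g : E → ℝ} {s : Set E} {u₀ u : E} {Q : ℝ} (hs : Convex ℝ s)
    (hu₀ : u₀ ∈ s) (hu : u ∈ s) (hmin : IsMinOn g s u₀)
    (hconv : ∀ a b : ℝ, 0 ≤ a → 0 ≤ b → a + b = 1 →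
      g (a • u₀ + b • u) ≤ a * g u₀ + b * g u - a * b * Q) :
    g u₀ + Q ≤ g u := by
  have : Q ≤ g u - g u₀ := by
    apply le_of_forall_one_sub_mul_le
    intro b hb hb1
    have h1 := hconv (1 - b) b (by linarith) hb.le (by ring)
    have h2 : g u₀ ≤ g ((1 - b) • u₀ + b • u) :=
      hmin (hs hu₀ hu (by linarith) hb.le (by ring))
    have : b * ((1 - b) * Q) ≤ b * (g u - g u₀) := by linarith
    exact le_of_mul_le_mul_left this hb
  linarith

end Generic

/-! ### Block subproblems: solvability, growth and optimality -/

variable {B : ℕ} {n : Fin B → ℕ} {l : ℕ} {P : Problem B n l} {K : Moduli n} {S : Params}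

/-- The real values of the dampened augmented Lagrangian on `ℋ`. -/
def Problem.lagReal (P : Problem B n l) (θ c : ℝ) (x : Blocks n) (p : EuclideanSpace ℝ (Fin l)) :
    ℝ :=
  P.phi x + ((1 - θ) * inner ℝ p (P.A x - P.d) + c / 2 * ‖P.A x - P.d‖ ^ 2)

/-- The objective of a block subproblem at the base point `w`. -/
def blockObj (P : Problem B n l) (S : Params) (c : ℝ) (p : EuclideanSpace ℝ (Fin l))
    (w : Blocks n) (t : Fin B) (u : EuclideanSpace ℝ (Fin (n t))) : EReal :=
  (S.lam : EReal) * P.lagrangian S.theta c (splice w t u w) p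
      + ((1 / 2 * ‖u - w t‖ ^ 2 : ℝ) : EReal)

/-- The real values of the objective of a block subproblem. -/
def blockReal (P : Problem B n l) (S : Params) (c : ℝ) (p : EuclideanSpace ℝ (Fin l))
    (w : Blocks n) (t : Fin B) (u : EuclideanSpace ℝ (Fin (n t))) : ℝ :=
  S.lam * P.lagReal S.theta c (splice w t u w) p + 1 / 2 * ‖u - w t‖ ^ 2

theorem isProxSweep_iff {c : ℝ} {x : Blocks n} {p} {y : Blocks n} :
    IsProxSweep P S c x p y ↔
      ∀ t : Fin B, IsMinOn (blockObj P S c p (headTail y x t) t) Set.univ (y t) := by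
  unfold IsProxSweep
  refine forall_congr' fun t => ?_
  have : (fun u => (S.lam : EReal) * P.lagrangian S.theta c (splice y t u x) p
      + ((1 / 2 * ‖u - x t‖ ^ 2 : ℝ) : EReal)) = blockObj P S c p (headTail y x t) t := by
    funext u
    rw [blockObj, headTail_apply_self, ← splice_eq_splice_headTail]
  rw [this]

namespace Assumptions

theorem lagrangian_eq (hP : Assumptions P K) (θ c : ℝ) {x : Blocks n} (hx : x ∈ P.dom) (p) :
    P.lagrangian θ c x p = (P.lagReal θ c x p : EReal) := by
  rw [Problem.lagrangian, Problem.lagReal, Problem.phi, ← hP.coe_toReal_h hx, ← EReal.coe_add,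
    ← EReal.coe_add, EReal.toReal_coe]

theorem lagrangian_eq_top (hP : Assumptions P K) (θ c : ℝ) {x : Blocks n} (hx : x ∉ P.dom) (p) :
    P.lagrangian θ c x p = ⊤ := by
  rw [Problem.lagrangian, hP.h_eq_top hx, EReal.coe_add_top, EReal.top_add_coe]

theorem blockObj_eq (hP : Assumptions P K) (c p) {w : Blocks n} (hw : w ∈ P.dom) {t : Fin B}
    {u} (hu : u ∈ P.domBlock t) : blockObj P S c p w t u = (blockReal P S c p w t u : EReal) := by
  rw [blockObj, hP.lagrangian_eq _ _ ((splice_mem_dom P fun s _ => hw s).2 hu), blockReal,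
    ← EReal.coe_mul, ← EReal.coe_add]

theorem blockObj_eq_top (hP : Assumptions P K) (hS : S.Admissible K) (c p) {w : Blocks n}
    (hw : w ∈ P.dom) {t : Fin B}
    {u} (hu : u ∉ P.domBlock t) : blockObj P S c p w t u = ⊤ := by
  rw [blockObj, hP.lagrangian_eq_top _ _ (fun h => hu ((splice_mem_dom P fun s _ => hw s).1 h)),
    EReal.coe_mul_top_of_pos hS.lam_pos, EReal.top_add_coe]

/-- The objective is finite at the current block `w t` and `⊤` off the block's domain, so the
extended-valued problem is a real one on a compact convex set. -/
theorem isMinOn_blockObj_iff (hP : Assumptions P K) (hS : S.Admissible K) (c p) {w : Blocks n}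
    (hw : w ∈ P.dom) {t : Fin B} {u} :
    IsMinOn (blockObj P S c p w t) Set.univ u ↔
      u ∈ P.domBlock t ∧ IsMinOn (blockReal P S c p w t) (P.domBlock t) u := by
  constructor
  · intro h
    have hu : u ∈ P.domBlock t := by
      by_contra hu
      have : blockObj P S c p w t u ≤ blockObj P S c p w t (w t) := h (Set.mem_univ (w t))
      rw [hP.blockObj_eq_top hS c p hw hu, hP.blockObj_eq c p hw (hw t)] at this
      exact absurd this (not_le.2 (EReal.coe_lt_top _))
    refine ⟨hu, fun v hv => ?_⟩
    have : blockObj P S c p w t u ≤ blockObj P S c p w t v := h (Set.mem_univ v)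
    rw [hP.blockObj_eq c p hw hu, hP.blockObj_eq c p hw hv] at this
    exact EReal.coe_le_coe_iff.1 this
  · rintro ⟨hu, h⟩ v -
    change blockObj P S c p w t u ≤ blockObj P S c p w t v
    by_cases hv : v ∈ P.domBlock t
    · have := h hv
      rw [hP.blockObj_eq c p hw hu, hP.blockObj_eq c p hw hv]
      exact EReal.coe_le_coe_iff.2 this
    · rw [hP.blockObj_eq_top hS c p hw hv]
      exact le_top

theorem continuousOn_blockReal (hP : Assumptions P K) (c p) {w : Blocks n}
    (hw : w ∈ P.dom) (t : Fin B) : ContinuousOn (blockReal P S c p w t) (P.domBlock t) := by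
  have hsp : Continuous fun u => splice w t u w := by
    refine (PiLp.continuous_toLp 2 _).comp ?_
    exact continuous_const.update t continuous_id
  have h1 : ContinuousOn (fun u => P.phi (splice w t u w)) (P.domBlock t) :=
    hP.continuousOn_phi.comp hsp.continuousOn
      fun u hu => (splice_mem_dom P fun s _ => hw s).2 hu
  unfold blockReal Problem.lagReal
  have h2 : Continuous fun u => P.A (splice w t u w) - P.d :=
    (P.A.continuous.comp hsp).sub continuous_const
  refine ((h1.add ?_).const_smul S.lam).add (by fun_prop)
  exact (((continuous_const.inner h2).const_smul (1 - S.theta)).add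
    ((h2.norm.pow 2).const_smul (c / 2))).continuousOn

theorem exists_isMinOn_blockObj (hP : Assumptions P K) (hS : S.Admissible K) (c p) {w : Blocks n}
    (hw : w ∈ P.dom) (t : Fin B) : ∃ u, IsMinOn (blockObj P S c p w t) Set.univ u := by
  obtain ⟨u, hu, hmin⟩ := (hP.compactDom t).exists_isMinOn ⟨w t, hw t⟩
    (hP.continuousOn_blockReal (S := S) c p hw t)
  exact ⟨u, (hP.isMinOn_blockObj_iff hS c p hw).2 ⟨hu, hmin⟩⟩

/-- Strong convexity. The prox term has modulus `1`, and weak convexity of `λ f` costs at most `λ m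
≤ 1/2`, which leaves `1/4 ‖u - v‖²`. The quadratic penalty contributes its curvature along `A_t`
exactly. -/
theorem blockReal_combo_le (hP : Assumptions P K) (hS : S.Admissible K) (c p)
    {w : Blocks n} (hw : w ∈ P.dom) {t : Fin B} {u v} (hu : u ∈ P.domBlock t)
    (hv : v ∈ P.domBlock t) {a b : ℝ} (ha : 0 ≤ a) (hb : 0 ≤ b) (hab : a + b = 1) :
    blockReal P S c p w t (a • u + b • v) ≤ a * blockReal P S c p w t u
      + b * blockReal P S c p w t v
      - a * b * (1 / 4 * ‖u - v‖ ^ 2 + S.lam * c / 2 * ‖P.ABlock t (u - v)‖ ^ 2) := by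
  have hlam := hS.lam_pos
  have hf := (hP.weaklyConvex t w hw).2 hu hv ha hb hab
  have hh := hP.convexOn_h.2 ((splice_mem_dom P fun s _ => hw s).2 hu)
    ((splice_mem_dom P fun s _ => hw s).2 hv) ha hb hab
  simp only [smul_eq_mul, ← splice_combo w t u v hab] at hf hh
  rw [norm_sq_combo u v hab] at hf
  have hA : P.A (splice w t (a • u + b • v) w) - P.d =
      a • (P.A (splice w t u w) - P.d) + b • (P.A (splice w t v w) - P.d) := by
    rw [splice_combo w t u v hab, map_add, map_smul, map_smul, smul_sub, smul_sub]
    have : P.d = a • P.d + b • P.d := by rw [← add_smul, hab, one_smul]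
    nth_rewrite 1 [this]
    abel
  have hAd : P.A (splice w t u w) - P.d - (P.A (splice w t v w) - P.d) = P.ABlock t (u - v) := by
    rw [P.A_splice w t u v]; abel
  have hprox : a • u + b • v - w t = a • (u - w t) + b • (v - w t) := by
    have : w t = a • w t + b • w t := by rw [← add_smul, hab, one_smul]
    nth_rewrite 1 [this]
    rw [smul_sub, smul_sub]
    abel
  have hm : S.lam * K.mBlock t ≤ 1 / 2 := by
    have := mul_le_mul_of_nonneg_left (K.mBlock_le t) hlam.le
    linarith [hS.lam_le]
  unfold blockReal Problem.lagReal Problem.phi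
  rw [hA, norm_sq_combo _ _ hab, hAd, hprox, norm_sq_combo (u - w t) _ hab, inner_add_right,
    inner_smul_right, inner_smul_right, sub_sub_sub_cancel_right]
  have h1 := mul_le_mul_of_nonneg_left hf hlam.le
  have h2 := mul_le_mul_of_nonneg_left hh hlam.le
  have h3 := mul_le_mul_of_nonneg_right hm
    (mul_nonneg (mul_nonneg ha hb) (sq_nonneg ‖u - v‖))
  linarith

/-- Quadratic growth of the block subproblem at its solution. -/
theorem blockReal_growth (hP : Assumptions P K) (hS : S.Admissible K) (c p)
    {w : Blocks n} (hw : w ∈ P.dom) {t : Fin B} {u₀ u}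
    (hmin : IsMinOn (blockObj P S c p w t) Set.univ u₀) (hu : u ∈ P.domBlock t) :
    blockReal P S c p w t u₀
      + (1 / 4 * ‖u₀ - u‖ ^ 2 + S.lam * c / 2 * ‖P.ABlock t (u₀ - u)‖ ^ 2) ≤
      blockReal P S c p w t u := by
  obtain ⟨hu₀, hmin⟩ := (hP.isMinOn_blockObj_iff hS c p hw).1 hmin
  exact growth_of_isMinOn (hP.convexOn_hBlock t).1 hu₀ hu hmin
    fun a b ha hb hab => hP.blockReal_combo_le hS c p hw hu₀ hu ha hb hab

theorem isMinOn_blockObj_unique (hP : Assumptions P K) (hS : S.Admissible K) {c : ℝ} (hc : 0 ≤ c)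
    (p) {w : Blocks n} (hw : w ∈ P.dom) {t : Fin B} {u v}
    (hu : IsMinOn (blockObj P S c p w t) Set.univ u)
    (hv : IsMinOn (blockObj P S c p w t) Set.univ v) : u = v := by
  have h1 := hP.blockReal_growth hS c p hw hu ((hP.isMinOn_blockObj_iff hS c p hw).1 hv).1
  have h2 := ((hP.isMinOn_blockObj_iff hS c p hw).1 hv).2
    ((hP.isMinOn_blockObj_iff hS c p hw).1 hu).1
  have h2' : blockReal P S c p w t v ≤ blockReal P S c p w t u := h2
  have h3 : 0 ≤ S.lam * c / 2 * ‖P.ABlock t (u - v)‖ ^ 2 := by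
    have := hS.lam_pos
    positivity
  have h4 : ‖u - v‖ ^ 2 ≤ 0 := by linarith
  have h5 : ‖u - v‖ = 0 := by
    have := sq_nonneg ‖u - v‖
    exact pow_eq_zero_iff two_ne_zero |>.1 (le_antisymm h4 this)
  exact sub_eq_zero.1 (norm_eq_zero.1 h5)

/-- First-order optimality of the solution of a block subproblem. -/
theorem block_optimality (hP : Assumptions P K) (hS : S.Admissible K) (c p)
    {w : Blocks n} (hw : w ∈ P.dom) {t : Fin B} {u₀ u}
    (hmin : IsMinOn (blockObj P S c p w t) Set.univ u₀) (hu : u ∈ P.domBlock t) :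
    0 ≤ inner ℝ (P.grad (splice w t u₀ w) t
        + ContinuousLinearMap.adjoint (P.ABlock t)
          ((1 - S.theta) • p + c • (P.A (splice w t u₀ w) - P.d))
        + (1 / S.lam) • (u₀ - w t)) (u - u₀)
      + ((P.hBlock t u).toReal - (P.hBlock t u₀).toReal) := by
  have hlam := hS.lam_pos
  obtain ⟨hu₀, hmin⟩ := (hP.isMinOn_blockObj_iff hS c p hw).1 hmin
  have hmem : ∀ {v}, v ∈ P.domBlock t → splice w t v w ∈ P.dom :=
    fun hv => (splice_mem_dom P fun s _ => hw s).2 hv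
  set w' := splice w t u₀ w with hw'
  set δ := u - u₀ with hδ
  set H := (P.hBlock t u).toReal - (P.hBlock t u₀).toReal with hH
  set r := P.A w' - P.d with hr
  have hcurve : ∀ b : ℝ, splice w t ((1 - b) • u₀ + b • u) w = w' + b • blockSingle t δ := by
    intro b
    rw [splice_combo w t u₀ u (by ring), hδ, ← splice_sub_splice w t u u₀, ← hw']
    module
  have hHd : (P.h (splice w t u w)).toReal - (P.h w').toReal = H := by
    rw [hP.toReal_h (hmem hu), hP.toReal_h (hmem hu₀), ← Finset.sum_sub_distrib,
      Finset.sum_eq_single t]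
    · rw [splice_apply_self, splice_apply_self]
    · intro s _ hs
      rw [splice_self_apply_ne _ hs, splice_self_apply_ne _ hs, sub_self]
    · simp
  -- an upper model of the objective along the segment from `u₀` to `u`
  let ψ : ℝ → ℝ := fun b => S.lam * (P.f (w' + b • blockSingle t δ) + b * H
    + ((1 - S.theta) * (b * inner ℝ p (P.ABlock t δ))
      + c / 2 * (2 * b * inner ℝ r (P.ABlock t δ) + b ^ 2 * ‖P.ABlock t δ‖ ^ 2)))
    + 1 / 2 * (2 * b * inner ℝ (u₀ - w t) δ + b ^ 2 * ‖δ‖ ^ 2)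
  have hmaps : Set.MapsTo (fun b : ℝ => w' + b • blockSingle t δ) (Set.Icc 0 1) P.dom := by
    intro b hb
    have : splice w t ((1 - b) • u₀ + b • u) w ∈ P.dom :=
      hmem ((hP.convexOn_hBlock t).1 hu₀ hu (by linarith [hb.2]) hb.1 (by ring))
    rwa [hcurve b] at this
  -- Replacing `h` by its chord gives a differentiable function that, up to an additive constant,
  -- dominates the objective on the segment and agrees with it at `0`; minimality at `0` is
  -- inherited.
  have hψmin : IsMinOn ψ (Set.Icc 0 1) 0 := by
    intro b hb
    have hub := (hP.convexOn_hBlock t).1 hu₀ hu (by linarith [hb.2] : 0 ≤ 1 - b) hb.1 (by ring)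
    have h1 : blockReal P S c p w t u₀ ≤ blockReal P S c p w t ((1 - b) • u₀ + b • u) := hmin hub
    have h2 := hP.convexOn_h.2 (hmem hu₀) (hmem hu) (by linarith [hb.2] : 0 ≤ 1 - b) hb.1 (by ring)
    rw [← splice_combo w t u₀ u (by ring), hcurve] at h2
    simp only [smul_eq_mul, ← hw'] at h2
    unfold blockReal Problem.lagReal Problem.phi at h1
    rw [hcurve, ← hw'] at h1
    have e1 : P.A (w' + b • blockSingle t δ) - P.d = r + b • P.ABlock t δ := by
      rw [map_add, map_smul, P.A_blockSingle]; simp only [hr]; abel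
    have e2 : (1 - b) • u₀ + b • u - w t = (u₀ - w t) + b • δ := by
      rw [hδ]; module
    rw [e1, e2, norm_add_sq_real, norm_add_sq_real, inner_smul_right, inner_smul_right,
      norm_smul, norm_smul, mul_pow, mul_pow, Real.norm_eq_abs, sq_abs, ← hr, inner_add_right,
      inner_smul_right] at h1
    have h3 : (P.h (w' + b • blockSingle t δ)).toReal ≤ (P.h w').toReal + b * H := by
      rw [← hHd]; linarith
    have h4 := mul_le_mul_of_nonneg_left h3 hlam.le
    simp only [ψ, Set.mem_ofPred_eq]
    simp only [zero_smul, add_zero, zero_mul, mul_zero, ne_eq, OfNat.ofNat_ne_zero,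
      not_false_eq_true, zero_pow]
    linarith
  have hderivf : HasDerivWithinAt (fun b : ℝ => P.f (w' + b • blockSingle t δ))
      (inner ℝ (P.grad w' t) δ) (Set.Icc 0 1) 0 := by
    have hline : HasDerivWithinAt (fun b : ℝ => w' + b • blockSingle t δ) (blockSingle t δ)
        (Set.Icc 0 1) 0 := by
      have := ((hasDerivAt_id (0 : ℝ)).smul_const (blockSingle t δ)).const_add w'
      simpa using this.hasDerivWithinAt
    have := (hP.hasFDerivWithinAt_f (hmem hu₀)).comp_hasDerivWithinAt_of_eq (x := (0 : ℝ))
      (f := fun b : ℝ => w' + b • blockSingle t δ) hline hmaps (by simp [hw'])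
    simpa [inner_blockSingle, Function.comp_def] using this
  have hderiv : HasDerivWithinAt ψ (S.lam * (inner ℝ (P.grad w' t) δ + H
      + ((1 - S.theta) * inner ℝ p (P.ABlock t δ) + c * inner ℝ r (P.ABlock t δ)))
      + inner ℝ (u₀ - w t) δ) (Set.Icc 0 1) 0 := by
    have hid := hasDerivWithinAt_id (0 : ℝ) (Set.Icc (0 : ℝ) 1)
    have hsq := (hasDerivAt_pow 2 (0 : ℝ)).hasDerivWithinAt (s := Set.Icc (0 : ℝ) 1)
    have := (((hderivf.add (hid.mul_const H)).add
      (((hid.mul_const (inner ℝ p (P.ABlock t δ))).const_mul (1 - S.theta)).add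
        ((((hid.const_mul 2).mul_const (inner ℝ r (P.ABlock t δ))).add
          (hsq.mul_const (‖P.ABlock t δ‖ ^ 2))).const_mul (c / 2)))).const_mul S.lam).add
      ((((hid.const_mul 2).mul_const (inner ℝ (u₀ - w t) δ)).add
        (hsq.mul_const (‖δ‖ ^ 2))).const_mul (1 / 2))
    refine this.congr_deriv ?_
    norm_num
    ring_nf
  -- Only the one-sided derivative into the segment is available, as `f` is differentiable merely
  -- relative to `ℋ`.
  have hnn := (hψmin.localize).hasFDerivWithinAt_nonneg hderiv.hasFDerivWithinAt
    (y := 1) (mem_posTangentConeAt_of_segment_subset (by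
      rw [segment_eq_Icc (by norm_num)]; norm_num))
  simp only [ContinuousLinearMap.toSpanSingleton_apply, one_smul] at hnn
  rw [inner_add_left, inner_add_left, ContinuousLinearMap.adjoint_inner_left, inner_add_left,
    inner_smul_left, inner_smul_left, inner_smul_left]
  simp only [conj_trivial]
  have e : S.lam * (inner ℝ (P.grad w' t) δ + H
      + ((1 - S.theta) * inner ℝ p (P.ABlock t δ) + c * inner ℝ r (P.ABlock t δ)))
      + inner ℝ (u₀ - w t) δ = S.lam * (inner ℝ (P.grad w' t) δ +
        ((1 - S.theta) * inner ℝ p (P.ABlock t δ) + c * inner ℝ r (P.ABlock t δ)) +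
        1 / S.lam * inner ℝ (u₀ - w t) δ + H) := by
    field_simp
    ring
  rw [e] at hnn
  exact nonneg_of_mul_nonneg_right hnn hlam

end Assumptions

/-! ### A full sweep: uniqueness, descent and residual -/

theorem headTail_congr {y y' x : Blocks n} {j : ℕ} (h : ∀ s : Fin B, (s : ℕ) < j → y s = y' s) :
    headTail y x j = headTail y' x j := by
  ext s : 1
  simp only [headTail_apply]
  split_ifs with hs
  · rw [h s hs]
  · rfl

theorem headTail_mem_dom {y x : Blocks n} {j : ℕ} (hx : x ∈ P.dom)
    (h : ∀ s : Fin B, (s : ℕ) < j → y s ∈ P.domBlock s) : headTail y x j ∈ P.dom := by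
  intro s
  rw [headTail_apply]
  split_ifs with hs
  · exact h s hs
  · exact hx s

/-- The residual of a sweep from `x` to `y`. -/
def sweepResidual (P : Problem B n l) (S : Params) (c : ℝ) (x y : Blocks n) : Blocks n :=
  WithLp.toLp 2 fun t =>
    (P.grad y t - P.grad (splice y t (y t) x) t)
      + c • ContinuousLinearMap.adjoint (P.ABlock t)
          (∑ j ∈ Finset.Ioi t, P.ABlock j (y j - x j))
      - (1 / S.lam) • (y t - x t)

theorem State.v_eq (s : State n l) (i : ℕ) :
    s.v P S i = sweepResidual P S s.c (s.x (i - 1)) (s.x i) := rfl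

/-- Cauchy–Schwarz in the plane, which avoids the factor `2` of `(X + Y)² ≤ 2 X² + 2 Y²`. -/
theorem add_sq_le_mul_add {X Y a b α β : ℝ} (ha : 0 ≤ a) (hb : 0 ≤ b) (hα : 0 ≤ α) (hβ : 0 ≤ β)
    (hX : X ^ 2 ≤ a * α) (hY : Y ^ 2 ≤ b * β) : (X + Y) ^ 2 ≤ (a + b) * (α + β) := by
  have h1 : (X * Y) ^ 2 ≤ ((a * β + b * α) / 2) ^ 2 := by
    have h2 : (X * Y) ^ 2 ≤ (a * α) * (b * β) := by
      rw [mul_pow]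
      exact mul_le_mul hX hY (sq_nonneg _) (mul_nonneg ha hα)
    nlinarith [sq_nonneg (a * β - b * α)]
  have h3 := (abs_le_of_sq_le_sq' h1 (by positivity)).2
  nlinarith

theorem norm_le_sum_norm (x : Blocks n) : ‖x‖ ≤ ∑ t, ‖x t‖ := by
  have h : ‖x‖ ^ 2 ≤ (∑ t, ‖x t‖) ^ 2 := by
    rw [PiLp.norm_sq_eq_of_L2]
    exact Finset.sum_sq_le_sq_sum_of_nonneg fun t _ => norm_nonneg _
  exact (abs_le_of_sq_le_sq' h (Finset.sum_nonneg fun t _ => norm_nonneg _)).2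

theorem tailDist_le (t : Fin B) (x y : Blocks n) : tailDist t x y ≤ ‖x - y‖ := by
  rw [tailDist, Real.sqrt_le_left (norm_nonneg _), PiLp.norm_sq_eq_of_L2]
  exact Finset.sum_le_sum_of_subset_of_nonneg (Finset.subset_univ _) fun _ _ _ => sq_nonneg _

namespace Assumptions

theorem sweep_mem_dom (hP : Assumptions P K) (hS : S.Admissible K) {c : ℝ} {x y : Blocks n} {p}
    (hx : x ∈ P.dom) (hy : IsProxSweep P S c x p y) : y ∈ P.dom := by
  rw [isProxSweep_iff] at hy
  have key : ∀ j : ℕ, ∀ t : Fin B, (t : ℕ) < j → y t ∈ P.domBlock t := by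
    intro j
    induction j with
    | zero => intro t ht; omega
    | succ j ih =>
      intro t ht
      exact ((hP.isMinOn_blockObj_iff hS c p
        (headTail_mem_dom hx fun s hs => ih s (by omega))).1 (hy t)).1
  exact fun t => key B t t.2

theorem headTail_sweep_mem_dom (hP : Assumptions P K) (hS : S.Admissible K) {c : ℝ}
    {x y : Blocks n} {p} (hx : x ∈ P.dom) (hy : IsProxSweep P S c x p y) (j : ℕ) :
    headTail y x j ∈ P.dom :=
  headTail_mem_dom hx fun s _ => hP.sweep_mem_dom hS hx hy s

/-- The subproblem of block `t` sees the new point only through its earlier blocks, so existence and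
uniqueness both follow by induction on the number of blocks already settled. -/
theorem existsUnique_sweep (hP : Assumptions P K) (hS : S.Admissible K) {c : ℝ} (hc : 0 ≤ c)
    {x : Blocks n} (hx : x ∈ P.dom) (p) : ∃! y, IsProxSweep P S c x p y := by
  have hex : ∀ j : ℕ, j ≤ B → ∃ y : Blocks n, ∀ t : Fin B, (t : ℕ) < j →
      y t ∈ P.domBlock t ∧
      IsMinOn (blockObj P S c p (headTail y x t) t) Set.univ (y t) := by
    intro j
    induction j with
    | zero => intro _; exact ⟨x, fun t ht => by omega⟩
    | succ j ih =>
      intro hj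
      obtain ⟨y, hy⟩ := ih (by omega)
      set t₀ : Fin B := ⟨j, by omega⟩ with ht₀
      have hW : headTail y x j ∈ P.dom := headTail_mem_dom hx fun s hs => (hy s hs).1
      obtain ⟨u, hu⟩ := hP.exists_isMinOn_blockObj hS c p hW t₀
      have hlow : ∀ s : Fin B, (s : ℕ) < j → splice y t₀ u y s = y s := fun s hs =>
        splice_self_apply_ne _ (fun h => by rw [h, ht₀] at hs; simp at hs) _
      refine ⟨splice y t₀ u y, fun t ht => ?_⟩
      rw [headTail_congr (y' := y) fun s hs => hlow s (by omega)]
      by_cases h : (t : ℕ) < j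
      · rw [hlow t h]; exact hy t h
      · obtain rfl : t = t₀ := Fin.ext (by simp only [ht₀]; omega)
        rw [splice_apply_self]
        exact ⟨((hP.isMinOn_blockObj_iff hS c p hW).1 hu).1, hu⟩
  obtain ⟨y, hy⟩ := hex B le_rfl
  refine ⟨y, isProxSweep_iff.2 fun t => (hy t t.2).2, ?_⟩
  intro y' hy'
  have hy'd := hP.sweep_mem_dom hS hx hy'
  rw [isProxSweep_iff] at hy'
  have key : ∀ j : ℕ, ∀ t : Fin B, (t : ℕ) < j → y' t = y t := by
    intro j
    induction j with
    | zero => intro t ht; omega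
    | succ j ih =>
      intro t ht
      have h1 := hy' t
      have he : headTail y' x t = headTail y x t := headTail_congr fun s hs => ih s (by omega)
      have hW : headTail y x t ∈ P.dom := headTail_mem_dom hx fun s _ => (hy s s.2).1
      rw [he] at h1
      exact hP.isMinOn_blockObj_unique hS hc p hW h1 (hy t t.2).2
  ext t : 1
  exact key B t t.2

/-- Decrease of the augmented Lagrangian along a sweep. -/
theorem sweep_descent (hP : Assumptions P K) (hS : S.Admissible K) {c : ℝ}
    {x y : Blocks n} {p} (hx : x ∈ P.dom) (hy : IsProxSweep P S c x p y) :
    3 / 4 * ‖y - x‖ ^ 2 + S.lam * c / 2 * ∑ t, ‖P.ABlock t (y t - x t)‖ ^ 2 ≤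
      S.lam * (P.lagReal S.theta c x p - P.lagReal S.theta c y p) := by
  have hblock : ∀ t : Fin B, 3 / 4 * ‖y t - x t‖ ^ 2
      + S.lam * c / 2 * ‖P.ABlock t (y t - x t)‖ ^ 2 ≤
      S.lam * P.lagReal S.theta c (headTail y x t) p
        - S.lam * P.lagReal S.theta c (headTail y x (t + 1)) p := by
    intro t
    -- Comparison with the old block: growth `1/4` and the prox term `1/2` add up to `3/4`.
    have h := hP.blockReal_growth hS c p (hP.headTail_sweep_mem_dom hS hx hy t)
      (isProxSweep_iff.1 hy t) (u := x t) (hx t)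
    unfold blockReal at h
    rw [← splice_eq_splice_headTail, ← headTail_succ, headTail_apply_self, sub_self] at h
    have hself : splice (headTail y x t) t (x t) (headTail y x t) = headTail y x t := by
      have := splice_self_self (headTail y x t) t
      rwa [headTail_apply_self] at this
    rw [hself] at h
    simp only [norm_zero] at h
    linarith
  have hsum := Finset.sum_le_sum fun t (_ : t ∈ Finset.univ) => hblock t
  rw [Fin.sum_univ_eq_sum_range (fun i => S.lam * P.lagReal S.theta c (headTail y x i) p
        - S.lam * P.lagReal S.theta c (headTail y x (i + 1)) p) B,
    Finset.sum_range_sub' (fun i => S.lam * P.lagReal S.theta c (headTail y x i) p),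
    headTail_zero, headTail_card, Finset.sum_add_distrib, ← Finset.mul_sum, ← Finset.mul_sum]
    at hsum
  rw [PiLp.norm_sq_eq_of_L2]
  simp only [PiLp.sub_apply]
  linarith

/-- The residual of a sweep is an element of `∇f + A^* q + ∂h` at the new iterate. -/
theorem sweep_subgradient (hP : Assumptions P K) (hS : S.Admissible K) {c : ℝ}
    {x y : Blocks n} {p} (hx : x ∈ P.dom) (hy : IsProxSweep P S c x p y)
    {u : Blocks n} (hu : u ∈ P.dom) :
    (P.h y).toReal + inner ℝ (sweepResidual P S c x y - P.grad y
      - ContinuousLinearMap.adjoint P.A ((1 - S.theta) • p + c • (P.A y - P.d))) (u - y) ≤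
      (P.h u).toReal := by
  have hyd := hP.sweep_mem_dom hS hx hy
  rw [hP.toReal_h hyd, hP.toReal_h hu, PiLp.inner_apply, ← Finset.sum_add_distrib]
  refine Finset.sum_le_sum fun t _ => ?_
  have h := hP.block_optimality hS c p (hP.headTail_sweep_mem_dom hS hx hy t)
      (isProxSweep_iff.1 hy t) (u := u t) (hu t)
  rw [← splice_eq_splice_headTail, headTail_apply_self] at h
  -- Optimality of block `t` holds at the partially updated point; its difference in `A` from the
  -- final point is the coupling sum built into the residual.
  have hA : P.A (splice y t (y t) x) - P.d =
      (P.A y - P.d) - ∑ j ∈ Finset.Ioi t, P.ABlock j (y j - x j) := by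
    have : ∑ j ∈ Finset.Ioi t, P.ABlock j (y j - x j) = P.A y - P.A (splice y t (y t) x) := by
      rw [← map_sub, P.A_apply]
      refine Finset.sum_subset_zero_on_sdiff (Finset.subset_univ _) (fun j hj => ?_)
        (fun j hj => ?_)
      · have hj' : j ≤ t := by simpa using hj
        rcases hj'.eq_or_lt with rfl | hlt
        · simp [splice_apply_self]
        · simp [splice_apply_ne y hlt.ne, hlt]
      · have hj' : t < j := by simpa using hj
        simp [splice_apply_ne y hj'.ne', hj'.not_gt]
    rw [this]; abel
  rw [hA] at h
  have hv : (sweepResidual P S c x y - P.grad y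
      - ContinuousLinearMap.adjoint P.A ((1 - S.theta) • p + c • (P.A y - P.d))) t =
      -(P.grad (splice y t (y t) x) t
        + ContinuousLinearMap.adjoint (P.ABlock t)
          ((1 - S.theta) • p + c • (P.A y - P.d - ∑ j ∈ Finset.Ioi t, P.ABlock j (y j - x j)))
        + (1 / S.lam) • (y t - x t)) := by
    rw [PiLp.sub_apply, PiLp.sub_apply, P.adjoint_A_apply]
    simp only [sweepResidual, map_add, map_smul, map_sub, smul_sub]
    abel
  rw [hv, inner_neg_left]
  simp only [PiLp.sub_apply]
  linarith

/-- The residual of a sweep is controlled by the step. -/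
theorem sweepResidual_sq_le (hP : Assumptions P K) (hS : S.Admissible K) {c : ℝ} (hc : 0 ≤ c)
    {x y : Blocks n} (hx : x ∈ P.dom) (hy : y ∈ P.dom) :
    ‖sweepResidual P S c x y‖ ^ 2 ≤ (kappa0 K S ^ 2 + kappa5 P * c) *
      (‖y - x‖ ^ 2 / (4 * S.lam) + c / 8 * ∑ t, ‖P.ABlock t (y t - x t)‖ ^ 2) := by
  have hlam := hS.lam_pos
  have hM := hP.iSup_M_nonneg
  have hB : (1 : ℝ) ≤ B := by exact_mod_cast hP.one_le_B
  set Δ := ‖y - x‖ with hΔ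
  set Q := ∑ t, ‖P.ABlock t (y t - x t)‖ ^ 2 with hQ
  have hQ0 : 0 ≤ Q := Finset.sum_nonneg fun _ _ => sq_nonneg _
  have htail : ∀ t : Fin B, ‖∑ j ∈ Finset.Ioi t, P.ABlock j (y j - x j)‖ ≤
      Real.sqrt ((B - 1) * Q) := by
    intro t
    refine (norm_sum_le _ _).trans (Real.le_sqrt_of_sq_le ?_)
    refine sq_sum_le_card_mul_sum_sq.trans ?_
    have h1 : ((Finset.Ioi t).card : ℝ) ≤ B - 1 := by
      rw [Fin.card_Ioi, le_sub_iff_add_le]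
      exact_mod_cast (by omega : B - 1 - (t : ℕ) + 1 ≤ B)
    have h2 : ∑ j ∈ Finset.Ioi t, ‖P.ABlock j (y j - x j)‖ ^ 2 ≤ Q :=
      Finset.sum_le_sum_of_subset_of_nonneg (Finset.subset_univ _) fun _ _ _ => sq_nonneg _
    exact mul_le_mul h1 h2 (Finset.sum_nonneg fun _ _ => sq_nonneg _) (by linarith)
  have hblock : ∀ t : Fin B, ‖sweepResidual P S c x y t‖ ≤
      (K.M + 1 / S.lam) * Δ + c * Real.sqrt ((B - 1) * Q) * ‖P.ABlock t‖ := by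
    intro t
    have e1 : ‖P.grad y t - P.grad (splice y t (y t) x) t‖ ≤ K.M * Δ := by
      rw [norm_sub_rev]
      refine (hP.grad_lipschitz t y hy x hx).trans ?_
      have : tailDist t x y ≤ Δ := by
        rw [hΔ, norm_sub_rev]; exact tailDist_le t x y
      exact mul_le_mul (K.MBlock_le t) this (Real.sqrt_nonneg _) hM
    have e2 : ‖c • ContinuousLinearMap.adjoint (P.ABlock t)
          (∑ j ∈ Finset.Ioi t, P.ABlock j (y j - x j))‖ ≤
        c * Real.sqrt ((B - 1) * Q) * ‖P.ABlock t‖ := by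
      rw [norm_smul, Real.norm_of_nonneg hc, mul_assoc]
      refine mul_le_mul_of_nonneg_left ?_ hc
      refine (ContinuousLinearMap.le_opNorm _ _).trans ?_
      rw [LinearIsometryEquiv.norm_map, mul_comm]
      exact mul_le_mul_of_nonneg_right (htail t) (norm_nonneg _)
    have e3 : ‖(1 / S.lam) • (y t - x t)‖ ≤ 1 / S.lam * Δ := by
      rw [norm_smul, Real.norm_of_nonneg (by positivity)]
      exact mul_le_mul_of_nonneg_left (PiLp.norm_apply_le (y - x) t) (by positivity)
    calc ‖sweepResidual P S c x y t‖ ≤ K.M * Δ + c * Real.sqrt ((B - 1) * Q) * ‖P.ABlock t‖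
          + 1 / S.lam * Δ :=
          (norm_sub_le _ _).trans (add_le_add ((norm_add_le _ _).trans (add_le_add e1 e2)) e3)
      _ = _ := by ring
  have hnorm : ‖sweepResidual P S c x y‖ ≤ B * (K.M + 1 / S.lam) * Δ
      + c * Real.sqrt ((B - 1) * Q) * normADag P := by
    refine (norm_le_sum_norm _).trans ((Finset.sum_le_sum fun t _ => hblock t).trans ?_)
    rw [Finset.sum_add_distrib, ← Finset.mul_sum (a := c * _), normADag, Finset.sum_const,
      Finset.card_univ, Fintype.card_fin, nsmul_eq_mul, ← mul_assoc]
  refine (pow_le_pow_left₀ (norm_nonneg _) hnorm 2).trans ?_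
  have hB1 : (0 : ℝ) ≤ B - 1 := by linarith
  have hk5 : 0 ≤ kappa5 P := by unfold kappa5; positivity
  refine add_sq_le_mul_add (sq_nonneg _) (by positivity) (by positivity) (by positivity) ?_ ?_
  -- `κ₀` carries `B²` where the estimate needs only `B`; the spare factor is at least `1`.
  · have : kappa0 K S ^ 2 * (Δ ^ 2 / (4 * S.lam)) =
        ((B : ℝ) * (B * (K.M + 1 / S.lam) * Δ)) ^ 2 := by
      unfold kappa0
      rw [div_pow, Real.sq_sqrt hlam.le]
      field_simp
      ring
    rw [this]
    have h0 : 0 ≤ B * (K.M + 1 / S.lam) * Δ := by positivity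
    exact pow_le_pow_left₀ h0 (le_mul_of_one_le_left h0 hB) 2
  · rw [mul_pow, mul_pow, Real.sq_sqrt (by positivity)]
    unfold kappa5
    apply le_of_eq
    ring

end Assumptions

/-! ### Dual step, potential and multiplier bounds -/

section DualStep

variable {F : Type*} [NormedAddCommGroup F] [InnerProductSpace ℝ F]

/-- The dual step in terms of successive multipliers. -/
theorem inner_dual_step {θ χ c : ℝ} (hχc : 0 < χ * c) {p₀ p₁ r : F}
    (hp : p₁ = (1 - θ) • p₀ + (χ * c) • r) :
    inner ℝ (p₁ - p₀) r = 1 / (χ * c) * ((2 - θ) / 2 * ‖p₁ - p₀‖ ^ 2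
      + θ / 2 * (‖p₁‖ ^ 2 - ‖p₀‖ ^ 2)) := by
  have hr : (χ * c) • r = p₁ - (1 - θ) • p₀ := by rw [hp]; abel
  have h : χ * c * inner ℝ (p₁ - p₀) r = (2 - θ) / 2 * ‖p₁ - p₀‖ ^ 2
      + θ / 2 * (‖p₁‖ ^ 2 - ‖p₀‖ ^ 2) := by
    rw [← inner_smul_right, hr, norm_sub_sq_real]
    simp only [inner_sub_left, inner_sub_right, inner_smul_right, real_inner_self_eq_norm_sq]
    rw [real_inner_comm p₁ p₀]
    ring
  rw [← h, ← mul_assoc, one_div_mul_cancel hχc.ne', one_mul]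

/-- Convexity of the squared norm for the combination `(1 - θ) e + θ (w / θ)`. Successive multiplier
increments therefore contract up to a term in the primal step. -/
theorem norm_sq_dual_diff_le {θ : ℝ} (hθ : 0 < θ) (hθ1 : θ ≤ 1) (e w : F) :
    ‖(1 - θ) • e + w‖ ^ 2 ≤ (1 - θ) * ‖e‖ ^ 2 + 1 / θ * ‖w‖ ^ 2 := by
  have h := norm_sq_combo e ((1 / θ) • w) (a := 1 - θ) (b := θ) (by ring)
  rw [smul_smul, mul_one_div_cancel hθ.ne', one_smul] at h
  rw [h, norm_smul, Real.norm_of_nonneg (by positivity), mul_pow]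
  have h1 : 0 ≤ (1 - θ) * θ * ‖e - (1 / θ) • w‖ ^ 2 :=
    mul_nonneg (mul_nonneg (by linarith) hθ.le) (sq_nonneg _)
  have h2 : θ * ((1 / θ) ^ 2 * ‖w‖ ^ 2) = 1 / θ * ‖w‖ ^ 2 := by field_simp
  linarith

end DualStep

/-- The infinite sequence of iterates that the static method would produce without its
termination tests. -/
structure IsTrajectory (P : Problem B n l) (S : Params) (c : ℝ) (x : ℕ → Blocks n)
    (p : ℕ → EuclideanSpace ℝ (Fin l)) : Prop where
  sweep : ∀ i, IsProxSweep P S c (x i) (p i) (x (i + 1))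
  dual : ∀ i, p (i + 1) = (1 - S.theta) • p i + (S.chi * c) • (P.A (x (i + 1)) - P.d)

/-- The potential that decreases along the static method. -/
def potential (P : Problem B n l) (S : Params) (c : ℝ) (x : ℕ → Blocks n)
    (p : ℕ → EuclideanSpace ℝ (Fin l)) (i : ℕ) : ℝ :=
  P.lagReal S.theta c (x i) (p i) - (1 - S.theta) * S.theta / (2 * S.chi * c) * ‖p i‖ ^ 2
    + (1 - S.theta) ^ 2 * (2 - S.theta) / (2 * S.chi * c * S.theta) * ‖p i - p (i - 1)‖ ^ 2

theorem norm_A_sq_le (P : Problem B n l) (x : Blocks n) :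
    ‖P.A x‖ ^ 2 ≤ B * ∑ t, ‖P.ABlock t (x t)‖ ^ 2 := by
  rw [P.A_apply]
  calc ‖∑ t, P.ABlock t (x t)‖ ^ 2 ≤ (∑ t, ‖P.ABlock t (x t)‖) ^ 2 :=
        pow_le_pow_left₀ (norm_nonneg _) (norm_sum_le _ _) 2
    _ ≤ _ := by
      simpa using sq_sum_le_card_mul_sum_sq (s := Finset.univ) (f := fun t => ‖P.ABlock t (x t)‖)

namespace Assumptions

theorem A_sub_d_eq (hP : Assumptions P K) (x : Blocks n) : P.A x - P.d = P.A (x - K.zdag) := by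
  rw [map_sub, hP.zdag_feasible.2]

theorem norm_A_sub_d_le (hP : Assumptions P K) {x : Blocks n} (hx : x ∈ P.dom) :
    ‖P.A x - P.d‖ ≤ ‖P.A‖ * Ddag P K := by
  rw [hP.A_sub_d_eq]
  exact (P.A.le_opNorm _).trans
    (mul_le_mul_of_nonneg_left (hP.norm_sub_zdag_le hx) (norm_nonneg _))

/-- The admissibility condition with `B` weakened to `1`, for estimates in which the number of
blocks plays no role. -/
theorem chi_theta_le (hP : Assumptions P K) (hS : S.Admissible K) :
    S.chi * ((1 - S.theta) * (2 - S.theta)) ≤ S.theta ^ 2 / 2 := by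
  have hB : (1 : ℝ) ≤ B := by exact_mod_cast hP.one_le_B
  have h := hS.chi_theta
  have h0 : 0 ≤ S.chi * ((1 - S.theta) * (2 - S.theta)) :=
    mul_nonneg hS.chi_pos.le (mul_nonneg (by linarith [hS.theta_le]) (by linarith [hS.theta_le]))
  have := mul_le_mul_of_nonneg_right hB h0
  linarith

/-- The Slater point bounds the multiplier of a sweep. -/
theorem slater_bound (hP : Assumptions P K) (hS : S.Admissible K) {c : ℝ}
    {x y : Blocks n} {p} (hx : x ∈ P.dom) (hy : IsProxSweep P S c x p y)
    (hp : p ∈ Set.range P.A) :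
    ddag P K * sigmaPlus P * ‖(1 - S.theta) • p + c • (P.A y - P.d)‖
      + inner ℝ ((1 - S.theta) • p + c • (P.A y - P.d)) (P.A y - P.d) ≤
      2 * Ddag P K * (‖sweepResidual P S c x y‖ + (K.Kh + Gf P)) := by
  have hyd := hP.sweep_mem_dom hS hx hy
  set q := (1 - S.theta) • p + c • (P.A y - P.d) with hq
  set v := sweepResidual P S c x y with hv
  -- Only on the range of `A` does `σ_A^+` bound `A^*` from below; feasibility of `z_†` puts `A y -
  -- d` there.
  have hqr : q ∈ Set.range P.A := by
    obtain ⟨z, rfl⟩ := hp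
    refine ⟨(1 - S.theta) • z + c • (y - K.zdag), ?_⟩
    rw [hq, hP.A_sub_d_eq, map_add, map_smul, map_smul]
  set ξ := v - P.grad y - ContinuousLinearMap.adjoint P.A q with hξ
  have hd := hP.ddag_pos
  have h1 := norm_subgradient_le (g := fun u => (P.h u).toReal) (s := P.dom) (x := y) (ξ := ξ)
    hd.le hP.closedBall_subset_dom hP.Kh_nonneg
    (fun u hu => (le_abs_self _).trans (hP.h_lipschitz u hu y hyd))
    (fun u hu => hP.sweep_subgradient hS hx hy hu)
  have hg := hP.norm_grad_le hyd
  have hD := hP.norm_sub_zdag_le hyd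
  have h2 : ‖ContinuousLinearMap.adjoint P.A q‖ ≤ ‖v‖ + Gf P + ‖ξ‖ := by
    have : ContinuousLinearMap.adjoint P.A q = v - P.grad y - ξ := by rw [hξ]; abel
    rw [this]
    linarith [norm_sub_le (v - P.grad y) ξ, norm_sub_le v (P.grad y)]
  have h3 := hP.sigmaPlus_mul_norm_le hqr
  have h4 : inner ℝ ξ (y - K.zdag) ≤ (‖v‖ + Gf P) * Ddag P K - inner ℝ q (P.A y - P.d) := by
    rw [hξ, inner_sub_left, ContinuousLinearMap.adjoint_inner_left, hP.A_sub_d_eq]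
    have : inner ℝ (v - P.grad y) (y - K.zdag) ≤ (‖v‖ + Gf P) * Ddag P K := by
      refine (real_inner_le_norm _ _).trans ?_
      have hvg : ‖v - P.grad y‖ ≤ ‖v‖ + Gf P := by linarith [norm_sub_le v (P.grad y)]
      exact mul_le_mul hvg hD (norm_nonneg _) (by linarith [norm_nonneg v, hP.Gf_nonneg])
    linarith
  have h5 := mul_le_mul_of_nonneg_left (h3.trans h2) hd.le
  have h6 : (ddag P K + ‖y - K.zdag‖) * K.Kh ≤ (2 * Ddag P K) * K.Kh :=
    mul_le_mul_of_nonneg_right (by linarith [hP.ddag_le_Ddag]) hP.Kh_nonneg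
  have h7 : ddag P K * (‖v‖ + Gf P) ≤ Ddag P K * (‖v‖ + Gf P) :=
    mul_le_mul_of_nonneg_right hP.ddag_le_Ddag (by linarith [norm_nonneg v, hP.Gf_nonneg])
  linarith

theorem kappa4_pos (hP : Assumptions P K) (hS : S.Admissible K) : 0 < kappa4 P K S := by
  have := hP.ddag_pos
  have := hP.Ddag_pos
  have := hP.sigmaPlus_spec.1
  have := hS.chi_pos
  have := hS.theta_pos
  unfold kappa4
  positivity

/-- The recursion for the multiplier norms. -/
theorem norm_dual_succ_le (hP : Assumptions P K) (hS : S.Admissible K) {c : ℝ} (hc : 0 < c)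
    {x y : Blocks n} {p p₁} (hx : x ∈ P.dom) (hy : IsProxSweep P S c x p y)
    (hp : p ∈ Set.range P.A) (hp₁ : p₁ = (1 - S.theta) • p + (S.chi * c) • (P.A y - P.d)) :
    ‖p₁‖ ≤ (1 - S.theta) * ‖p‖
      + 2 * S.theta / kappa4 P K S * (‖sweepResidual P S c x y‖ + (K.Kh + Gf P)) := by
  have hχ := hS.chi_pos
  have hθ := hS.theta_pos
  have h4 := hP.kappa4_pos hS
  have hd := hP.ddag_pos
  have hD := hP.Ddag_pos
  have hσ := hP.sigmaPlus_spec.1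
  have hV : 0 ≤ ‖sweepResidual P S c x y‖ + (K.Kh + Gf P) := by
    linarith [norm_nonneg (sweepResidual P S c x y), hP.Kh_nonneg, hP.Gf_nonneg]
  -- Otherwise `χ c ⟨p₁, r⟩ ≥ ‖p₁‖ (‖p₁‖ - (1 - θ) ‖p‖) ≥ 0`, hence `⟨q, r⟩ ≥ 0`, and the inner
  -- product can be dropped from the Slater bound.
  by_cases hw : ‖p₁‖ - (1 - S.theta) * ‖p‖ ≤ 0
  · have : 0 ≤ 2 * S.theta / kappa4 P K S * (‖sweepResidual P S c x y‖ + (K.Kh + Gf P)) := by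
      positivity
    linarith
  push Not at hw
  have hs := hP.slater_bound hS hx hy hp
  set r := P.A y - P.d with hr
  set q := (1 - S.theta) • p + c • r with hq
  have hqn : ‖p₁‖ - (1 - S.theta) * ‖p‖ ≤ S.chi * ‖q‖ := by
    have e : p₁ = ((1 - S.chi) * (1 - S.theta)) • p + S.chi • q := by
      rw [hp₁, hq]; module
    have h1 : ‖p₁‖ ≤ (1 - S.chi) * (1 - S.theta) * ‖p‖ + S.chi * ‖q‖ := by
      rw [e]
      refine (norm_add_le _ _).trans ?_
      rw [norm_smul, norm_smul, Real.norm_of_nonneg hχ.le, Real.norm_of_nonneg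
        (mul_nonneg (by linarith [hS.chi_le]) (by linarith [hS.theta_le]))]
    have h2 : 0 ≤ S.chi * (1 - S.theta) * ‖p‖ :=
      mul_nonneg (mul_nonneg hχ.le (by linarith [hS.theta_le])) (norm_nonneg _)
    linarith
  have hqr : 0 ≤ inner ℝ q r := by
    have e : q = p₁ + ((1 - S.chi) * c) • r := by rw [hp₁, hq]; module
    have h1 : 0 ≤ (1 - S.chi) * c * ‖r‖ ^ 2 :=
      mul_nonneg (mul_nonneg (by linarith [hS.chi_le]) hc.le) (sq_nonneg _)
    have e2 : (S.chi * c) • r = p₁ - (1 - S.theta) • p := by rw [hp₁]; abel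
    have h2 : 0 ≤ S.chi * c * inner ℝ p₁ r := by
      rw [← inner_smul_right, e2, inner_sub_right, inner_smul_right, real_inner_self_eq_norm_sq]
      have h3 := mul_le_mul_of_nonneg_left (real_inner_le_norm p₁ p)
        (by linarith [hS.theta_le] : 0 ≤ 1 - S.theta)
      have h4 := mul_nonneg (norm_nonneg p₁) hw.le
      linarith
    have h3 : 0 ≤ inner ℝ p₁ r := nonneg_of_mul_nonneg_right h2 (by positivity)
    rw [e, inner_add_left, inner_smul_left, real_inner_self_eq_norm_sq]
    simp only [conj_trivial]
    linarith
  have hfin : ddag P K * sigmaPlus P * (‖p₁‖ - (1 - S.theta) * ‖p‖) ≤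
      S.chi * (2 * Ddag P K * (‖sweepResidual P S c x y‖ + (K.Kh + Gf P))) := by
    have h1 := mul_le_mul_of_nonneg_left hqn (by positivity : 0 ≤ ddag P K * sigmaPlus P)
    have h2 := mul_le_mul_of_nonneg_left hs hχ.le
    have h3 := mul_nonneg hχ.le hqr
    linarith
  have e : 2 * S.theta / kappa4 P K S * (‖sweepResidual P S c x y‖ + (K.Kh + Gf P)) =
      S.chi * (2 * Ddag P K * (‖sweepResidual P S c x y‖ + (K.Kh + Gf P)))
        / (ddag P K * sigmaPlus P) := by
    unfold kappa4
    field_simp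
  rw [e, ← sub_le_iff_le_add', le_div_iff₀ (by positivity)]
  linarith

variable {c : ℝ} {x : ℕ → Blocks n} {p : ℕ → EuclideanSpace ℝ (Fin l)}

theorem trajectory_mem_dom (hP : Assumptions P K) (hS : S.Admissible K)
    (hT : IsTrajectory P S c x p) (hx : x 0 ∈ P.dom) (i : ℕ) : x i ∈ P.dom := by
  induction i with
  | zero => exact hx
  | succ i ih => exact hP.sweep_mem_dom hS ih (hT.sweep i)

theorem trajectory_mem_range (hP : Assumptions P K)
    (hT : IsTrajectory P S c x p) (hp : p 0 ∈ Set.range P.A) (i : ℕ) : p i ∈ Set.range P.A := by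
  induction i with
  | zero => exact hp
  | succ i ih =>
    obtain ⟨z, hz⟩ := ih
    refine ⟨(1 - S.theta) • z + (S.chi * c) • (x (i + 1) - K.zdag), ?_⟩
    rw [hT.dual, hP.A_sub_d_eq, map_add, map_smul, map_smul, hz]

/-- The damped dual step maps the ball of radius `κ₁ c` into itself, since `χ c ‖A‖ D_† = θ κ₁ c`.
-/
theorem norm_trajectory_le (hP : Assumptions P K) (hS : S.Admissible K) (hc : 0 < c)
    (hT : IsTrajectory P S c x p) (hx : x 0 ∈ P.dom) (hp : ‖p 0‖ ≤ kappa1 P K S * c) (i : ℕ) :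
    ‖p i‖ ≤ kappa1 P K S * c := by
  have hθ := hS.theta_pos
  have hχ := hS.chi_pos
  induction i with
  | zero => exact hp
  | succ i ih =>
    rw [hT.dual]
    refine (norm_add_le _ _).trans ?_
    rw [norm_smul, norm_smul, Real.norm_of_nonneg (by linarith [hS.theta_le]),
      Real.norm_of_nonneg (by positivity)]
    have h1 := mul_le_mul_of_nonneg_left ih (by linarith [hS.theta_le] : 0 ≤ 1 - S.theta)
    have h2 := mul_le_mul_of_nonneg_left
      (hP.norm_A_sub_d_le (hP.trajectory_mem_dom hS hT hx (i + 1)))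
      (by positivity : 0 ≤ S.chi * c)
    have e : S.chi * c * (‖P.A‖ * Ddag P K) = S.theta * (kappa1 P K S * c) := by
      unfold kappa1; field_simp
    linarith

/-- The dual step adds a telescoping multiple of `‖p‖²` and `g` times the squared increment. The
weight `g/θ - g` on that increment in the potential absorbs the latter through its contraction by `1
- θ`; the remainder costs half of the penalty decrease, by the condition on `χ` and `θ`. -/
theorem potential_decrease (hP : Assumptions P K) (hS : S.Admissible K) (hc : 0 < c)
    (hT : IsTrajectory P S c x p) (hx : x 0 ∈ P.dom) {i : ℕ} (hi : 1 ≤ i) :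
    3 / (4 * S.lam) * ‖x (i + 1) - x i‖ ^ 2
      + c / 4 * ∑ t, ‖P.ABlock t (x (i + 1) t - x i t)‖ ^ 2 ≤
      potential P S c x p i - potential P S c x p (i + 1) := by
  have hθ := hS.theta_pos
  have hθ1 := hS.theta_le
  have hχ := hS.chi_pos
  have hlam := hS.lam_pos
  -- The contraction compares two dual steps, so `p^i` must itself arise from one; hence `i ≥ 1`.
  obtain ⟨j, rfl⟩ : ∃ j, i = j + 1 := ⟨i - 1, by omega⟩
  set Q := ∑ t, ‖P.ABlock t (x (j + 1 + 1) t - x (j + 1) t)‖ ^ 2 with hQ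
  have hQ0 : 0 ≤ Q := Finset.sum_nonneg fun _ _ => sq_nonneg _
  have h1 := hP.sweep_descent hS (hP.trajectory_mem_dom hS hT hx (j + 1)) (hT.sweep (j + 1))
  rw [← hQ] at h1
  have h1' : 3 / (4 * S.lam) * ‖x (j + 1 + 1) - x (j + 1)‖ ^ 2 + c / 2 * Q ≤
      P.lagReal S.theta c (x (j + 1)) (p (j + 1))
        - P.lagReal S.theta c (x (j + 1 + 1)) (p (j + 1)) := by
    refine le_of_mul_le_mul_left (le_trans (le_of_eq ?_) h1) hlam
    field_simp
  -- the dual step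
  have h2 : P.lagReal S.theta c (x (j + 1 + 1)) (p (j + 1 + 1))
      - P.lagReal S.theta c (x (j + 1 + 1)) (p (j + 1)) =
      (1 - S.theta) * inner ℝ (p (j + 1 + 1) - p (j + 1)) (P.A (x (j + 1 + 1)) - P.d) := by
    unfold Problem.lagReal
    rw [inner_sub_left]
    ring
  rw [inner_dual_step (by positivity) (hT.dual (j + 1))] at h2
  have h3 : ‖p (j + 1 + 1) - p (j + 1)‖ ^ 2 ≤ (1 - S.theta) * ‖p (j + 1) - p j‖ ^ 2
      + 1 / S.theta * ((S.chi * c) ^ 2 * (B * Q)) := by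
    have e : p (j + 1 + 1) - p (j + 1) = (1 - S.theta) • (p (j + 1) - p j)
        + (S.chi * c) • P.A (x (j + 1 + 1) - x (j + 1)) := by
      rw [hT.dual (j + 1)]
      nth_rewrite 2 [hT.dual j]
      rw [map_sub]
      module
    rw [e]
    refine (norm_sq_dual_diff_le hθ hθ1 _ _).trans ?_
    rw [norm_smul, mul_pow, Real.norm_of_nonneg (by positivity)]
    have h := norm_A_sq_le P (x (j + 1 + 1) - x (j + 1))
    gcongr
    exact h
  set g := (1 - S.theta) * (2 - S.theta) / (2 * S.chi * c) with hg
  have hg0 : 0 ≤ g := div_nonneg (mul_nonneg (by linarith) (by linarith)) (by positivity)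
  have h4 := mul_le_mul_of_nonneg_left h3 (by positivity : 0 ≤ g / S.theta)
  have h5 : g / S.theta * (1 / S.theta * ((S.chi * c) ^ 2 * (B * Q))) ≤ c / 4 * Q := by
    have e : g / S.theta * (1 / S.theta * ((S.chi * c) ^ 2 * (B * Q))) =
        (2 * S.chi * B * (2 - S.theta) * (1 - S.theta)) * (c * Q) / (4 * S.theta ^ 2) := by
      rw [hg]; field_simp; ring
    rw [e, div_le_iff₀ (by positivity)]
    have := mul_le_mul_of_nonneg_right hS.chi_theta (mul_nonneg hc.le hQ0)
    linarith
  have e1 : (1 - S.theta) ^ 2 * (2 - S.theta) / (2 * S.chi * c * S.theta) =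
      g / S.theta - g := by
    rw [hg]; field_simp
  have e2 : (1 - S.theta) * (1 / (S.chi * c) * ((2 - S.theta) / 2
        * ‖p (j + 1 + 1) - p (j + 1)‖ ^ 2
      + S.theta / 2 * (‖p (j + 1 + 1)‖ ^ 2 - ‖p (j + 1)‖ ^ 2))) =
      g * ‖p (j + 1 + 1) - p (j + 1)‖ ^ 2
      + (1 - S.theta) * S.theta / (2 * S.chi * c) * (‖p (j + 1 + 1)‖ ^ 2 - ‖p (j + 1)‖ ^ 2) := by
    rw [hg]; field_simp
  rw [e2] at h2
  unfold potential
  simp only [Nat.add_sub_cancel]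
  rw [e1]
  have e3 : g / S.theta * ((1 - S.theta) * ‖p (j + 1) - p j‖ ^ 2
      + 1 / S.theta * ((S.chi * c) ^ 2 * (B * Q))) =
      (g / S.theta - g) * ‖p (j + 1) - p j‖ ^ 2
        + g / S.theta * (1 / S.theta * ((S.chi * c) ^ 2 * (B * Q))) := by
    field_simp
  rw [e3] at h4
  linarith

/-- Two small consecutive multipliers control `A x - d` and every multiplier term. In units of `R² /
(χ² c)` the three positive parts are `θ²/2`, `(2 - θ)²/2` and `(1 - θ) θ`, with sum `2 - θ`. -/
theorem potential_le (hP : Assumptions P K) (hS : S.Admissible K) (hc : 0 < c)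
    (hT : IsTrajectory P S c x p) (hx : x 0 ∈ P.dom) (i : ℕ) {R : ℝ} (h0 : ‖p i‖ ≤ R)
    (h1 : ‖p (i + 1)‖ ≤ R) :
    potential P S c x p (i + 1) ≤ sSup (P.phi '' P.dom) + 2 * R ^ 2 / (S.chi ^ 2 * c) := by
  have hθ := hS.theta_pos
  have hθ1 := hS.theta_le
  have hχ := hS.chi_pos
  have hR : 0 ≤ R := (norm_nonneg _).trans h0
  have h1θ : 0 ≤ 1 - S.theta := by linarith
  have hy := hP.chi_theta_le hS
  set r := P.A (x (i + 1)) - P.d with hr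
  set Z := R ^ 2 / (S.chi ^ 2 * c) with hZ
  have hZ0 : 0 ≤ Z := by positivity
  have hrn : ‖r‖ ≤ (2 - S.theta) * R / (S.chi * c) := by
    rw [le_div_iff₀ (by positivity)]
    have e : (S.chi * c) • r = p (i + 1) - (1 - S.theta) • p i := by rw [hT.dual]; abel
    have := norm_sub_le (p (i + 1)) ((1 - S.theta) • p i)
    rw [← e, norm_smul, norm_smul, Real.norm_of_nonneg (by positivity),
      Real.norm_of_nonneg h1θ] at this
    have := mul_le_mul_of_nonneg_left h0 h1θ
    linarith
  have t1 : (1 - S.theta) * inner ℝ (p (i + 1)) r ≤ S.theta ^ 2 / 2 * Z := by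
    have : inner ℝ (p (i + 1)) r ≤ R * ((2 - S.theta) * R / (S.chi * c)) :=
      (real_inner_le_norm _ _).trans (mul_le_mul h1 hrn (norm_nonneg _) hR)
    calc _ ≤ (1 - S.theta) * (R * ((2 - S.theta) * R / (S.chi * c))) :=
          mul_le_mul_of_nonneg_left this h1θ
      _ = S.chi * ((1 - S.theta) * (2 - S.theta)) * Z := by rw [hZ]; field_simp
      _ ≤ _ := mul_le_mul_of_nonneg_right hy hZ0
  have t2 : c / 2 * ‖r‖ ^ 2 ≤ (2 - S.theta) ^ 2 / 2 * Z := by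
    calc _ ≤ c / 2 * ((2 - S.theta) * R / (S.chi * c)) ^ 2 := by gcongr
      _ = _ := by rw [hZ]; field_simp
  have t3 : (1 - S.theta) ^ 2 * (2 - S.theta) / (2 * S.chi * c * S.theta)
      * ‖p (i + 1) - p i‖ ^ 2 ≤ (1 - S.theta) * S.theta * Z := by
    have hn : ‖p (i + 1) - p i‖ ≤ 2 * R := by linarith [norm_sub_le (p (i + 1)) (p i)]
    have h2 : 0 ≤ 2 - S.theta := by linarith
    calc _ ≤ (1 - S.theta) ^ 2 * (2 - S.theta) / (2 * S.chi * c * S.theta) * (2 * R) ^ 2 := by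
          gcongr
      _ = S.chi * ((1 - S.theta) * (2 - S.theta)) * (2 * (1 - S.theta) / S.theta * Z) := by
          rw [hZ]; field_simp
      _ ≤ S.theta ^ 2 / 2 * (2 * (1 - S.theta) / S.theta * Z) :=
          mul_le_mul_of_nonneg_right hy (by positivity)
      _ = _ := by field_simp
  have t4 : 0 ≤ (1 - S.theta) * S.theta / (2 * S.chi * c) * ‖p (i + 1)‖ ^ 2 := by positivity
  have t5 := hP.phi_le_sSup (hP.trajectory_mem_dom hS hT hx (i + 1))
  have t6 : 2 * R ^ 2 / (S.chi ^ 2 * c) = 2 * Z := by rw [hZ]; ring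
  have t7 : 0 ≤ S.theta * Z := by positivity
  unfold potential Problem.lagReal
  simp only [Nat.add_sub_cancel, ← hr]
  rw [t6]
  linarith

/-- Completing the square removes `A x - d`. The remaining coefficient is `(1 - θ)² χ² + (1 - θ) θ χ
≤ 1 - θ ≤ 1`. -/
theorem le_potential (hP : Assumptions P K) (hS : S.Admissible K) (hc : 0 < c)
    (hT : IsTrajectory P S c x p) (hx : x 0 ∈ P.dom) (i : ℕ) :
    sInf (P.phi '' P.dom) - ‖p i‖ ^ 2 / (2 * S.chi ^ 2 * c) ≤ potential P S c x p i := by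
  have hθ := hS.theta_pos
  have hθ1 := hS.theta_le
  have hχ := hS.chi_pos
  have hχ1 := hS.chi_le
  have h1θ : 0 ≤ 1 - S.theta := by linarith
  have h2θ : 0 ≤ 2 - S.theta := by linarith
  set r := P.A (x i) - P.d with hr
  have t1 : -((1 - S.theta) ^ 2 / (2 * c) * ‖p i‖ ^ 2) ≤
      (1 - S.theta) * inner ℝ (p i) r + c / 2 * ‖r‖ ^ 2 := by
    have h := sq_nonneg ‖(1 - S.theta) • p i + c • r‖
    rw [norm_add_sq_real, norm_smul, norm_smul, mul_pow, mul_pow, inner_smul_left,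
      inner_smul_right, Real.norm_eq_abs, Real.norm_eq_abs, sq_abs, sq_abs] at h
    simp only [conj_trivial] at h
    have e : (1 - S.theta) * inner ℝ (p i) r + c / 2 * ‖r‖ ^ 2
        + (1 - S.theta) ^ 2 / (2 * c) * ‖p i‖ ^ 2 =
        ((1 - S.theta) ^ 2 * ‖p i‖ ^ 2 + 2 * ((1 - S.theta) * (c * inner ℝ (p i) r))
          + c ^ 2 * ‖r‖ ^ 2) / (2 * c) := by field_simp; ring
    have : 0 ≤ ((1 - S.theta) ^ 2 * ‖p i‖ ^ 2 + 2 * ((1 - S.theta) * (c * inner ℝ (p i) r))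
          + c ^ 2 * ‖r‖ ^ 2) / (2 * c) := div_nonneg h (by positivity)
    linarith
  have t2 : (1 - S.theta) ^ 2 / (2 * c) * ‖p i‖ ^ 2
      + (1 - S.theta) * S.theta / (2 * S.chi * c) * ‖p i‖ ^ 2 ≤
      ‖p i‖ ^ 2 / (2 * S.chi ^ 2 * c) := by
    have e : (1 - S.theta) ^ 2 / (2 * c) * ‖p i‖ ^ 2
      + (1 - S.theta) * S.theta / (2 * S.chi * c) * ‖p i‖ ^ 2 =
      ((1 - S.theta) ^ 2 * S.chi ^ 2 + (1 - S.theta) * S.theta * S.chi) * ‖p i‖ ^ 2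
        / (2 * S.chi ^ 2 * c) := by field_simp
    rw [e]
    gcongr
    have a1 : S.chi ^ 2 ≤ 1 := pow_le_one₀ hχ.le hχ1
    have a2 := mul_le_mul_of_nonneg_left a1 (sq_nonneg (1 - S.theta))
    have a3 := mul_le_mul_of_nonneg_left hχ1 (mul_nonneg h1θ hθ.le)
    have : (1 - S.theta) ^ 2 * S.chi ^ 2 + (1 - S.theta) * S.theta * S.chi ≤ 1 := by linarith
    exact mul_le_of_le_one_left (sq_nonneg _) this
  have t3 := hP.sInf_le_phi (hP.trajectory_mem_dom hS hT hx i)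
  have t4 : 0 ≤ (1 - S.theta) ^ 2 * (2 - S.theta) / (2 * S.chi * c * S.theta)
      * ‖p i - p (i - 1)‖ ^ 2 := by positivity
  unfold potential Problem.lagReal
  rw [← hr]
  linarith

theorem kappa5_nonneg (hP : Assumptions P K) : 0 ≤ kappa5 P := by
  have hB : (1 : ℝ) ≤ B := by exact_mod_cast hP.one_le_B
  have : (0 : ℝ) ≤ B - 1 := by linarith
  unfold kappa5
  positivity

/-- The scalar quantities attached to a trajectory satisfy the scalar analysis. -/
theorem staticSequence (hP : Assumptions P K) (hS : S.Admissible K) (hc : 0 < c)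
    (hT : IsTrajectory P S c x p) (hx : x 0 ∈ P.dom) (hp : ‖p 0‖ ≤ kappa1 P K S * c)
    (hpr : p 0 ∈ Set.range P.A) :
    StaticSequence (fun i => ‖p i‖) (fun i => ‖sweepResidual P S c (x (i - 1)) (x i)‖)
      (fun i => ‖P.A (x i) - P.d‖) (potential P S c x p) S.theta S.chi c
      (kappa0 K S ^ 2 + kappa5 P * c) (kappa1 P K S) (kappa4 P K S) (K.Kh + Gf P)
      (sInf (P.phi '' P.dom)) (sSup (P.phi '' P.dom)) := by
  have hlam := hS.lam_pos
  have hχ := hS.chi_pos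
  have hk : 0 ≤ kappa0 K S ^ 2 + kappa5 P * c := by
    have := hP.kappa5_nonneg
    positivity
  have hQ0 : ∀ i, 0 ≤ ∑ t, ‖P.ABlock t (x (i + 1) t - x i t)‖ ^ 2 :=
    fun i => Finset.sum_nonneg fun _ _ => sq_nonneg _
  refine ⟨hS.theta_pos, hS.theta_le, hS.chi_pos, hc, hk, hP.kappa4_pos hS,
    add_nonneg hP.Kh_nonneg hP.Gf_nonneg, fun i => norm_nonneg _, ?_, ?_, ?_, ?_, ?_, ?_, ?_⟩
  · intro i hi
    have h1 := hP.potential_decrease hS hc hT hx hi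
    have h2 := hP.sweepResidual_sq_le hS hc.le (hP.trajectory_mem_dom hS hT hx i)
      (hP.trajectory_mem_dom hS hT hx (i + 1))
    refine h2.trans ?_
    rw [div_mul_eq_mul_div (kappa0 K S ^ 2 + kappa5 P * c) 2, mul_div_assoc (_ + _)]
    refine mul_le_mul_of_nonneg_left ?_ hk
    have : ‖x (i + 1) - x i‖ ^ 2 / (4 * S.lam) ≤
        (3 / (4 * S.lam) * ‖x (i + 1) - x i‖ ^ 2) / 2 := by
      have h0 : 0 ≤ ‖x (i + 1) - x i‖ ^ 2 / (4 * S.lam) := by positivity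
      have e : (3 / (4 * S.lam) * ‖x (i + 1) - x i‖ ^ 2) / 2 =
        3 / 2 * (‖x (i + 1) - x i‖ ^ 2 / (4 * S.lam)) := by ring
      linarith
    linarith
  · intro i hi
    have h1 := hP.potential_decrease hS hc hT hx hi
    have h2 : 0 ≤ 3 / (4 * S.lam) * ‖x (i + 1) - x i‖ ^ 2 := by positivity
    have h3 := mul_nonneg (by linarith : 0 ≤ c / 4) (hQ0 i)
    linarith
  · intro i R h0 h1
    exact hP.potential_le hS hc hT hx i h0 h1
  · intro i
    exact hP.le_potential hS hc hT hx (i + 1)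
  · intro i
    exact hP.norm_dual_succ_le hS hc (hP.trajectory_mem_dom hS hT hx i) (hT.sweep i)
      (hP.trajectory_mem_range hT hpr i) (hT.dual i)
  · exact hP.norm_trajectory_le hS hc hT hx hp
  · intro i
    have e : (S.chi * c) • (P.A (x (i + 1)) - P.d) = p (i + 1) - (1 - S.theta) • p i := by
      rw [hT.dual]; abel
    have h1 := norm_sub_le (p (i + 1)) ((1 - S.theta) • p i)
    rw [← e, norm_smul, norm_smul, Real.norm_of_nonneg (by positivity),
      Real.norm_of_nonneg (by linarith [hS.theta_le])] at h1
    have h2 := mul_nonneg hS.theta_pos.le (norm_nonneg (p i))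
    linarith

end Assumptions

/-! ### Termination tests -/

theorem State.successful_congr {s s' : State n l} (hc : s.c = s'.c) (hk : s.k = s'.k)
    (hx : ∀ i ≤ s.k, s.x i = s'.x i) {ρ η : ℝ} :
    s.Successful P S ρ η ↔ s'.Successful P S ρ η := by
  unfold State.Successful
  rw [State.v_eq, State.v_eq, hx s.k le_rfl, hx (s.k - 1) (Nat.sub_le _ _), hc, hk]

theorem State.passesErgodicTest_congr {s s' : State n l} (hc : s.c = s'.c) (hk : s.k = s'.k)
    (hx : ∀ i ≤ s.k, s.x i = s'.x i) {ρ η : ℝ} :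
    s.PassesErgodicTest P S ρ η ↔ s'.PassesErgodicTest P S ρ η := by
  have h1 : ∑ i ∈ Finset.Icc (s.k / 2) s.k, ‖s.v P S i‖ =
      ∑ i ∈ Finset.Icc (s.k / 2) s.k, ‖s'.v P S i‖ := by
    refine Finset.sum_congr rfl fun i hi => ?_
    have hi := (Finset.mem_Icc.1 hi).2
    rw [State.v_eq, State.v_eq, hx i hi, hx (i - 1) ((Nat.sub_le _ _).trans hi), hc]
  have h2 : ∑ i ∈ Finset.Icc (s.k / 2) s.k, ‖P.A (s.x i) - P.d‖ =
      ∑ i ∈ Finset.Icc (s.k / 2) s.k, ‖P.A (s'.x i) - P.d‖ :=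
    Finset.sum_congr rfl fun i hi => by rw [hx i (Finset.mem_Icc.1 hi).2]
  unfold State.PassesErgodicTest
  rw [h1, h2, hc, hk]

theorem State.returns_congr {s s' : State n l} (hc : s.c = s'.c) (hk : s.k = s'.k)
    (hx : ∀ i ≤ s.k, s.x i = s'.x i) {ρ η : ℝ} :
    s.Returns P S ρ η ↔ s'.Returns P S ρ η :=
  or_congr (State.successful_congr hc hk hx) (State.passesErgodicTest_congr hc hk hx)

/-- If the ergodic test is passed although no iterate in the window was successful, the penalty
parameter is small. -/
theorem State.PassesErgodicTest.exists_successful {s : State n l} {ρ η : ℝ} (hρ : 0 < ρ)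
    (hη : 0 < η) (h : s.PassesErgodicTest P S ρ η) (hk : (s.k : ℝ) ≤ s.c ^ 3) :
    ∃ i, 1 ≤ i ∧ i ≤ s.k ∧ ‖s.v P S i‖ ≤ ρ ∧ ‖P.A (s.x i) - P.d‖ ≤ η := by
  obtain ⟨⟨m, hm⟩, h3, ht⟩ := h
  set W := Finset.Icc (s.k / 2) s.k with hW
  have hcard : W.card = m + 1 := by rw [hW, Nat.card_Icc]; omega
  have hk0 : (0 : ℝ) < s.k := by exact_mod_cast (by omega : 0 < s.k)
  -- For `k ≤ c³` the test bounds by `1` the plain window average of `‖v‖/ρ + ‖A x - d‖/η`, so some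
  -- index has both terms at most `1`.
  have hsq : 1 ≤ Real.sqrt (s.c ^ 3 / (s.k : ℝ)) := by
    rw [Real.one_le_sqrt, le_div_iff₀ hk0]; linarith
  have hkm : (s.k : ℝ) + 2 = 2 * ((m + 1 : ℕ) : ℝ) := by rw [hm]; push_cast; ring
  have hmpos : (0 : ℝ) < ((m + 1 : ℕ) : ℝ) := by positivity
  have he : 2 / ((s.k : ℝ) + 2) = 1 / ((m + 1 : ℕ) : ℝ) := by rw [hkm]; field_simp
  rw [he] at ht
  have hφ : 0 ≤ 1 / ((m + 1 : ℕ) : ℝ) * ∑ i ∈ W, ‖P.A (s.x i) - P.d‖ := by positivity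
  have h1 : 1 / ρ * (1 / ((m + 1 : ℕ) : ℝ) * ∑ i ∈ W, ‖s.v P S i‖)
      + 1 / η * (1 / ((m + 1 : ℕ) : ℝ) * ∑ i ∈ W, ‖P.A (s.x i) - P.d‖) ≤ 1 := by
    refine le_trans ?_ ht
    gcongr
    exact le_mul_of_one_le_right (by positivity) hsq
  have h2 : ∑ i ∈ W, (1 / ρ * ‖s.v P S i‖ + 1 / η * ‖P.A (s.x i) - P.d‖) ≤ ∑ i ∈ W, (1 : ℝ) := by
    rw [Finset.sum_add_distrib, ← Finset.mul_sum, ← Finset.mul_sum, Finset.sum_const, hcard,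
      nsmul_eq_mul, mul_one]
    have h := mul_le_mul_of_nonneg_left h1 hmpos.le
    have e : ((m + 1 : ℕ) : ℝ) * (1 / ρ * (1 / ((m + 1 : ℕ) : ℝ) * ∑ i ∈ W, ‖s.v P S i‖)
      + 1 / η * (1 / ((m + 1 : ℕ) : ℝ) * ∑ i ∈ W, ‖P.A (s.x i) - P.d‖)) =
      1 / ρ * ∑ i ∈ W, ‖s.v P S i‖ + 1 / η * ∑ i ∈ W, ‖P.A (s.x i) - P.d‖ := by
      field_simp
    rw [e] at h
    linarith
  obtain ⟨i, hi, hle⟩ := Finset.exists_le_of_sum_le (by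
    rw [← Finset.card_pos, hcard]; omega) h2
  rw [hW, Finset.mem_Icc] at hi
  have a1 : 0 ≤ 1 / ρ * ‖s.v P S i‖ := by positivity
  have a2 : 0 ≤ 1 / η * ‖P.A (s.x i) - P.d‖ := by positivity
  refine ⟨i, by omega, hi.2, ?_, ?_⟩
  · have : 1 / ρ * ‖s.v P S i‖ ≤ 1 := by linarith
    rwa [one_div_mul_eq_div, div_le_one hρ] at this
  · have : 1 / η * ‖P.A (s.x i) - P.d‖ ≤ 1 := by linarith
    rwa [one_div_mul_eq_div, div_le_one hη] at this

/-! ### Iteration bound for a single call -/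

theorem kappa2_eq (hP : Assumptions P K) (hS : S.Admissible K) :
    kappa2 P K S = 1 / S.theta * (1 + 2 * (K.Kh + Gf P) / kappa4 P K S) + 1 := by
  have := hP.ddag_pos
  have := hP.Ddag_pos
  have := hP.sigmaPlus_spec.1
  have := hS.chi_pos
  have := hS.theta_pos
  unfold kappa2 kappa4
  field_simp

/-- Regroups the powers of `c` around `κ₀² + κ₅ c`, the factor of the scalar analysis. With `R = 2
κ₁` one has `R + κ₁ = 3 κ₁`, whence `81`. -/
theorem iterBound_eq (c ρ η cLow : ℝ) :
    iterBound P K S c ρ η cLow (2 * kappa1 P K S) =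
      48 * (3 + 8 / kappa4 P K S ^ 2 * ((kappa0 K S ^ 2 + kappa5 P * c) *
          (deltaPhi P + 81 * kappa1 P K S ^ 2 * c / S.chi ^ 2))
        + 3 * (1 - S.theta) * (kappa1 P K S * c)
        + 3 * ((kappa0 K S ^ 2 + kappa5 P * c) * kappaTilde0 P K S cLow ^ 2) / ρ ^ 2
        + 108 * (kappa2 P K S ^ 2 * c / (S.chi ^ 2 * η ^ 2))) := by
  unfold iterBound kappa6 kappaTilde1 kappaTilde2 xi0 xi1 kappa3
  simp only [div_eq_mul_inv, mul_inv]
  ring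

namespace Assumptions

theorem kappa1_nonneg (hP : Assumptions P K) (hS : S.Admissible K) : 0 ≤ kappa1 P K S := by
  have := hP.Ddag_pos
  have := hS.chi_pos
  have := hS.theta_pos
  unfold kappa1
  positivity

theorem kappa2_pos (hP : Assumptions P K) (hS : S.Admissible K) : 0 < kappa2 P K S := by
  have := hP.kappa4_pos hS
  have := hS.theta_pos
  have := hP.Kh_nonneg
  have := hP.Gf_nonneg
  rw [kappa2_eq hP hS]
  positivity

/-- Replaces the late range of the potential by a quantity free of `c`: `(a + b)² ≥ a² + b²`, with
`25 / c₁` dominating `9 / c`. -/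
theorem le_kappaTilde0_sq (hP : Assumptions P K) (hS : S.Admissible K) {c c₁ : ℝ} (hc₁ : 0 < c₁)
    (hc : c₁ ≤ c) : 4 * (deltaPhi P + 9 * kappa2 P K S ^ 2 / (S.chi ^ 2 * c)) ≤
      kappaTilde0 P K S c₁ ^ 2 := by
  have hΔ := hP.deltaPhi_nonneg
  have hκ := hP.kappa2_pos hS
  have hχ := hS.chi_pos
  unfold kappaTilde0
  set a := Real.sqrt (deltaPhi P)
  set b := 5 * kappa2 P K S / (S.chi * Real.sqrt c₁) with hb
  have ha : a ^ 2 = deltaPhi P := Real.sq_sqrt hΔ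
  have ha0 : 0 ≤ a := Real.sqrt_nonneg _
  have hb0 : 0 ≤ b := by positivity
  have hb2 : b ^ 2 = 25 * kappa2 P K S ^ 2 / (S.chi ^ 2 * c₁) := by
    rw [hb, div_pow, mul_pow, mul_pow, Real.sq_sqrt hc₁.le]; norm_num
  have h1 : 9 * kappa2 P K S ^ 2 / (S.chi ^ 2 * c) ≤ b ^ 2 := by
    rw [hb2]
    have : 9 * kappa2 P K S ^ 2 ≤ 25 * kappa2 P K S ^ 2 := by nlinarith [sq_nonneg (kappa2 P K S)]
    gcongr
  have h2 := mul_nonneg ha0 hb0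
  nlinarith

/-- Without termination tests, the ergodic test would be passed after a bounded number of
iterations. -/
theorem exists_passesErgodicTest (hP : Assumptions P K) (hS : S.Admissible K) {c c₁ ρ η : ℝ}
    (hc₁ : 0 < c₁) (hc : c₁ ≤ c) (hρ : 0 < ρ) (hη : 0 < η)
    {x : ℕ → Blocks n} {p : ℕ → EuclideanSpace ℝ (Fin l)}
    (hT : IsTrajectory P S c x p) (hx : x 0 ∈ P.dom) (hp : ‖p 0‖ ≤ kappa1 P K S * c)
    (hpr : p 0 ∈ Set.range P.A) :
    ∃ k : ℕ, (k : ℝ) ≤ iterBound P K S c ρ η c₁ (2 * kappa1 P K S) / 4 ∧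
      (State.mk c k x p).PassesErgodicTest P S ρ η := by
  have hc0 : 0 < c := hc₁.trans_le hc
  have hseq := hP.staticSequence hS hc0 hT hx hp hpr
  have hκ := hseq.kappa_nonneg
  have h4 := hP.kappa4_pos hS
  have hΔ := hP.deltaPhi_nonneg
  have hχ := hS.chi_pos
  have h1θ : 0 ≤ 1 - S.theta := by linarith [hS.theta_le]
  have hk1 := hP.kappa1_nonneg hS
  have hk2 := hP.kappa2_pos hS
  have hΔdef : sSup (P.phi '' P.dom) - sInf (P.phi '' P.dom) = deltaPhi P := rfl
  set κ := kappa0 K S ^ 2 + kappa5 P * c with hκdef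
  set X₁ := 2 * κ * (deltaPhi P + 5 / 2 * kappa1 P K S ^ 2 * c / S.chi ^ 2) / kappa4 P K S ^ 2
    with hX₁
  set X₂ := (1 - S.theta) * (kappa1 P K S * c) with hX₂
  set Y := 2 * κ * (deltaPhi P + 9 * kappa2 P K S ^ 2 / (S.chi ^ 2 * c)) / ρ ^ 2 with hY
  set W := 8 * kappa2 P K S ^ 2 * c / (S.chi ^ 2 * η ^ 2) with hW
  have hX₁0 : 0 ≤ X₁ := by positivity
  have hX₂0 : 0 ≤ X₂ := by positivity
  have hY0 : 0 ≤ Y := by positivity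
  have hW0 : 0 ≤ W := by positivity
  -- `X₁` and `X₂` are the lengths needed for small multipliers, `Y` and `W` those needed for the
  -- residual and infeasibility halves of the test.
  set m := ⌈X₁ + X₂⌉₊ + 1 with hm
  set k := 2 * m + 3 + ⌈Y⌉₊ + ⌈W⌉₊ with hk
  have hmX : X₁ + X₂ ≤ m := (Nat.le_ceil _).trans (by rw [hm]; push_cast; linarith)
  have hkY : Y ≤ k := (Nat.le_ceil _).trans (by rw [hk]; push_cast; nlinarith)
  have hkW : W ≤ k := (Nat.le_ceil _).trans (by
    rw [hk]; push_cast
    have : (0 : ℝ) ≤ (⌈Y⌉₊ : ℝ) := Nat.cast_nonneg _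
    have : (0 : ℝ) ≤ (m : ℝ) := Nat.cast_nonneg _
    linarith)
  have htest := hseq.ergodic_test (m := m) (by omega)
    (by
      rw [hΔdef, ← div_le_iff₀ (by positivity)]
      linarith)
    (by linarith) (k := k) (by omega) hρ hη
    (by
      rw [hΔdef, ← kappa2_eq hP hS, ← div_le_iff₀ (by positivity)]
      exact hkY)
    (by
      rw [← kappa2_eq hP hS, ← div_le_iff₀ (by positivity)]
      exact hkW)
  refine ⟨2 * k, ?_, ⟨even_two_mul k, by simp only; omega, htest⟩⟩
  have c1 : (⌈X₁ + X₂⌉₊ : ℝ) ≤ X₁ + X₂ + 1 := (Nat.ceil_lt_add_one (by positivity)).le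
  have c2 : (⌈Y⌉₊ : ℝ) ≤ Y + 1 := (Nat.ceil_lt_add_one hY0).le
  have c3 : (⌈W⌉₊ : ℝ) ≤ W + 1 := (Nat.ceil_lt_add_one hW0).le
  have hkle : ((2 * k : ℕ) : ℝ) ≤ 4 * (X₁ + X₂) + 2 * Y + 2 * W + 18 := by
    rw [hk, hm]; push_cast; linarith
  rw [iterBound_eq, ← hκdef]
  have b1 : X₁ ≤ 8 / kappa4 P K S ^ 2 *
      (κ * (deltaPhi P + 81 * kappa1 P K S ^ 2 * c / S.chi ^ 2)) := by
    have e : 8 / kappa4 P K S ^ 2 * (κ * (deltaPhi P + 81 * kappa1 P K S ^ 2 * c / S.chi ^ 2)) =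
      8 * κ * (deltaPhi P + 81 * kappa1 P K S ^ 2 * c / S.chi ^ 2) / kappa4 P K S ^ 2 := by ring
    rw [e, hX₁]
    gcongr <;> norm_num
  have b2 : Y ≤ 3 * (κ * kappaTilde0 P K S c₁ ^ 2) / ρ ^ 2 := by
    rw [hY]
    have := hP.le_kappaTilde0_sq hS hc₁ hc
    have h0 : 0 ≤ deltaPhi P + 9 * kappa2 P K S ^ 2 / (S.chi ^ 2 * c) := by positivity
    gcongr ?_ / _
    have := mul_le_mul_of_nonneg_left this hκ
    have := mul_nonneg hκ h0
    linarith
  have b3 : W ≤ 108 * (kappa2 P K S ^ 2 * c / (S.chi ^ 2 * η ^ 2)) := by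
    have e : W = 8 * (kappa2 P K S ^ 2 * c / (S.chi ^ 2 * η ^ 2)) := by rw [hW]; ring
    rw [e]
    gcongr
    norm_num
  linarith

theorem exists_trajectory (hP : Assumptions P K) (hS : S.Admissible K) {c : ℝ} (hc : 0 < c)
    {z : Blocks n} (hz : z ∈ P.dom) (p₀ : EuclideanSpace ℝ (Fin l)) :
    ∃ x p, IsTrajectory P S c x p ∧ x 0 = z ∧ p 0 = p₀ := by
  -- A total choice of sweeps allows plain recursion; its value off `ℋ` is never used.
  have hex : ∀ (x : Blocks n) (p : EuclideanSpace ℝ (Fin l)), ∃ y, x ∈ P.dom →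
      IsProxSweep P S c x p y := by
    intro x p
    by_cases hx : x ∈ P.dom
    · obtain ⟨y, hy, -⟩ := hP.existsUnique_sweep hS hc.le hx p
      exact ⟨y, fun _ => hy⟩
    · exact ⟨x, fun h => absurd h hx⟩
  choose g hg using hex
  let seq : ℕ → Blocks n × EuclideanSpace ℝ (Fin l) := fun i => Nat.rec (z, p₀)
    (fun _ a => (g a.1 a.2, (1 - S.theta) • a.2 + (S.chi * c) • (P.A (g a.1 a.2) - P.d))) i
  have hdom : ∀ i, (seq i).1 ∈ P.dom := by
    intro i
    induction i with
    | zero => exact hz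
    | succ i ih => exact hP.sweep_mem_dom hS ih (hg _ (seq i).2 ih)
  exact ⟨fun i => (seq i).1, fun i => (seq i).2,
    ⟨fun i => hg _ _ (hdom i), fun i => rfl⟩, rfl, rfl⟩

end Assumptions

/-! ### Summing the costs over all calls -/

section OuterCount

theorem sum_two_pow_le (j : ℕ) : ∑ i ∈ Finset.range (j + 1), (2 : ℝ) ^ i ≤ 2 * 2 ^ j := by
  induction j with
  | zero => norm_num
  | succ j ih => rw [Finset.sum_range_succ]; rw [pow_succ]; linarith

theorem sum_two_pow_sq_le (j : ℕ) :
    ∑ i ∈ Finset.range (j + 1), ((2 : ℝ) ^ i) ^ 2 ≤ 2 * (2 ^ j) ^ 2 := by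
  induction j with
  | zero => norm_num
  | succ j ih =>
    rw [Finset.sum_range_succ, pow_succ 2 j]
    nlinarith [sq_nonneg ((2 : ℝ) ^ j)]

/-- The total cost of geometrically growing calls, when the penalty parameter of the last but one
call is bounded by the cube root of its cost. -/
theorem sum_call_cost_le {T c₁ ε : ℝ} (hT : 1 ≤ T) (hc₁ : 0 < c₁) (hε : 0 < ε) (j : ℕ)
    (hj : j = 0 ∨ (c₁ * 2 ^ (j - 1)) ^ 3 <
      T / 4 * ((2 : ℝ) ^ (j - 1) / ε ^ 2 + ((2 : ℝ) ^ (j - 1)) ^ 2)) :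
    ∑ i ∈ Finset.range (j + 1), T / 4 * ((2 : ℝ) ^ i / ε ^ 2 + ((2 : ℝ) ^ i) ^ 2) ≤
      T * (2 * (2 * (1 + T ^ 2 / c₁ ^ 3)) ^ 2
        + (2 * (1 + T ^ 2 / c₁ ^ 3) + 2 * (2 * Real.sqrt (T / c₁ ^ 3)) ^ 2) / ε ^ 2
        + 2 * Real.sqrt (T / c₁ ^ 3) / ε ^ 3) := by
  set τ := T / c₁ ^ 3 with hτ
  set b := Real.sqrt τ with hb
  set δ := 1 / ε with hδ
  have hT0 : 0 < T := by linarith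
  have hτ0 : 0 < τ := by positivity
  have hb2 : b ^ 2 = τ := Real.sq_sqrt hτ0.le
  have hb0 : 0 ≤ b := Real.sqrt_nonneg _
  have hδ0 : 0 < δ := by positivity
  have hdiv2 : ∀ a : ℝ, a / ε ^ 2 = a * δ ^ 2 := fun a => by rw [hδ]; field_simp
  have hdiv3 : ∀ a : ℝ, a / ε ^ 3 = a * δ ^ 3 := fun a => by rw [hδ]; field_simp
  have hE : τ ≤ T ^ 2 / c₁ ^ 3 := by
    rw [hτ]; gcongr; nlinarith
  set E := T ^ 2 / c₁ ^ 3 with hEdef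
  simp only [hdiv2, hdiv3] at hj ⊢
  have hsum : ∑ i ∈ Finset.range (j + 1), T / 4 * ((2 : ℝ) ^ i * δ ^ 2 + ((2 : ℝ) ^ i) ^ 2) ≤
      T / 4 * (2 * 2 ^ j * δ ^ 2 + 2 * (2 ^ j) ^ 2) := by
    rw [← Finset.mul_sum, Finset.sum_add_distrib, ← Finset.sum_mul]
    have h1 := sum_two_pow_le j
    have h2 := sum_two_pow_sq_le j
    gcongr
  refine hsum.trans ?_
  have hE0 : 0 < E := hτ0.trans_le hE
  have hb3 : 0 ≤ b * δ ^ 3 := by positivity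
  rw [div_mul_eq_mul_div, mul_div_assoc]
  refine mul_le_mul_of_nonneg_left ?_ hT0.le
  have hEE : τ ^ 2 ≤ E ^ 2 := pow_le_pow_left₀ hτ0.le hE 2
  have hδ2 : 0 ≤ δ ^ 2 := sq_nonneg δ
  have hEδ : τ * δ ^ 2 ≤ E * δ ^ 2 := mul_le_mul_of_nonneg_right hE hδ2
  have hτδ : 0 ≤ τ * δ ^ 2 := by positivity
  obtain rfl | ⟨j, rfl⟩ : j = 0 ∨ ∃ i, j = i + 1 := by
    cases j
    · exact Or.inl rfl
    · exact Or.inr ⟨_, rfl⟩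
  · rw [mul_pow 2 b, hb2]
    nlinarith
  replace hj := hj.resolve_left (by omega)
  simp only [Nat.add_sub_cancel] at hj
  set s : ℝ := 2 ^ j with hs
  have hs0 : 0 < s := by positivity
  have hs2 : s ^ 2 ≤ τ / 4 * δ ^ 2 + τ / 4 * s := by
    have e : T = τ * c₁ ^ 3 := by rw [hτ]; field_simp
    have h1 : (c₁ ^ 3 * s) * s ^ 2 ≤ (c₁ ^ 3 * s) * (τ / 4 * δ ^ 2 + τ / 4 * s) := by
      refine le_trans (le_of_eq (by ring)) (hj.le.trans (le_of_eq ?_))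
      rw [e]; ring
    exact le_of_mul_le_mul_left h1 (by positivity)
  -- Solves the quadratic inequality `hs2` for `s`: the linear term gives `τ / 4` and the constant
  -- term its square root.
  have hsle : s ≤ τ / 4 + b / 2 * δ := by
    by_contra! hlt
    have hbδ : 0 ≤ b / 2 * δ := by positivity
    have h1 : (τ / 4 + b / 2 * δ) * (b / 2 * δ) ≤ s * (s - τ / 4) :=
      mul_le_mul hlt.le (by linarith) hbδ hs0.le
    have h2 : (b / 2 * δ) < s - τ / 4 := by linarith
    have h3 : s * (b / 2 * δ) ≤ s * (s - τ / 4) := mul_le_mul_of_nonneg_left h2.le hs0.le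
    have e : (b / 2 * δ) ^ 2 = τ / 4 * δ ^ 2 := by rw [mul_pow, div_pow, hb2]; norm_num
    have h4 : (s - τ / 4) * s ≤ (b / 2 * δ) ^ 2 := by rw [e]; linarith
    have h5 : (b / 2 * δ) * (b / 2 * δ) < (s - τ / 4) * s := by
      have : b / 2 * δ < s := by linarith
      exact mul_lt_mul'' h2 this hbδ hbδ
    nlinarith
  have hr : 2 ^ (j + 1) = 2 * s := by rw [pow_succ, hs]; ring
  rw [hr, mul_pow 2 b, hb2]
  have g1 : 2 * s * δ ^ 2 ≤ (τ / 2 + b * δ) * δ ^ 2 :=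
    mul_le_mul_of_nonneg_right (by linarith) hδ2
  have g2 : (2 * s) ^ 2 ≤ (τ / 2 + b * δ) ^ 2 :=
    pow_le_pow_left₀ (by positivity) (by linarith) 2
  have g3 : (τ / 2 + b * δ) ^ 2 ≤ τ ^ 2 / 2 + 2 * (τ * δ ^ 2) := by
    rw [← hb2]; nlinarith [sq_nonneg (b ^ 2 / 2 - b * δ)]
  nlinarith

end OuterCount

namespace Assumptions

theorem one_le_T1 (hP : Assumptions P K) (hS : S.Admissible K) {c₁ : ℝ} (hc₁ : 0 < c₁) :
    1 ≤ T1 P K S c₁ := by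
  have h4 := hP.kappa4_pos hS
  have hΔ := hP.deltaPhi_nonneg
  have hχ := hS.chi_pos
  have h1θ : 0 ≤ 1 - S.theta := by linarith [hS.theta_le]
  have hk1 := hP.kappa1_nonneg hS
  have hk5 := hP.kappa5_nonneg
  rw [T1, iterBound_eq]
  set X := 8 / kappa4 P K S ^ 2 * ((kappa0 K S ^ 2 + kappa5 P * c₁) *
          (deltaPhi P + 81 * kappa1 P K S ^ 2 * c₁ / S.chi ^ 2))
        + 3 * (1 - S.theta) * (kappa1 P K S * c₁)
        + 3 * ((kappa0 K S ^ 2 + kappa5 P * c₁) * kappaTilde0 P K S c₁ ^ 2) / 1 ^ 2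
        + 108 * (kappa2 P K S ^ 2 * c₁ / (S.chi ^ 2 * 1 ^ 2)) with hX
  have hX0 : 0 ≤ X := by positivity
  linarith

/-- At `c = c₁ r` with `r ≥ 1`, each of `1`, `r`, `r²`, `1/ρ²`, `r/ρ²` and `r/η²` is at most `r/ε² +
r²`; the coefficients then sum to `T₁`. -/
theorem iterBound_le (hP : Assumptions P K) (hS : S.Admissible K) {c₁ ρ η r : ℝ} (hc₁ : 0 < c₁)
    (hρ : 0 < ρ) (hη : 0 < η) (hr : 1 ≤ r) :
    iterBound P K S (c₁ * r) ρ η c₁ (2 * kappa1 P K S) ≤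
      T1 P K S c₁ * (r / min ρ η ^ 2 + r ^ 2) := by
  have h4 := hP.kappa4_pos hS
  have hΔ := hP.deltaPhi_nonneg
  have hχ := hS.chi_pos
  have h1θ : 0 ≤ 1 - S.theta := by linarith [hS.theta_le]
  have hk1 := hP.kappa1_nonneg hS
  have hk5 := hP.kappa5_nonneg
  have hε : 0 < min ρ η := lt_min hρ hη
  have hr0 : 0 < r := by linarith
  have hrr : r ≤ r ^ 2 := by nlinarith
  have hr1 : 1 ≤ r ^ 2 := by linarith
  have hdρ : 1 / ρ ^ 2 ≤ 1 / min ρ η ^ 2 := by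
    gcongr; exact min_le_left _ _
  have hdη : 1 / η ^ 2 ≤ 1 / min ρ η ^ 2 := by
    gcongr; exact min_le_right _ _
  have hrε : 0 ≤ r / min ρ η ^ 2 := by positivity
  rw [T1, iterBound, iterBound]
  have e6 : 0 ≤ kappa6 P K S := by unfold kappa6; positivity
  have e1 : 0 ≤ kappaTilde1 P K S c₁ := by unfold kappaTilde1; positivity
  have e2 : 0 ≤ kappaTilde2 P K S c₁ * c₁ := by unfold kappaTilde2; positivity
  have e3 : 0 ≤ kappa3 P K S * c₁ := by unfold kappa3; positivity
  have e4 : 0 ≤ xi0 P K S (2 * kappa1 P K S) * c₁ := by unfold xi0; positivity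
  have e5 : 0 ≤ xi1 P K S (2 * kappa1 P K S) * c₁ ^ 2 := by unfold xi1; positivity
  have hsum : 1 ≤ r ^ 2 + r / min ρ η ^ 2 := by linarith
  have i6 : kappa6 P K S ≤ kappa6 P K S * (r / min ρ η ^ 2 + r ^ 2) :=
    le_mul_of_one_le_right e6 (by linarith)
  have aux1 : 1 / ρ ^ 2 ≤ r / min ρ η ^ 2 + r ^ 2 := by
    have : 1 / min ρ η ^ 2 ≤ r / min ρ η ^ 2 := by gcongr
    have := sq_nonneg r
    linarith
  have aux2 : r / ρ ^ 2 ≤ r / min ρ η ^ 2 + r ^ 2 := by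
    have := mul_le_mul_of_nonneg_left hdρ hr0.le
    rw [mul_one_div, mul_one_div] at this
    linarith
  have aux3 : r / η ^ 2 ≤ r / min ρ η ^ 2 + r ^ 2 := by
    have := mul_le_mul_of_nonneg_left hdη hr0.le
    rw [mul_one_div, mul_one_div] at this
    linarith
  have i1 := mul_le_mul_of_nonneg_left aux1 e1
  have i2 := mul_le_mul_of_nonneg_left aux2 e2
  have i3 := mul_le_mul_of_nonneg_left aux3 e3
  have i4 := mul_le_mul_of_nonneg_left (by linarith : r ≤ r / min ρ η ^ 2 + r ^ 2) e4
  have i5 := mul_le_mul_of_nonneg_left (by linarith : r ^ 2 ≤ r / min ρ η ^ 2 + r ^ 2) e5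
  have elhs : (kappa6 P K S + kappaTilde1 P K S c₁ / ρ ^ 2)
    + (xi0 P K S (2 * kappa1 P K S) + kappa3 P K S / η ^ 2 + kappaTilde2 P K S c₁ / ρ ^ 2)
      * (c₁ * r) + xi1 P K S (2 * kappa1 P K S) * (c₁ * r) ^ 2 =
    kappa6 P K S + kappaTilde1 P K S c₁ * (1 / ρ ^ 2)
      + (xi0 P K S (2 * kappa1 P K S) * c₁ * r + kappa3 P K S * c₁ * (r / η ^ 2)
        + kappaTilde2 P K S c₁ * c₁ * (r / ρ ^ 2))
      + xi1 P K S (2 * kappa1 P K S) * c₁ ^ 2 * r ^ 2 := by ring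
  rw [elhs]
  simp only [one_pow, div_one]
  linarith

end Assumptions

/-! ### Invariant of the dynamic method -/

/-- What is known about a state that the dynamic method can reach. -/
structure CallInvariant (P : Problem B n l) (K : Moduli n) (S : Params) (ρ η c₁ : ℝ) (N : ℕ)
    (s : State n l) (j : ℕ) (x : ℕ → Blocks n) (p : ℕ → EuclideanSpace ℝ (Fin l)) : Prop where
  c_eq : s.c = c₁ * 2 ^ j
  traj : IsTrajectory P S s.c x p
  mem_dom : x 0 ∈ P.dom
  norm_le : ‖p 0‖ ≤ kappa1 P K S * s.c
  mem_range : p 0 ∈ Set.range P.A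
  x_eq : ∀ i ≤ s.k, s.x i = x i
  p_eq : ∀ i ≤ s.k, s.p i = p i
  not_returns : ∀ i < s.k, ¬ (State.mk s.c i x p).Returns P S ρ η
  count : (N : ℝ) ≤ ∑ i ∈ Finset.range j,
    iterBound P K S (c₁ * 2 ^ i) ρ η c₁ (2 * kappa1 P K S) / 4 + s.k
  previous : j = 0 ∨ (c₁ * 2 ^ (j - 1)) ^ 3 <
    iterBound P K S (c₁ * 2 ^ (j - 1)) ρ η c₁ (2 * kappa1 P K S) / 4

namespace CallInvariant

variable {ρ η c₁ : ℝ} {N : ℕ} {s : State n l} {j : ℕ} {x : ℕ → Blocks n}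
  {p : ℕ → EuclideanSpace ℝ (Fin l)}

theorem c_pos (h : CallInvariant P K S ρ η c₁ N s j x p) (hc₁ : 0 < c₁) : 0 < s.c := by
  rw [h.c_eq]; positivity

theorem le_c (h : CallInvariant P K S ρ η c₁ N s j x p) (hc₁ : 0 < c₁) : c₁ ≤ s.c := by
  rw [h.c_eq]
  exact le_mul_of_one_le_right hc₁.le (one_le_pow₀ (by norm_num))

theorem state_mem_dom (h : CallInvariant P K S ρ η c₁ N s j x p) (hP : Assumptions P K)
    (hS : S.Admissible K) : s.x s.k ∈ P.dom := by
  rw [h.x_eq s.k le_rfl]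
  exact hP.trajectory_mem_dom hS h.traj h.mem_dom _

/-- The number of iterations of a single call. -/
theorem k_le (h : CallInvariant P K S ρ η c₁ N s j x p) (hP : Assumptions P K)
    (hS : S.Admissible K) (hc₁ : 0 < c₁) (hρ : 0 < ρ) (hη : 0 < η) :
    (s.k : ℝ) ≤ iterBound P K S (c₁ * 2 ^ j) ρ η c₁ (2 * kappa1 P K S) / 4 := by
  obtain ⟨k, hk, htest⟩ := hP.exists_passesErgodicTest hS hc₁ (h.le_c hc₁) hρ hη h.traj
    h.mem_dom h.norm_le h.mem_range
  rw [h.c_eq] at hk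
  refine le_trans ?_ hk
  by_contra! hlt
  exact h.not_returns k (by exact_mod_cast hlt) (Or.inr htest)

theorem count_le (h : CallInvariant P K S ρ η c₁ N s j x p) (hP : Assumptions P K)
    (hS : S.Admissible K) (hc₁ : 0 < c₁) (hρ : 0 < ρ) (hη : 0 < η) :
    (N : ℝ) ≤ totalBound P K S c₁ (min ρ η) := by
  have hle : ∀ i : ℕ, iterBound P K S (c₁ * 2 ^ i) ρ η c₁ (2 * kappa1 P K S) / 4 ≤
      T1 P K S c₁ / 4 * ((2 : ℝ) ^ i / min ρ η ^ 2 + ((2 : ℝ) ^ i) ^ 2) := by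
    intro i
    have := hP.iterBound_le hS hc₁ hρ hη (r := 2 ^ i) (one_le_pow₀ (by norm_num))
    linarith
  have h1 : (N : ℝ) ≤ ∑ i ∈ Finset.range (j + 1),
      iterBound P K S (c₁ * 2 ^ i) ρ η c₁ (2 * kappa1 P K S) / 4 := by
    rw [Finset.sum_range_succ]
    exact h.count.trans (add_le_add_right (h.k_le hP hS hc₁ hρ hη) _)
  refine h1.trans ((Finset.sum_le_sum fun i _ => hle i).trans ?_)
  exact sum_call_cost_le (hP.one_le_T1 hS hc₁) hc₁ (lt_min hρ hη) j
    (h.previous.imp_right fun h' => h'.trans_le (hle _))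

/-- An unsuccessful call has a small penalty parameter. -/
theorem c_cube_lt (h : CallInvariant P K S ρ η c₁ N s j x p) (hP : Assumptions P K)
    (hS : S.Admissible K) (hc₁ : 0 < c₁) (hρ : 0 < ρ) (hη : 0 < η)
    (hret : s.Returns P S ρ η) (hns : ¬ s.Successful P S ρ η) :
    s.c ^ 3 < iterBound P K S (c₁ * 2 ^ j) ρ η c₁ (2 * kappa1 P K S) / 4 := by
  refine lt_of_lt_of_le ?_ (h.k_le hP hS hc₁ hρ hη)
  by_contra! hle
  obtain ⟨i, hi1, hik, hv, hf⟩ :=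
    (hret.resolve_left hns).exists_successful hρ hη hle
  -- A successful index would have ended the call there: at the current index this contradicts
  -- `hns`, at an earlier one the absence of a return.
  rcases hik.eq_or_lt with rfl | hlt
  · exact hns ⟨hi1, hv, hf⟩
  · refine h.not_returns i hlt (Or.inl ⟨hi1, ?_, ?_⟩)
    · rw [State.v_eq] at hv ⊢
      rwa [h.x_eq i hik, h.x_eq (i - 1) ((Nat.sub_le _ _).trans hik)] at hv
    · rwa [h.x_eq i hik] at hf

/-- The invariant holds at the start of a call. -/
theorem exists_start (hP : Assumptions P K) (hS : S.Admissible K) {c : ℝ} (hc₁ : 0 < c₁)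
    (hc : c = c₁ * 2 ^ j) {z : Blocks n} (hz : z ∈ P.dom) {p₀ : EuclideanSpace ℝ (Fin l)}
    (hp₀ : ‖p₀‖ ≤ kappa1 P K S * c) (hpr : p₀ ∈ Set.range P.A)
    (hN : (N : ℝ) ≤ ∑ i ∈ Finset.range j,
      iterBound P K S (c₁ * 2 ^ i) ρ η c₁ (2 * kappa1 P K S) / 4)
    (hprev : j = 0 ∨ (c₁ * 2 ^ (j - 1)) ^ 3 <
      iterBound P K S (c₁ * 2 ^ (j - 1)) ρ η c₁ (2 * kappa1 P K S) / 4) :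
    ∃ x p, CallInvariant P K S ρ η c₁ N (State.start c z p₀) j x p := by
  have hc0 : 0 < c := by rw [hc]; positivity
  obtain ⟨x, p, hT, hx, hp⟩ := hP.exists_trajectory hS hc0 hz p₀
  subst hx hp
  exact ⟨x, p, {
    c_eq := hc
    traj := hT
    mem_dom := hz
    norm_le := hp₀
    mem_range := hpr
    x_eq := fun i hi => by rw [Nat.le_zero.1 hi]; rfl
    p_eq := fun i hi => by rw [Nat.le_zero.1 hi]; rfl
    not_returns := fun i hi => absurd hi (Nat.not_lt_zero i)
    count := by simpa [State.start] using hN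
    previous := hprev }⟩

/-- The invariant is preserved by an iteration of the static method. -/
theorem next (h : CallInvariant P K S ρ η c₁ N s j x p) (hP : Assumptions P K)
    (hS : S.Admissible K) (hc₁ : 0 < c₁) {y : Blocks n} (hret : ¬ s.Returns P S ρ η)
    (hy : IsProxSweep P S s.c (s.x s.k) (s.p s.k) y) :
    CallInvariant P K S ρ η c₁ (N + 1) (s.next P S y) j x p := by
  have hpk := h.p_eq s.k le_rfl
  have hsw : IsProxSweep P S s.c (s.x s.k) (s.p s.k) (x (s.k + 1)) := by
    rw [h.x_eq s.k le_rfl, hpk]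
    exact h.traj.sweep s.k
  have hyx : y = x (s.k + 1) :=
    -- Uniqueness of the sweep identifies the actual iterate with that of the infinite sequence.
    ExistsUnique.unique
      (hP.existsUnique_sweep hS (h.c_pos hc₁).le (h.state_mem_dom hP hS) (s.p s.k)) hy hsw
  have hcongr : s.Returns P S ρ η ↔ (State.mk s.c s.k x p).Returns P S ρ η :=
    State.returns_congr (s := s) (s' := State.mk s.c s.k x p) rfl rfl h.x_eq
  have hx' : ∀ i ≤ s.k + 1, Function.update s.x (s.k + 1) y i = x i := by
    intro i hi
    rcases hi.eq_or_lt with rfl | hlt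
    · rw [Function.update_self, hyx]
    · rw [Function.update_of_ne hlt.ne]
      exact h.x_eq i (by omega)
  have hp' : ∀ i ≤ s.k + 1, Function.update s.p (s.k + 1)
      ((1 - S.theta) • s.p s.k + (S.chi * s.c) • (P.A y - P.d)) i = p i := by
    intro i hi
    rcases hi.eq_or_lt with rfl | hlt
    · rw [Function.update_self, h.traj.dual, ← hyx, ← hpk]
    · rw [Function.update_of_ne hlt.ne]
      exact h.p_eq i (by omega)
  have hr' : ∀ i < s.k + 1, ¬ (State.mk s.c i x p).Returns P S ρ η := by
    intro i hi
    rcases (Nat.lt_succ_iff.1 hi).eq_or_lt with rfl | hlt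
    · exact fun hr => hret (hcongr.2 hr)
    · exact h.not_returns i hlt
  have hN := h.count
  exact ⟨h.c_eq, h.traj, h.mem_dom, h.norm_le, h.mem_range, hx', hp', hr',
    by simp only [State.next]; push_cast; linarith, h.previous⟩

/-- The invariant is restored by a new call. -/
theorem exists_newCall (h : CallInvariant P K S ρ η c₁ N s j x p) (hP : Assumptions P K)
    (hS : S.Admissible K) (hc₁ : 0 < c₁) (hρ : 0 < ρ) (hη : 0 < η)
    (hret : s.Returns P S ρ η) (hns : ¬ s.Successful P S ρ η) :
    ∃ x' p', CallInvariant P K S ρ η c₁ N (State.start (2 * s.c) (s.x s.k) (s.p s.k)) (j + 1)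
      x' p' := by
  have hc := h.c_pos hc₁
  have hpk := h.p_eq s.k le_rfl
  have hk1 := hP.kappa1_nonneg hS
  refine exists_start hP hS hc₁ (by rw [h.c_eq, pow_succ]; ring) (h.state_mem_dom hP hS) ?_ ?_ ?_
    (Or.inr ?_)
  · rw [hpk]
    refine (hP.norm_trajectory_le hS hc h.traj h.mem_dom h.norm_le s.k).trans ?_
    -- The inherited multiplier is bounded by `κ₁ c ≤ κ₁ (2 c)`, so the warm start is admissible for
    -- the doubled penalty.
    exact mul_le_mul_of_nonneg_left (by linarith) hk1
  · rw [hpk]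
    exact hP.trajectory_mem_range h.traj h.mem_range s.k
  · rw [Finset.sum_range_succ]
    linarith [h.count, h.k_le hP hS hc₁ hρ hη]
  · have := h.c_cube_lt hP hS hc₁ hρ hη hret hns
    rw [Nat.add_sub_cancel, ← h.c_eq]
    rwa [← h.c_eq] at this

end CallInvariant

theorem Reach.exists_callInvariant (hP : Assumptions P K) (hS : S.Admissible K) {ρ η c₁ : ℝ}
    (hc₁ : 0 < c₁) (hρ : 0 < ρ) (hη : 0 < η) {z₀ : Blocks n} (hz₀ : z₀ ∈ P.dom) {N : ℕ}
    {s : State n l} (h : Reach P S ρ η c₁ z₀ N s) :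
    ∃ j x p, CallInvariant P K S ρ η c₁ N s j x p := by
  induction h with
  | init =>
    refine ⟨0, CallInvariant.exists_start hP hS hc₁ (by simp) hz₀ ?_ ⟨0, map_zero _⟩ (by simp)
      (Or.inl rfl)⟩
    rw [norm_zero]
    exact mul_nonneg (hP.kappa1_nonneg hS) hc₁.le
  | iterate _ hret hy ih =>
    obtain ⟨j, x, p, h⟩ := ih
    exact ⟨j, x, p, h.next hP hS hc₁ hret hy⟩
  | newCall _ hret hns ih =>
    obtain ⟨j, x, p, h⟩ := ih
    exact ⟨j + 1, h.exists_newCall hP hS hc₁ hρ hη hret hns⟩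

theorem State.not_returns_start (c : ℝ) (z : Blocks n) (p : EuclideanSpace ℝ (Fin l)) (ρ η : ℝ) :
    ¬ (State.start c z p).Returns P S ρ η := by
  rintro (h | h)
  · exact absurd h.1 (by simp [State.start])
  · exact absurd h.2.1 (by simp [State.start])

/-! ### Stopping and stationarity of the output -/

namespace Assumptions

theorem existsUnique_sweep_of_reach (hP : Assumptions P K) (hS : S.Admissible K) {ρ η c₁ : ℝ}
    (hc₁ : 0 < c₁) (hρ : 0 < ρ) (hη : 0 < η) {z₀ : Blocks n} (hz₀ : z₀ ∈ P.dom) {N : ℕ}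
    {s : State n l} (h : Reach P S ρ η c₁ z₀ N s) :
    ∃! y, IsProxSweep P S s.c (s.x s.k) (s.p s.k) y := by
  obtain ⟨j, x, p, hI⟩ := h.exists_callInvariant hP hS hc₁ hρ hη hz₀
  exact hP.existsUnique_sweep hS (hI.c_pos hc₁).le (hI.state_mem_dom hP hS) _

theorem reach_count_le (hP : Assumptions P K) (hS : S.Admissible K) {ρ η c₁ : ℝ}
    (hc₁ : 0 < c₁) (hρ : 0 < ρ) (hη : 0 < η) {z₀ : Blocks n} (hz₀ : z₀ ∈ P.dom) {N : ℕ}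
    {s : State n l} (h : Reach P S ρ η c₁ z₀ N s) :
    (N : ℝ) ≤ totalBound P K S c₁ (min ρ η) := by
  obtain ⟨j, x, p, hI⟩ := h.exists_callInvariant hP hS hc₁ hρ hη hz₀
  exact hI.count_le hP hS hc₁ hρ hη

/-- If success never occurred, states with arbitrarily large iteration count would be reachable,
against `reach_count_le`. New calls do not raise the count but cannot follow one another forever,
since a freshly started call never returns before its first iteration. -/
theorem exists_reach_successful (hP : Assumptions P K) (hS : S.Admissible K) {ρ η c₁ : ℝ}
    (hc₁ : 0 < c₁) (hρ : 0 < ρ) (hη : 0 < η) {z₀ : Blocks n} (hz₀ : z₀ ∈ P.dom) :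
    ∃ (N : ℕ) (s : State n l), Reach P S ρ η c₁ z₀ N s ∧ s.Successful P S ρ η := by
  by_contra! hno
  have hall : ∀ N : ℕ, ∃ s : State n l, Reach P S ρ η c₁ z₀ N s := by
    intro N
    induction N with
    | zero => exact ⟨_, Reach.init⟩
    | succ N ih =>
      obtain ⟨s, hs⟩ := ih
      obtain ⟨s', hs', hret⟩ : ∃ s' : State n l, Reach P S ρ η c₁ z₀ N s' ∧
          ¬ s'.Returns P S ρ η := by
        by_cases hret : s.Returns P S ρ η
        · exact ⟨_, Reach.newCall hs hret (hno N s hs), State.not_returns_start _ _ _ _ _⟩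
        · exact ⟨s, hs, hret⟩
      obtain ⟨y, hy, -⟩ := hP.existsUnique_sweep_of_reach hS hc₁ hρ hη hz₀ hs'
      exact ⟨_, Reach.iterate hs' hret hy⟩
  obtain ⟨N, hN⟩ := exists_nat_gt (totalBound P K S c₁ (min ρ η))
  obtain ⟨s, hs⟩ := hall N
  exact absurd (hP.reach_count_le hS hc₁ hρ hη hz₀ hs) (not_le.2 hN)

theorem isStationaryPair_of_sweep (hP : Assumptions P K) (hS : S.Admissible K) {c ρ η : ℝ}
    {x y : Blocks n} {p} (hx : x ∈ P.dom) (hy : IsProxSweep P S c x p y)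
    (hv : ‖sweepResidual P S c x y‖ ≤ ρ) (hf : ‖P.A y - P.d‖ ≤ η) :
    P.IsStationaryPair ρ η y ((1 - S.theta) • p + c • (P.A y - P.d)) := by
  have hyd := hP.sweep_mem_dom hS hx hy
  set q := (1 - S.theta) • p + c • (P.A y - P.d) with hq
  refine ⟨hyd, ?_, hf⟩
  have hsub : sweepResidual P S c x y - P.grad y - ContinuousLinearMap.adjoint P.A q ∈
      subdiff P.h y := by
    intro u
    by_cases hu : u ∈ P.dom
    · rw [← hP.coe_toReal_h hyd, ← hP.coe_toReal_h hu, ← EReal.coe_add, EReal.coe_le_coe_iff]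
      exact hP.sweep_subgradient hS hx hy hu
    · rw [hP.h_eq_top hu]
      exact le_top
  -- With this subgradient, `∇f + A^*q + ξ` is exactly the residual.
  refine (Metric.infEDist_le_edist_of_mem (Set.mem_image_of_mem _ hsub)).trans ?_
  rw [edist_dist, dist_zero_left]
  refine ENNReal.ofReal_le_ofReal (le_trans (le_of_eq ?_) hv)
  congr 1
  abel

theorem isStationaryPair_of_reach (hP : Assumptions P K) (hS : S.Admissible K) {ρ η c₁ : ℝ}
    (hc₁ : 0 < c₁) (hρ : 0 < ρ) (hη : 0 < η) {z₀ : Blocks n} (hz₀ : z₀ ∈ P.dom) {N : ℕ}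
    {s : State n l} (h : Reach P S ρ η c₁ z₀ N s) (hs : s.Successful P S ρ η) :
    P.IsStationaryPair ρ η (s.x s.k) (s.q P S s.k) := by
  obtain ⟨j, x, p, hI⟩ := h.exists_callInvariant hP hS hc₁ hρ hη hz₀
  obtain ⟨hk, hv, hf⟩ := hs
  obtain ⟨i, hi⟩ : ∃ i, s.k = i + 1 := ⟨s.k - 1, by omega⟩
  have hsw := hI.traj.sweep i
  have hxd := hP.trajectory_mem_dom hS hI.traj hI.mem_dom i
  rw [← hI.x_eq i (by omega)] at hxd
  rw [← hI.x_eq i (by omega), ← hI.p_eq i (by omega), ← hI.x_eq (i + 1) (by omega)] at hsw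
  rw [State.v_eq] at hv
  unfold State.q
  rw [hi] at hv hf ⊢
  simp only [Nat.add_sub_cancel] at hv ⊢
  exact hP.isStationaryPair_of_sweep hS hxd hsw hv hf

end Assumptions

end DPADMM

end

theorem theorem2p2 {B l : ℕ} {n : Fin B → ℕ} (P : DPADMM.Problem B n l) (K : DPADMM.Moduli n)
    (S : DPADMM.Params) (hP : DPADMM.Assumptions P K) (hS : S.Admissible K)
    (c₁ : ℝ) (hc₁ : 0 < c₁) :
    (∀ (ρ η : ℝ) (z₀ : DPADMM.Blocks n), 0 < ρ → ρ < 1 → 0 < η → η < 1 → z₀ ∈ P.dom →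
      -- every iteration the method asks for can be carried out, in exactly one way
      (∀ (N : ℕ) (s : DPADMM.State n l), DPADMM.Reach P S ρ η c₁ z₀ N s →
        ¬ s.Returns P S ρ η → ∃! y, DPADMM.IsProxSweep P S s.c (s.x s.k) (s.p s.k) y) ∧
      -- the total number of static iterations never exceeds the bound
      (∀ (N : ℕ) (s : DPADMM.State n l), DPADMM.Reach P S ρ η c₁ z₀ N s →
        (N : ℝ) ≤ DPADMM.totalBound P K S c₁ (min ρ η)) ∧
      -- the method stops
      (∃ (N : ℕ) (s : DPADMM.State n l), DPADMM.Reach P S ρ η c₁ z₀ N s ∧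
        s.Successful P S ρ η) ∧
      -- whenever it stops, its output is a `(ρ, η)`-stationary pair
      (∀ (N : ℕ) (s : DPADMM.State n l), DPADMM.Reach P S ρ η c₁ z₀ N s →
        s.Successful P S ρ η → P.IsStationaryPair ρ η (s.x s.k) (s.q P S s.k))) ∧
    -- the complexity is `O(ε⁻³)`, with a constant independent of the tolerances and of `z₀`
    (∃ C : ℝ, ∀ (ρ η : ℝ) (z₀ : DPADMM.Blocks n), 0 < ρ → ρ < 1 → 0 < η → η < 1 → z₀ ∈ P.dom →
      ∀ (N : ℕ) (s : DPADMM.State n l), DPADMM.Reach P S ρ η c₁ z₀ N s →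
        (N : ℝ) ≤ C / (min ρ η) ^ 3) := by
  refine ⟨fun ρ η z₀ hρ _ hη _ hz₀ => ⟨fun N s hs _ =>
      hP.existsUnique_sweep_of_reach hS hc₁ hρ hη hz₀ hs, fun N s hs =>
      hP.reach_count_le hS hc₁ hρ hη hz₀ hs, hP.exists_reach_successful hS hc₁ hρ hη hz₀,
      fun N s hs hsucc => hP.isStationaryPair_of_reach hS hc₁ hρ hη hz₀ hs hsucc⟩,
    -- The constant is the total bound at `ε = 1`: for `ε ≤ 1` each power of `1/ε` in it is at most
    -- `ε⁻³`.
    DPADMM.totalBound P K S c₁ 1, fun ρ η z₀ hρ hρ1 hη _ hz₀ N s hs => ?_⟩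
  refine (hP.reach_count_le hS hc₁ hρ hη hz₀ hs).trans ?_
  have hT := hP.one_le_T1 hS hc₁
  have hE0 : 0 ≤ DPADMM.E0 P K S c₁ := by unfold DPADMM.E0; positivity
  have hE1 : 0 ≤ DPADMM.E1 P K S c₁ := by unfold DPADMM.E1; positivity
  have hε : 0 < min ρ η := lt_min hρ hη
  have hε1 : min ρ η ≤ 1 := (min_le_left _ _).trans hρ1.le
  set ε := min ρ η
  unfold DPADMM.totalBound
  rw [mul_div_assoc]
  refine mul_le_mul_of_nonneg_left ?_ (by linarith)
  rw [one_pow, one_pow, div_one, div_one, add_div _ (DPADMM.E1 P K S c₁),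
    add_div (2 * DPADMM.E0 P K S c₁ ^ 2)]
  have h3 : ε ^ 3 ≤ 1 := pow_le_one₀ hε.le hε1
  have h32 : ε ^ 3 ≤ ε ^ 2 := pow_le_pow_of_le_one hε.le hε1 (by norm_num)
  have a1 : 2 * DPADMM.E0 P K S c₁ ^ 2 ≤ 2 * DPADMM.E0 P K S c₁ ^ 2 / ε ^ 3 := by
    rw [le_div_iff₀ (by positivity)]
    exact mul_le_of_le_one_right (by positivity) h3
  have a2 : (DPADMM.E0 P K S c₁ + 2 * DPADMM.E1 P K S c₁ ^ 2) / ε ^ 2 ≤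
      (DPADMM.E0 P K S c₁ + 2 * DPADMM.E1 P K S c₁ ^ 2) / ε ^ 3 := by
    gcongr
  linarith
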